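/- **Setting.** Let $(X,\omega)$ be a compact smooth symplectic manifold with a smooth action of a compact connected Lie group $G$, let $\langle\cdot,\cdot\rangle$ be an $\mathrm{Ad}$-invariant inner product on the Lie algebra $\mathfrak g$, and for $\xi\in\mathfrak g$ let $X_\xi$ be the vector field on $X$ generated by $\xi$. Let $\mu:X\to\mathfrak g$ be a smooth moment map: $\mu(gx)=\mathrm{Ad}_g\mu(x)$ and $\omega(X_\xi,\cdot)=\langle d\mu(\cdot),\xi\rangle$. Assume that $0$ is a regular value of $\mu$. Let $J$ be a smooth $G$-invariant $\omega$-compatible almost complex structure, with metric $|v|^2=\omega(v,Jv)$. Let $S^1=\mathbb R/2\pi\mathbb Z$, and fix a distance on $X$ that induces its topology (for instance a Riemannian one). **Vortices.** Let $h=\lambda\,(dt^2+d\theta^2)$, with $\lambda>0$ smooth, be any Kähler metric on $[t_0,\infty)\times S^1$. A temporal symplectic vortex is a pair $w=(u,\eta)$ of smooth maps $u:[t_0,\infty)\times S^1\to X$, $\eta:[t_0,\infty)\times S^1\to\mathfrak g$ that satisfies the vortex equations $\bar\partial_A u=0$, $F_A+*_h\mu(u)=0$ for the connection $A=\eta\,d\theta$,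 that is, $$\partial_tu+J\big(\partial_\theta u+X_\eta(u)\big)=0,\qquad \partial_t\eta+\lambda\,\mu(u)=0 .$$ Its Yang–Mills–Higgs energy is $E(w;[t_1,t_2]\times S^1)=\int_{[t_1,t_2]\times S^1}\frac12\big(|d_Au|_h^2+|F_A|_h^2+|\mu(u)|^2\big)\,\nu_h$, where $d_Au=\partial_tu\,dt+(\partial_\theta u+X_\eta(u))\,d\theta$ and $F_A=\partial_t\eta\,dt\wedge d\theta$. **Cappings and local action.** Let $\rho>0$. A capping of size $\rho$ of a loop $x:S^1\to X$ is a map $c$ on the disk $D(2)$ of radius $2$, given in polar coordinates as a continuous map $c:[0,2]\times[0,2\pi]\to X$, smooth on $[0,1]\times[0,2\pi]$ and on $[1,2]\times[0,2\pi]$, with $c(s,2\pi)=c(s,0)$, such that $c(2,\theta)=x(\theta)$, such that $c$ maps $[0,1]\times[0,2\pi]$ into $\mu^{-1}(0)$, and such that for some $z_0\in X$ and some smooth $g:[0,2\pi]\to G$ with $g(0)=e$ one has $c(0,\theta)=g(\theta)z_0$ and $\mathrm{dist}\big(g(\theta)^{-1}c(s,\theta),z_0\big)<\rho$ for all $s,\theta$.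 (For $g\equiv e$ this is a usual disk; in general the centre of the disk is blown up to a loop in the orbit of $z_0$.) For $w=(u,\eta)$ and $t\ge t_0$ put $$\mathcal L_w(t)=-\int_{[0,2]\times[0,2\pi]}c^*\omega+\int_{S^1}\langle\mu(u(t,\theta)),\eta(t,\theta)\rangle\,d\theta ,$$ where $c$ is a capping of size $\rho$ of the loop $u(t,\cdot)$, and the orientation is $ds\wedge d\theta$. **Proposition.** There is $\rho_0>0$ such that for every $0<\rho\le\rho_0$ there is $\varepsilon>0$, where $\rho_0$ and $\varepsilon$ depend only on the data of the setting (and $\varepsilon$ on $\rho$), with the following property. For every $t_0$, every metric $h$ as above and every temporal symplectic vortex $w=(u,\eta)$ on $[t_0,\infty)\times S^1$ with $$|\partial_\theta u+X_\eta(u)|\le\varepsilon,\qquad|\mu(u)|\le\varepsilon\qquad\text{on }[t_0,\infty)\times S^1 :$$ 1. for every $t\ge t_0$ the loop $u(t,\cdot)$ has a capping of size $\rho$, and $\mathcal L_w(t)$ does not depend on its choice; 2. for all $t_0\le t_1\le t_2$, the energy density is integrable over $[t_1,t_2]\times S^1$ and $E(w;[t_1,t_2]\times S^1)=\mathcal L_w(t_1)-\mathcal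 L_w(t_2)$; 3. $\mathcal L_w(\infty):=\lim_{t\to\infty}\mathcal L_w(t)$ exists and equals $0$. -/

import Mathlib

open Set Filter MeasureTheory
open scoped Manifold ContDiff Topology

noncomputable section

namespace SympVortex

section Action

variable {F : Type*} [NormedAddCommGroup F] [NormedSpace ℝ F]
  {E : Type*} [NormedAddCommGroup E] [NormedSpace ℝ E]
  (G : Type*) [TopologicalSpace G] [ChartedSpace F G] [Group G]
  {X : Type*} [TopologicalSpace X] [ChartedSpace E X] [MulAction G X]

/-- The infinitesimal action `L_x : 𝔤 → T_x X`, `L_x ξ = X_ξ(x)`, the derivative at the unit of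
`g ↦ g • x`. The Lie algebra `𝔤 = T_1 G` has the model space `F` as underlying vector space. -/
def infAction (x : X) : F →L[ℝ] TangentSpace 𝓘(ℝ, E) x :=
  (mfderiv 𝓘(ℝ, F) 𝓘(ℝ, E) (fun g : G => g • x) 1 :
    TangentSpace 𝓘(ℝ, F) (1 : G) →L[ℝ] TangentSpace 𝓘(ℝ, E) ((1 : G) • x))

variable {G} in
/-- The adjoint action of `g` on `𝔤 = T_1 G`, the derivative at the unit of `h ↦ g h g⁻¹`. -/
def Ad (g : G) : F →L[ℝ] F :=
  (mfderiv 𝓘(ℝ, F) 𝓘(ℝ, F) (fun h : G => g * h * g⁻¹) 1 :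
    TangentSpace 𝓘(ℝ, F) (1 : G) →L[ℝ] TangentSpace 𝓘(ℝ, F) (g * 1 * g⁻¹))

/-- The Lie bracket of `𝔤 = T_1 G` (through left invariant vector fields). -/
def lieBr (ξ ζ : F) : F :=
  (fun v w : GroupLieAlgebra 𝓘(ℝ, F) G => (⁅v, w⁆ : GroupLieAlgebra 𝓘(ℝ, F) G)) ξ ζ

end Action

section Geometry

variable {E : Type*} [NormedAddCommGroup E] [NormedSpace ℝ E]
  {X : Type*} [TopologicalSpace X] [ChartedSpace E X]

/-- The coefficient `y ↦ ω(∂_a, ∂_b)` of a two-form in the chart at `x₀`. -/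
def formInChart
    (omega : ∀ x : X, TangentSpace 𝓘(ℝ, E) x →L[ℝ] TangentSpace 𝓘(ℝ, E) x →L[ℝ] ℝ)
    (x₀ : X) (a b : E) (y : E) : ℝ :=
  omega ((extChartAt 𝓘(ℝ, E) x₀).symm y)
    (mfderiv 𝓘(ℝ, E) 𝓘(ℝ, E) (extChartAt 𝓘(ℝ, E) x₀).symm y a)
    (mfderiv 𝓘(ℝ, E) 𝓘(ℝ, E) (extChartAt 𝓘(ℝ, E) x₀).symm y b)

/-- `dω = 0`, in the charts. -/
def IsClosedForm
    (omega : ∀ x : X, TangentSpace 𝓘(ℝ, E) x →L[ℝ] TangentSpace 𝓘(ℝ, E) x →L[ℝ] ℝ) : Prop :=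
  ∀ x₀ : X, ∀ y ∈ (extChartAt 𝓘(ℝ, E) x₀).target, ∀ a b c : E,
    fderiv ℝ (formInChart omega x₀ b c) y a + fderiv ℝ (formInChart omega x₀ c a) y b
      + fderiv ℝ (formInChart omega x₀ a b) y c = 0

end Geometry

/-- A Hamiltonian action of the Lie group `G` on the symplectic manifold `(X, ω)` with moment map
`μ`, together with a `G`-invariant `ω`-compatible almost complex structure `J`, such that `0` is a
regular value of `μ`. The inner product `ip` on `𝔤` is the invariant one that identifies `𝔤` with
its dual. -/
structure HamiltonianSpace
    (F : Type*) [NormedAddCommGroup F] [NormedSpace ℝ F]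
    (E : Type*) [NormedAddCommGroup E] [NormedSpace ℝ E]
    (G : Type*) [TopologicalSpace G] [ChartedSpace F G] [Group G] [LieGroup 𝓘(ℝ, F) ∞ G]
    (X : Type*) [TopologicalSpace X] [ChartedSpace E X] [IsManifold 𝓘(ℝ, E) ∞ X]
    [MulAction G X] [ContMDiffSMul 𝓘(ℝ, F) 𝓘(ℝ, E) ∞ G X] where
  /-- the symplectic form -/
  omega : ∀ x : X, TangentSpace 𝓘(ℝ, E) x →L[ℝ] TangentSpace 𝓘(ℝ, E) x →L[ℝ] ℝ
  /-- the almost complex structure -/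
  J : ∀ x : X, TangentSpace 𝓘(ℝ, E) x →L[ℝ] TangentSpace 𝓘(ℝ, E) x
  /-- the invariant inner product on `𝔤` -/
  ip : F →L[ℝ] F →L[ℝ] ℝ
  /-- the moment map -/
  μ : X → F
  omega_smooth : ContMDiff 𝓘(ℝ, E) (𝓘(ℝ, E).prod 𝓘(ℝ, E →L[ℝ] E →L[ℝ] ℝ)) ∞
    (fun x => Bundle.TotalSpace.mk' (E →L[ℝ] E →L[ℝ] ℝ)
      (E := fun x : X => TangentSpace 𝓘(ℝ, E) x →L[ℝ] TangentSpace 𝓘(ℝ, E) x →L[ℝ] ℝ) x (omega x))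
  omega_alt : ∀ x v, omega x v v = 0
  omega_nondeg : ∀ x v, (∀ w, omega x v w = 0) → v = 0
  omega_closed : IsClosedForm omega
  J_smooth : ContMDiff 𝓘(ℝ, E) (𝓘(ℝ, E).prod 𝓘(ℝ, E →L[ℝ] E)) ∞
    (fun x => Bundle.TotalSpace.mk' (E →L[ℝ] E)
      (E := fun x : X => TangentSpace 𝓘(ℝ, E) x →L[ℝ] TangentSpace 𝓘(ℝ, E) x) x (J x))
  J_sq : ∀ x v, J x (J x v) = -v
  J_compat : ∀ x v w, omega x (J x v) (J x w) = omega x v w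
  J_pos : ∀ x v, v ≠ 0 → 0 < omega x v (J x v)
  J_invariant : ∀ (g : G) (x : X) (v : TangentSpace 𝓘(ℝ, E) x),
    mfderiv 𝓘(ℝ, E) 𝓘(ℝ, E) (fun y : X => g • y) x (J x v)
      = J (g • x) (mfderiv 𝓘(ℝ, E) 𝓘(ℝ, E) (fun y : X => g • y) x v)
  ip_symm : ∀ ξ ζ, ip ξ ζ = ip ζ ξ
  ip_pos : ∀ ξ, ξ ≠ 0 → 0 < ip ξ ξ
  ip_invariant : ∀ (g : G) ξ ζ, ip (Ad g ξ) (Ad g ζ) = ip ξ ζ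
  μ_smooth : ContMDiff 𝓘(ℝ, E) 𝓘(ℝ, F) ∞ μ
  μ_equivariant : ∀ (g : G) (x : X), μ (g • x) = Ad g (μ x)
  μ_hamiltonian : ∀ (x : X) (ξ : F) (v : TangentSpace 𝓘(ℝ, E) x),
    omega x (infAction G x ξ) v = ip (mfderiv 𝓘(ℝ, E) 𝓘(ℝ, F) μ x v) ξ
  μ_regular : ∀ x, μ x = 0 → Function.Surjective (mfderiv 𝓘(ℝ, E) 𝓘(ℝ, F) μ x)

section Vortices

variable {F : Type*} [NormedAddCommGroup F] [NormedSpace ℝ F]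
  {E : Type*} [NormedAddCommGroup E] [NormedSpace ℝ E]
  {G : Type*} [TopologicalSpace G] [ChartedSpace F G] [Group G] [LieGroup 𝓘(ℝ, F) ∞ G]
  {X : Type*} [TopologicalSpace X] [ChartedSpace E X] [IsManifold 𝓘(ℝ, E) ∞ X]
  [MulAction G X] [ContMDiffSMul 𝓘(ℝ, F) 𝓘(ℝ, E) ∞ G X]

/-- The half-cylinder `[t₀, ∞) × S¹`, `S¹ = ℝ / 2πℤ`, through its universal cover: objects on it
are objects on `[t₀, ∞) × ℝ` that are `2π`-periodic in the second variable. -/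
def halfCyl (t₀ : ℝ) : Set (ℝ × ℝ) := Ici t₀ ×ˢ univ

/-- `f` descends to the half-cylinder. -/
def IsPeriodic {α : Type*} (t₀ : ℝ) (f : ℝ × ℝ → α) : Prop :=
  ∀ t θ : ℝ, t₀ ≤ t → f (t, θ + 2 * Real.pi) = f (t, θ)

/-- `lam (dt² + dθ²)` is a smooth Kähler metric on the half-cylinder with its standard complex
structure; every Kähler metric there has this form. -/
structure IsConformalFactor (t₀ : ℝ) (lam : ℝ × ℝ → ℝ) : Prop where
  smooth : ContDiffOn ℝ ∞ lam (halfCyl t₀)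
  pos : ∀ p ∈ halfCyl t₀, 0 < lam p
  periodic : IsPeriodic t₀ lam

/-- The norm of `𝔤`. -/
def HamiltonianSpace.normLie (D : HamiltonianSpace F E G X) (ξ : F) : ℝ := √(D.ip ξ ξ)

/-- The norm of the metric `ω(·, J ·)`. -/
def HamiltonianSpace.normTan (D : HamiltonianSpace F E G X) (x : X)
    (v : TangentSpace 𝓘(ℝ, E) x) : ℝ := √(D.omega x v (D.J x v))

variable (G) in
/-- The component `d_A u(e) = ∂_e u + X_{A(e)}(u)` of the covariant derivative in the coordinate
direction `e`, where `a = A(e)`. -/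
def covDeriv (t₀ : ℝ) (u : ℝ × ℝ → X) (a : ℝ × ℝ → F) (e : ℝ × ℝ) (p : ℝ × ℝ) :
    TangentSpace 𝓘(ℝ, E) (u p) :=
  mfderivWithin 𝓘(ℝ, ℝ × ℝ) 𝓘(ℝ, E) u (halfCyl t₀) p e + infAction G (u p) (a p)

variable (G) in
/-- The curvature of `A = a₁ dt + a₂ dθ` is `curv dt ∧ dθ`. -/
def curv (t₀ : ℝ) (a₁ a₂ : ℝ × ℝ → F) (p : ℝ × ℝ) : F :=
  fderivWithin ℝ a₂ (halfCyl t₀) p (1, 0) - fderivWithin ℝ a₁ (halfCyl t₀) p (0, 1)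
    + lieBr G (a₁ p) (a₂ p)

/-- `(u, A)`, `A = a₁ dt + a₂ dθ`, is a symplectic vortex on the (trivial bundle over the)
half-cylinder with the metric `h = lam (dt² + dθ²)`: it is smooth, `∂̄_A u = 0` and
`F_A + *_h μ(u) = 0`. -/
structure IsVortex (D : HamiltonianSpace F E G X) (t₀ : ℝ) (lam : ℝ × ℝ → ℝ)
    (u : ℝ × ℝ → X) (a₁ a₂ : ℝ × ℝ → F) : Prop where
  u_smooth : ContMDiffOn 𝓘(ℝ, ℝ × ℝ) 𝓘(ℝ, E) ∞ u (halfCyl t₀)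
  a₁_smooth : ContDiffOn ℝ ∞ a₁ (halfCyl t₀)
  a₂_smooth : ContDiffOn ℝ ∞ a₂ (halfCyl t₀)
  u_periodic : IsPeriodic t₀ u
  a₁_periodic : IsPeriodic t₀ a₁
  a₂_periodic : IsPeriodic t₀ a₂
  holomorphic : ∀ p ∈ halfCyl t₀,
    covDeriv G t₀ u a₁ (1, 0) p + D.J (u p) (covDeriv G t₀ u a₂ (0, 1) p) = 0
  curvature : ∀ p ∈ halfCyl t₀, curv G t₀ a₁ a₂ p + lam p • D.μ (u p) = 0

/-- A temporal symplectic vortex: `A = η dθ`. -/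
def IsTemporalVortex (D : HamiltonianSpace F E G X) (t₀ : ℝ) (lam : ℝ × ℝ → ℝ)
    (u : ℝ × ℝ → X) (η : ℝ × ℝ → F) : Prop :=
  IsVortex D t₀ lam u (fun _ => 0) η

/-- The energy density `e = (|d_A u|² + |F_A|² + |μ(u)|²) / 2`, the norms being those of the metric
`h = lam (dt² + dθ²)`. -/
def energyDensity (D : HamiltonianSpace F E G X) (t₀ : ℝ) (lam : ℝ × ℝ → ℝ)
    (u : ℝ × ℝ → X) (a₁ a₂ : ℝ × ℝ → F) (p : ℝ × ℝ) : ℝ :=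
  (1 / 2) *
    ((lam p)⁻¹ * (D.normTan (u p) (covDeriv G t₀ u a₁ (1, 0) p) ^ 2
        + D.normTan (u p) (covDeriv G t₀ u a₂ (0, 1) p) ^ 2)
      + (lam p)⁻¹ ^ 2 * D.normLie (curv G t₀ a₁ a₂ p) ^ 2
      + D.normLie (D.μ (u p)) ^ 2)

/-- The coordinate rectangle of `[t₁, t₂] × S¹`. -/
def cylRect (t₁ t₂ : ℝ) : Set (ℝ × ℝ) := Icc t₁ t₂ ×ˢ Icc 0 (2 * Real.pi)

/-- The energy `E(w; [t₁, t₂] × S¹) = ∫ e ν_h` of the temporal pair `w = (u, η)`, where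
`ν_h = lam dt dθ`. -/
def energy (D : HamiltonianSpace F E G X) (t₀ : ℝ) (lam : ℝ × ℝ → ℝ)
    (u : ℝ × ℝ → X) (η : ℝ × ℝ → F) (t₁ t₂ : ℝ) : ℝ :=
  ∫ p in cylRect t₁ t₂, energyDensity D t₀ lam u (fun _ => 0) η p * lam p

/-- `∫ c^*ω` over the rectangle `[s₁, s₂] × [0, 2π]`, oriented by `ds ∧ dθ`. -/
def area (D : HamiltonianSpace F E G X) (c : ℝ × ℝ → X) (s₁ s₂ : ℝ) : ℝ :=
  ∫ p in cylRect s₁ s₂, D.omega (c p)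
    (mfderivWithin 𝓘(ℝ, ℝ × ℝ) 𝓘(ℝ, E) c (cylRect s₁ s₂) p (1, 0))
    (mfderivWithin 𝓘(ℝ, ℝ × ℝ) 𝓘(ℝ, E) c (cylRect s₁ s₂) p (0, 1))

/-- The action `-∫_{D(2)} c^*ω + ∫_{S¹} ⟨μ(x), η⟩ dθ` of the loop `(x, η)` with the capping `c`,
given in polar coordinates `(s, θ)` of `D(2)`. -/
def cappedAction (D : HamiltonianSpace F E G X) (c : ℝ × ℝ → X) (x : ℝ → X) (η : ℝ → F) : ℝ :=
  -(area D c 0 1 + area D c 1 2) + ∫ θ in (0 : ℝ)..(2 * Real.pi), D.ip (D.μ (x θ)) (η θ)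

end Vortices

section LocalAction

variable {F : Type*} [NormedAddCommGroup F] [NormedSpace ℝ F]
  {E : Type*} [NormedAddCommGroup E] [NormedSpace ℝ E]
  {G : Type*} [TopologicalSpace G] [ChartedSpace F G] [Group G] [LieGroup 𝓘(ℝ, F) ∞ G]
  {X : Type*} [MetricSpace X] [ChartedSpace E X] [IsManifold 𝓘(ℝ, E) ∞ X]
  [MulAction G X] [ContMDiffSMul 𝓘(ℝ, F) 𝓘(ℝ, E) ∞ G X]

/-- `c` is a capping of the loop `x`, of size `ρ`, with centre `z₀` and gauge `g : [0, 2π] → G`.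
In polar coordinates `(s, θ) ∈ [0, 2] × [0, 2π]` of the disk `D(2)`, the map `c` is piecewise
smooth with boundary `x`, it sends the inner disk `s ≤ 1` into `μ⁻¹(0)`, and after the gauge
transformation `g⁻¹` it is a map that takes the constant value `z₀` at `s = 0` and that stays in
the ball of radius `ρ` about `z₀`. As `g (2π)` need not be the unit (it only fixes `z₀`), the centre
of the disk is blown up to the loop `θ ↦ g θ • z₀`; for `g = 1` one has usual polar coordinates. -/
structure IsCapping (D : HamiltonianSpace F E G X) (ρ : ℝ) (x : ℝ → X)
    (c : ℝ × ℝ → X) (z₀ : X) (g : ℝ → G) : Prop where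
  smooth_inner : ContMDiffOn 𝓘(ℝ, ℝ × ℝ) 𝓘(ℝ, E) ∞ c (cylRect 0 1)
  smooth_outer : ContMDiffOn 𝓘(ℝ, ℝ × ℝ) 𝓘(ℝ, E) ∞ c (cylRect 1 2)
  boundary : ∀ θ ∈ Icc (0 : ℝ) (2 * Real.pi), c (2, θ) = x θ
  closed : ∀ s ∈ Icc (0 : ℝ) 2, c (s, 2 * Real.pi) = c (s, 0)
  inner_mem : ∀ p ∈ cylRect 0 1, D.μ (c p) = 0
  gauge_smooth : ContMDiffOn 𝓘(ℝ, ℝ) 𝓘(ℝ, F) ∞ g (Icc 0 (2 * Real.pi))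
  gauge_zero : g 0 = 1
  centre : ∀ θ ∈ Icc (0 : ℝ) (2 * Real.pi), c (0, θ) = g θ • z₀
  small : ∀ p ∈ cylRect 0 2, dist ((g p.2)⁻¹ • c p) z₀ < ρ

/-- The values of the action of the loop `(x, η)` on all its cappings of size `ρ`. -/
def actionValues (D : HamiltonianSpace F E G X) (ρ : ℝ) (x : ℝ → X) (η : ℝ → F) : Set ℝ :=
  {a | ∃ (c : ℝ × ℝ → X) (z₀ : X) (g : ℝ → G),
    IsCapping D ρ x c z₀ g ∧ a = cappedAction D c x η}

/-- The local action functional `𝓛_w(t)` of `w = (u, η)`: the action of the loop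
`(u(t, ·), η(t, ·))` on a capping of size `ρ`. -/
def localAction (D : HamiltonianSpace F E G X) (ρ : ℝ) (u : ℝ × ℝ → X) (η : ℝ × ℝ → F)
    (t : ℝ) : ℝ :=
  Classical.epsilon fun a =>
    a ∈ actionValues D ρ (fun θ => u (t, θ)) (fun θ => η (t, θ))

end LocalAction

end SympVortex

end

/-! Everything rests on a primitive of ω adapted to the moment map. As 0 is a regular value, the
action is locally free on μ⁻¹(0), so stabilizers there are finite, and a tube around the orbit of a
point z of μ⁻¹(0) is G ×_Γ B, where Γ is the stabilizer and B a ball in a linear slice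
(`nonempty_slice`). Scaling B contracts the tube equivariantly onto the orbit, which is isotropic.
The homotopy formula therefore yields a one-form α on the tube with dα = ω
(`Slice.hasPrimitiveAt_alpha`), and equivariance of the contraction yields α(X_ξ) = -⟨μ, ξ⟩
(`Slice.alpha_inf`).

For a loop (x, η) with a capping in the domain of α, Stokes' theorem turns the action into -∫ α(x' +
X_η) dθ; the blown-up centre contributes nothing, because it runs along an orbit inside the zero
level (`IsMomentPrimitive.cappedAction_eq`). This expression does not involve the capping, and two
cappings of the same loop lie in the domain of one α once their size is at most a third of a
Lebesgue number of a cover of μ⁻¹(0) by tubes.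

Cappings exist because the invariant radius of a tube varies along a loop only through x' + X_η. If
that is small, a loop that starts near the orbit stays in the tube, lifts to G × B with a lift that
closes up to an element of Γ, and is capped by joining the slice coordinate to 0 through its
projection to the kernel of the moment map, which is linear in the slice
(`Slice.isCapping_of_lift`).

The vortex equations identify the energy with the integral of u^*ω - ∂_t⟨μ, η⟩ dt ∧ dθ, so Stokes'
theorem with α makes it the decrease of the local action (`energy_eq_sub`). For the limit the linear
bound |𝓛(t)| ≤ C ∫ |∂_θ u + X_η| dθ is enough. The function 𝓛 is bounded and nonincreasing. If |𝓛|
stayed above δ > 0 from some time on, the Cauchy–Schwarz inequality would make the energy grow at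
least linearly in t, whatever the conformal factor, against the boundedness of 𝓛. So 𝓛 is
arbitrarily small at arbitrarily late times, and by monotonicity it tends to 0. -/

set_option linter.unusedSectionVars false

noncomputable section

namespace SympVortex

/-! ### Derivatives of charts and coordinate vector fields. -/

section Charts

variable {E : Type*} [NormedAddCommGroup E] [NormedSpace ℝ E]
  {X : Type*} [TopologicalSpace X] [ChartedSpace E X] [IsManifold 𝓘(ℝ, E) ∞ X]

/-- The derivative of the inverse of the chart at `x₀`. -/
def chartInvD (x₀ : X) (y : E) : E →L[ℝ] E :=
  mfderiv 𝓘(ℝ, E) 𝓘(ℝ, E) (extChartAt 𝓘(ℝ, E) x₀).symm y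

/-- The derivative of the chart at `x₀`. -/
def chartD (x₀ : X) (x : X) : E →L[ℝ] E :=
  mfderiv 𝓘(ℝ, E) 𝓘(ℝ, E) (extChartAt 𝓘(ℝ, E) x₀) x

/-- Smoothness of the structures on the tangent bundle is expressed in its trivializations; this
converts it into smoothness of coefficients in a chart, as in `contDiffOn_cxChart`. -/
theorem chartD_eq (x₀ : X) {x : X} (hx : x ∈ (chartAt E x₀).source) (v : E) :
    (trivializationAt E (TangentSpace 𝓘(ℝ, E)) x₀
      (Bundle.TotalSpace.mk' E (E := TangentSpace 𝓘(ℝ, E)) x v)).2 = chartD x₀ x v := by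
  have h := TangentBundle.continuousLinearMapAt_trivializationAt (I := 𝓘(ℝ, E)) hx
  have hb : x ∈ (trivializationAt E (TangentSpace 𝓘(ℝ, E) (M := X)) x₀).baseSet := by
    simpa using hx
  have h2 : ∀ v : TangentSpace 𝓘(ℝ, E) x,
      (trivializationAt E (TangentSpace 𝓘(ℝ, E)) x₀).continuousLinearMapAt ℝ x v
      = mfderiv 𝓘(ℝ, E) 𝓘(ℝ, E) (extChartAt 𝓘(ℝ, E) x₀) x v := fun v => by rw [h]; rfl
  have h3 : ∀ v : TangentSpace 𝓘(ℝ, E) x,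
      (trivializationAt E (TangentSpace 𝓘(ℝ, E)) x₀).continuousLinearMapAt ℝ x v
      = (trivializationAt E (TangentSpace 𝓘(ℝ, E)) x₀
        (Bundle.TotalSpace.mk' E (E := TangentSpace 𝓘(ℝ, E)) x v)).2 := fun v => by
    rw [Bundle.Trivialization.continuousLinearMapAt_apply,
      Bundle.Trivialization.linearMapAt_def_of_mem _ hb]
    rfl
  exact (h3 v).symm.trans (h2 v)

theorem chartInvD_eq (x₀ : X) {x : X} (hx : x ∈ (chartAt E x₀).source) (v : E) :
    (trivializationAt E (TangentSpace 𝓘(ℝ, E)) x₀).symm x v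
      = chartInvD x₀ (extChartAt 𝓘(ℝ, E) x₀ x) v := by
  have h := TangentBundle.symmL_trivializationAt (I := 𝓘(ℝ, E)) hx
  simp only [modelWithCornersSelf_coe, range_id, mfderivWithin_univ] at h
  rw [← Bundle.Trivialization.symmL_apply (R := ℝ) _ (by simpa using hx), h]
  rfl

theorem chartD_chartInvD (x₀ : X) {y : E} (hy : y ∈ (extChartAt 𝓘(ℝ, E) x₀).target) (a : E) :
    chartD x₀ ((extChartAt 𝓘(ℝ, E) x₀).symm y) (chartInvD x₀ y a) = a := by
  have := mfderiv_extChartAt_comp_mfderivWithin_extChartAt_symm (I := 𝓘(ℝ, E)) hy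
  simp only [modelWithCornersSelf_coe, range_id, mfderivWithin_univ] at this
  exact DFunLike.congr_fun this a

theorem chartInvD_chartD (x₀ : X) {x : X} (hx : x ∈ (extChartAt 𝓘(ℝ, E) x₀).source) (a : E) :
    chartInvD x₀ (extChartAt 𝓘(ℝ, E) x₀ x) (chartD x₀ x a) = a := by
  have := mfderivWithin_extChartAt_symm_comp_mfderiv_extChartAt' (I := 𝓘(ℝ, E)) hx
  simp only [modelWithCornersSelf_coe, range_id, mfderivWithin_univ] at this
  exact DFunLike.congr_fun this a

/-- The coordinate vector fields of a chart are smooth. -/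
theorem contMDiffOn_coordField (x₀ : X) (a : E) :
    ContMDiffOn 𝓘(ℝ, E) 𝓘(ℝ, E).tangent ∞
      (fun y : E => (Bundle.TotalSpace.mk' E (E := TangentSpace 𝓘(ℝ, E))
        ((extChartAt 𝓘(ℝ, E) x₀).symm y) (chartInvD x₀ y a) : TangentBundle 𝓘(ℝ, E) X))
      (extChartAt 𝓘(ℝ, E) x₀).target := by
  set e := trivializationAt E (TangentSpace 𝓘(ℝ, E) (M := X)) x₀
  have h1 : ContMDiffOn 𝓘(ℝ, E) 𝓘(ℝ, E).tangent ∞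
      (fun x : X => (Bundle.TotalSpace.mk' E (E := TangentSpace 𝓘(ℝ, E)) x
        (e.symm x a) : TangentBundle 𝓘(ℝ, E) X)) e.baseSet := by
    rw [e.contMDiffOn_section_baseSet_iff]
    refine (contMDiffOn_const (c := a)).congr fun x hx => ?_
    rw [e.apply_mk_symm hx]
  have h2 := h1.comp (contMDiffOn_extChartAt_symm (I := 𝓘(ℝ, E)) (n := ∞) x₀) (fun y hy => by
    have := (extChartAt 𝓘(ℝ, E) x₀).map_target hy
    simpa [e] using this)
  refine h2.congr fun y hy => ?_
  have hs := (extChartAt 𝓘(ℝ, E) x₀).map_target hy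
  rw [extChartAt_source] at hs
  have h3 := chartInvD_eq x₀ hs a
  rw [(extChartAt 𝓘(ℝ, E) x₀).right_inv hy] at h3
  simp only [Function.comp]
  rw [← h3]

end Charts

/-! ### The symplectic form and the almost complex structure in charts. -/

section Coefficients

variable {F : Type*} [NormedAddCommGroup F] [NormedSpace ℝ F]
  {E : Type*} [NormedAddCommGroup E] [NormedSpace ℝ E]
  {G : Type*} [TopologicalSpace G] [ChartedSpace F G] [Group G] [LieGroup 𝓘(ℝ, F) ∞ G]
  {X : Type*} [TopologicalSpace X] [ChartedSpace E X] [IsManifold 𝓘(ℝ, E) ∞ X]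
  [MulAction G X] [ContMDiffSMul 𝓘(ℝ, F) 𝓘(ℝ, E) ∞ G X]

/-- The symplectic form as a bilinear form on the model space. -/
def HamiltonianSpace.om (D : HamiltonianSpace F E G X) (x : X) : E →L[ℝ] E →L[ℝ] ℝ := D.omega x

/-- The almost complex structure as an endomorphism of the model space. -/
def HamiltonianSpace.cx (D : HamiltonianSpace F E G X) (x : X) : E →L[ℝ] E := D.J x

/-- The symplectic form in the chart at `x₀`. -/
def HamiltonianSpace.omChart (D : HamiltonianSpace F E G X) (x₀ : X) (y : E) :
    E →L[ℝ] E →L[ℝ] ℝ :=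
  (D.om ((extChartAt 𝓘(ℝ, E) x₀).symm y)).bilinearComp (chartInvD x₀ y) (chartInvD x₀ y)

/-- The almost complex structure in the chart at `x₀`. -/
def HamiltonianSpace.cxChart (D : HamiltonianSpace F E G X) (x₀ : X) (y : E) : E →L[ℝ] E :=
  (chartD x₀ ((extChartAt 𝓘(ℝ, E) x₀).symm y)).comp
    ((D.cx ((extChartAt 𝓘(ℝ, E) x₀).symm y)).comp (chartInvD x₀ y))

variable (D : HamiltonianSpace F E G X)

theorem omChart_apply (x₀ : X) (y a b : E) :
    D.omChart x₀ y a b = formInChart D.omega x₀ a b y := rfl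

theorem contDiffOn_omChart [FiniteDimensional ℝ E] (x₀ : X) :
    ContDiffOn ℝ ∞ (D.omChart x₀) (extChartAt 𝓘(ℝ, E) x₀).target := by
  rw [contDiffOn_clm_apply]
  intro a
  rw [contDiffOn_clm_apply]
  intro b
  rw [← contMDiffOn_iff_contDiffOn]
  have h1 : ContMDiffOn 𝓘(ℝ, E) (𝓘(ℝ, E).prod 𝓘(ℝ, ℝ)) ∞
      (fun y : E => Bundle.TotalSpace.mk' ℝ (E := Bundle.Trivial X ℝ)
        ((extChartAt 𝓘(ℝ, E) x₀).symm y)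
        (D.omega ((extChartAt 𝓘(ℝ, E) x₀).symm y) (chartInvD x₀ y a) (chartInvD x₀ y b)))
      (extChartAt 𝓘(ℝ, E) x₀).target :=
    ContMDiffOn.clm_bundle_apply₂ (F₁ := E) (F₂ := E)
      (D.omega_smooth.comp_contMDiffOn (contMDiffOn_extChartAt_symm x₀))
      (contMDiffOn_coordField x₀ a) (contMDiffOn_coordField x₀ b)
  intro y hy
  have h2 := h1 y hy
  simp only [Bundle.contMDiffWithinAt_totalSpace] at h2
  exact h2.2

theorem contDiffOn_cxChart [FiniteDimensional ℝ E] (x₀ : X) :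
    ContDiffOn ℝ ∞ (D.cxChart x₀) (extChartAt 𝓘(ℝ, E) x₀).target := by
  rw [contDiffOn_clm_apply]
  intro a
  rw [← contMDiffOn_iff_contDiffOn]
  have h1 : ContMDiffOn 𝓘(ℝ, E) 𝓘(ℝ, E).tangent ∞
      (fun y : E => (Bundle.TotalSpace.mk' E (E := TangentSpace 𝓘(ℝ, E))
        ((extChartAt 𝓘(ℝ, E) x₀).symm y)
        (D.J ((extChartAt 𝓘(ℝ, E) x₀).symm y) (chartInvD x₀ y a)) : TangentBundle 𝓘(ℝ, E) X))
      (extChartAt 𝓘(ℝ, E) x₀).target :=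
    ContMDiffOn.clm_bundle_apply (F₁ := E) (F₂ := E)
      (D.J_smooth.comp_contMDiffOn (contMDiffOn_extChartAt_symm x₀))
      (contMDiffOn_coordField x₀ a)
  set e := trivializationAt E (TangentSpace 𝓘(ℝ, E) (M := X)) x₀
  rw [e.contMDiffOn_iff (fun y hy => by
    have := (extChartAt 𝓘(ℝ, E) x₀).map_target hy
    rw [extChartAt_source] at this
    rw [e.mem_source]
    simpa [e] using this)] at h1
  refine h1.2.congr fun y hy => ?_
  have := (extChartAt 𝓘(ℝ, E) x₀).map_target hy
  rw [extChartAt_source] at this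
  exact (chartD_eq x₀ this _).symm

theorem om_self (x : X) (a : E) : D.om x a a = 0 := D.omega_alt x a

theorem om_skew (x : X) (a b : E) : D.om x a b = -D.om x b a := by
  have h' := om_self D x (a + b)
  simp only [map_add, add_apply, om_self] at h'
  linarith

theorem om_eq_omChart (x₀ : X) {x : X} (hx : x ∈ (extChartAt 𝓘(ℝ, E) x₀).source) (a b : E) :
    D.om x a b = D.omChart x₀ (extChartAt 𝓘(ℝ, E) x₀ x) (chartD x₀ x a) (chartD x₀ x b) := by
  simp only [HamiltonianSpace.omChart, ContinuousLinearMap.bilinearComp_apply,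
    (extChartAt 𝓘(ℝ, E) x₀).left_inv hx, chartInvD_chartD x₀ hx]

theorem cx_eq_cxChart (x₀ : X) {x : X} (hx : x ∈ (extChartAt 𝓘(ℝ, E) x₀).source) (a : E) :
    chartD x₀ x (D.cx x a) = D.cxChart x₀ (extChartAt 𝓘(ℝ, E) x₀ x) (chartD x₀ x a) := by
  simp only [HamiltonianSpace.cxChart, ContinuousLinearMap.comp_apply,
    (extChartAt 𝓘(ℝ, E) x₀).left_inv hx, chartInvD_chartD x₀ hx]

theorem omChart_closed [FiniteDimensional ℝ E] (x₀ : X) {y : E}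
    (hy : y ∈ (extChartAt 𝓘(ℝ, E) x₀).target) (a b c : E) :
    fderiv ℝ (D.omChart x₀) y a b c + fderiv ℝ (D.omChart x₀) y b c a
      + fderiv ℝ (D.omChart x₀) y c a b = 0 := by
  have hd : DifferentiableAt ℝ (D.omChart x₀) y :=
    ((contDiffOn_omChart D x₀).contDiffAt
      ((isOpen_extChartAt_target x₀).mem_nhds hy)).differentiableAt (by simp)
  have key : ∀ b c a, fderiv ℝ (formInChart D.omega x₀ b c) y a
      = fderiv ℝ (D.omChart x₀) y a b c := by
    intro b c a
    have h1 : HasFDerivAt (fun y => D.omChart x₀ y b c) _ y :=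
      (hd.hasFDerivAt.clm_apply (hasFDerivAt_const b y)).clm_apply (hasFDerivAt_const c y)
    have h2 : formInChart D.omega x₀ b c = fun y => D.omChart x₀ y b c := by
      ext y; exact (omChart_apply D x₀ y b c).symm
    rw [h2, h1.fderiv]
    simp
  have := D.omega_closed x₀ y hy a b c
  rwa [key, key, key] at this

/-- A bound for the coordinates of a tangent vector by its norm, locally uniform in the point. -/
theorem exists_norm_chartD_le [FiniteDimensional ℝ E] (x₀ : X) :
    ∃ C : ℝ, 0 < C ∧ ∀ᶠ x in 𝓝 x₀, ∀ w : E, ‖chartD x₀ x w‖ ≤ C * D.normTan x w := by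
  set φ := extChartAt 𝓘(ℝ, E) x₀ with hφ
  let g : E → E →L[ℝ] E →L[ℝ] ℝ := fun y =>
    (D.omChart x₀ y).bilinearComp (ContinuousLinearMap.id ℝ E) (D.cxChart x₀ y)
  have hy₀ : φ x₀ ∈ φ.target := mem_extChartAt_target x₀
  have hnear : φ.target ∈ 𝓝 (φ x₀) := (isOpen_extChartAt_target x₀).mem_nhds hy₀
  have hco : ContinuousAt (D.omChart x₀) (φ x₀) :=
    ((contDiffOn_omChart D x₀).continuousOn.continuousAt hnear)
  have hcc : ContinuousAt (D.cxChart x₀) (φ x₀) :=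
    ((contDiffOn_cxChart D x₀).continuousOn.continuousAt hnear)
  have hpos : ∀ a : E, a ≠ 0 → 0 < D.omChart x₀ (φ x₀) a (D.cxChart x₀ (φ x₀) a) := by
    intro a ha
    have hs : x₀ ∈ φ.source := mem_extChartAt_source x₀
    have h1 := chartD_chartInvD x₀ hy₀ a
    rw [φ.left_inv hs] at h1
    have hb : chartInvD x₀ (φ x₀) a ≠ 0 := fun h => by rw [h, map_zero] at h1; exact ha h1.symm
    have h2 := D.J_pos x₀ (chartInvD x₀ (φ x₀) a) hb
    have h3 : D.om x₀ (chartInvD x₀ (φ x₀) a) (D.cx x₀ (chartInvD x₀ (φ x₀) a)) =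
      D.omChart x₀ (φ x₀) a (D.cxChart x₀ (φ x₀) a) := by
      rw [om_eq_omChart D x₀ hs, cx_eq_cxChart D x₀ hs, h1]
    rw [← h3]; exact h2
  have hsph : IsCompact (Metric.sphere (0 : E) 1) := isCompact_sphere 0 1
  -- On the compact unit sphere half of the minimum at the centre is still a lower bound at nearby
  -- points; homogeneity extends the bound to all vectors.
  have hev : ∃ c : ℝ, 0 < c ∧ ∀ᶠ y in 𝓝 (φ x₀), ∀ a ∈ Metric.sphere (0 : E) 1,
      c < D.omChart x₀ y a (D.cxChart x₀ y a) := by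
    have hcts : ContinuousOn (fun a : E => D.omChart x₀ (φ x₀) a (D.cxChart x₀ (φ x₀) a))
        (Metric.sphere (0 : E) 1) := by fun_prop
    rcases (Metric.sphere (0 : E) 1).eq_empty_or_nonempty with he | hne
    · exact ⟨1, one_pos, by simp [he]⟩
    obtain ⟨a₀, ha₀, hmin⟩ := hsph.exists_isMinOn hne hcts
    have ha₀' : a₀ ≠ 0 := by rintro rfl; simp at ha₀
    have hm := hpos a₀ ha₀'
    refine ⟨D.omChart x₀ (φ x₀) a₀ (D.cxChart x₀ (φ x₀) a₀) / 2, by positivity, ?_⟩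
    have : ∀ a ∈ Metric.sphere (0 : E) 1, ∀ᶠ p : E × E in 𝓝 (φ x₀, a),
        D.omChart x₀ (φ x₀) a₀ (D.cxChart x₀ (φ x₀) a₀) / 2
          < D.omChart x₀ p.1 p.2 (D.cxChart x₀ p.1 p.2) := by
      intro a ha
      have hca : ContinuousAt (fun p : E × E => D.omChart x₀ p.1 p.2 (D.cxChart x₀ p.1 p.2))
          (φ x₀, a) := by
        have h1 : ContinuousAt (fun p : E × E => D.omChart x₀ p.1) (φ x₀, a) :=
          ContinuousAt.comp (x := (φ x₀, a)) (f := Prod.fst) (g := D.omChart x₀) hco continuousAt_fst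
        have h2 : ContinuousAt (fun p : E × E => D.cxChart x₀ p.1) (φ x₀, a) :=
          ContinuousAt.comp (x := (φ x₀, a)) (f := Prod.fst) (g := D.cxChart x₀) hcc continuousAt_fst
        exact (h1.clm_apply continuousAt_snd).clm_apply (h2.clm_apply continuousAt_snd)
      refine hca.eventually (lt_mem_nhds ?_)
      have : D.omChart x₀ (φ x₀) a₀ (D.cxChart x₀ (φ x₀) a₀)
        ≤ D.omChart x₀ (φ x₀) a (D.cxChart x₀ (φ x₀) a) := hmin ha
      linarith
    exact hsph.eventually_forall_of_forall_eventually
      (P := fun y a => D.omChart x₀ (φ x₀) a₀ (D.cxChart x₀ (φ x₀) a₀) / 2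
          < D.omChart x₀ y a (D.cxChart x₀ y a)) this
  obtain ⟨c, hc, hev⟩ := hev
  refine ⟨1 / √c, by positivity, ?_⟩
  have hφc : ContinuousAt φ x₀ := continuousAt_extChartAt x₀
  filter_upwards [hφc.eventually hev, extChartAt_source_mem_nhds (I := 𝓘(ℝ, E)) x₀] with x hx hxs w
  set b := chartD x₀ x w with hb
  have hn : D.normTan x w = √(D.omChart x₀ (φ x) b (D.cxChart x₀ (φ x) b)) := by
    rw [hb, ← cx_eq_cxChart D x₀ hxs, ← om_eq_omChart D x₀ hxs]; rfl
  rcases eq_or_ne b 0 with h0 | h0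
  · rw [h0, norm_zero]; unfold HamiltonianSpace.normTan; positivity
  have hbn : 0 < ‖b‖ := norm_pos_iff.2 h0
  have h4 := hx (‖b‖⁻¹ • b) (by simp [norm_smul, hbn.ne'])
  simp only [map_smul, smul_apply, smul_eq_mul] at h4
  have h5 : c * ‖b‖ ^ 2 ≤ D.omChart x₀ (φ x) b (D.cxChart x₀ (φ x) b) := by
    have : ‖b‖⁻¹ * (‖b‖⁻¹ * D.omChart x₀ (φ x) b (D.cxChart x₀ (φ x) b))
      = D.omChart x₀ (φ x) b (D.cxChart x₀ (φ x) b) / ‖b‖ ^ 2 := by field_simp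
    rw [this, lt_div_iff₀ (by positivity)] at h4
    exact h4.le
  rw [hn, one_div, inv_mul_eq_div, le_div_iff₀ (by positivity)]
  refine Real.le_sqrt_of_sq_le ?_
  rw [mul_pow, Real.sq_sqrt hc.le]
  linarith

end Coefficients
end SympVortex

namespace SympVortex

/-! ### The homotopy formula for closed two-forms. -/

section Calculus

variable {E : Type*} [NormedAddCommGroup E] [NormedSpace ℝ E]
  {M : Type*} [NormedAddCommGroup M] [NormedSpace ℝ M]
  {V : Type*} [NormedAddCommGroup V] [NormedSpace ℝ V]

/-- The derivative of the coefficients of the pull-back of a two-form. -/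
theorem hasFDerivAt_pullback₂ {Ω : E → E →L[ℝ] E →L[ℝ] ℝ} {f : M → E} {p : M}
    (hΩ : DifferentiableAt ℝ Ω (f p)) (hf : ContDiffAt ℝ 2 f p) (v w : M) :
    ∃ K' : M →L[ℝ] ℝ,
      HasFDerivAt (fun p => Ω (f p) (fderiv ℝ f p v) (fderiv ℝ f p w)) K' p ∧
      ∀ u, K' u = fderiv ℝ Ω (f p) (fderiv ℝ f p u) (fderiv ℝ f p v) (fderiv ℝ f p w)
        + Ω (f p) (fderiv ℝ (fderiv ℝ f) p u v) (fderiv ℝ f p w)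
        + Ω (f p) (fderiv ℝ f p v) (fderiv ℝ (fderiv ℝ f) p u w) := by
  have h1 : HasFDerivAt f (fderiv ℝ f p) p := (hf.differentiableAt (by simp)).hasFDerivAt
  have h2 : HasFDerivAt (fderiv ℝ f) (fderiv ℝ (fderiv ℝ f) p) p :=
    ((hf.fderiv_right (m := 1) (by norm_num)).differentiableAt (by simp)).hasFDerivAt
  have h3 : HasFDerivAt (fun p => Ω (f p)) ((fderiv ℝ Ω (f p)).comp (fderiv ℝ f p)) p :=
    HasFDerivAt.comp (g := Ω) p hΩ.hasFDerivAt h1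
  refine ⟨_, (h3.clm_apply (h2.clm_apply (hasFDerivAt_const v p))).clm_apply
    (h2.clm_apply (hasFDerivAt_const w p)), fun u => ?_⟩
  simp
  ring

/-- The pull-back of a closed two-form is closed. -/
theorem pullback₂_closed {Ω : E → E →L[ℝ] E →L[ℝ] ℝ} {f : M → E} {p : M}
    (hΩ : DifferentiableAt ℝ Ω (f p)) (hf : ContDiffAt ℝ 2 f p)
    (halt : ∀ y a b, Ω y a b = -Ω y b a)
    (hcl : ∀ a b c, fderiv ℝ Ω (f p) a b c + fderiv ℝ Ω (f p) b c a
      + fderiv ℝ Ω (f p) c a b = 0) (u v w : M) :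
    fderiv ℝ (fun p => Ω (f p) (fderiv ℝ f p v) (fderiv ℝ f p w)) p u
      + fderiv ℝ (fun p => Ω (f p) (fderiv ℝ f p w) (fderiv ℝ f p u)) p v
      + fderiv ℝ (fun p => Ω (f p) (fderiv ℝ f p u) (fderiv ℝ f p v)) p w = 0 := by
  obtain ⟨K₁, hK₁, e₁⟩ := hasFDerivAt_pullback₂ hΩ hf v w
  obtain ⟨K₂, hK₂, e₂⟩ := hasFDerivAt_pullback₂ hΩ hf w u
  obtain ⟨K₃, hK₃, e₃⟩ := hasFDerivAt_pullback₂ hΩ hf u v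
  have hsym : IsSymmSndFDerivAt ℝ f p := hf.isSymmSndFDerivAt (by simp)
  rw [hK₁.fderiv, hK₂.fderiv, hK₃.fderiv, e₁, e₂, e₃]
  have := hcl (fderiv ℝ f p u) (fderiv ℝ f p v) (fderiv ℝ f p w)
  -- The six terms with second derivatives of `f` cancel in pairs, by the symmetry of the second
  -- derivative and the skew symmetry of `Ω`; what remains is `hcl`.
  rw [hsym.eq v u, hsym.eq w u, hsym.eq w v,
    halt (f p) (fderiv ℝ f p w) (fderiv ℝ (fderiv ℝ f) p u v),
    halt (f p) (fderiv ℝ f p u) (fderiv ℝ (fderiv ℝ f) p v w),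
    halt (f p) (fderiv ℝ f p v) (fderiv ℝ (fderiv ℝ f) p u w)]
  linarith

theorem continuousOn_fderiv_slice {g : ℝ × M → V} {q : M}
    (hg : ∀ s ∈ Icc (0 : ℝ) 1, ContDiffAt ℝ 1 g (s, q)) :
    ContinuousOn (fun s : ℝ => fderiv ℝ g (s, q)) (Icc 0 1) := by
  intro s hs
  have h1 : ContinuousAt (fderiv ℝ g) (s, q) :=
    ((hg s hs).fderiv_right (m := 0) (by norm_num)).continuousAt
  exact (ContinuousAt.comp (f := fun s : ℝ => (s, q)) h1 (by fun_prop)).continuousWithinAt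

/-- Differentiation under the integral sign over a compact interval. -/
theorem hasFDerivAt_integral_of_contDiffAt {g : ℝ × M → V} {q : M}
    (hg : ∀ s ∈ Icc (0 : ℝ) 1, ContDiffAt ℝ 1 g (s, q)) :
    HasFDerivAt (fun q => ∫ s in (0 : ℝ)..1, g (s, q))
      (∫ s in (0 : ℝ)..1, (fderiv ℝ g (s, q)).comp (ContinuousLinearMap.inr ℝ ℝ M)) q := by
  have hfc := continuousOn_fderiv_slice hg
  obtain ⟨C, hC⟩ := isCompact_Icc.exists_bound_of_continuousOn hfc
  -- Compactness of the interval gives one neighbourhood of `q` and one constant for all `s`, which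
  -- serves as dominating function.
  have hev : ∀ᶠ q' in 𝓝 q, ∀ s ∈ Icc (0 : ℝ) 1,
      ContDiffAt ℝ 1 g (s, q') ∧ ‖fderiv ℝ g (s, q')‖ ≤ C + 1 := by
    refine isCompact_Icc.eventually_forall_of_forall_eventually
      (P := fun q' s => ContDiffAt ℝ 1 g (s, q') ∧ ‖fderiv ℝ g (s, q')‖ ≤ C + 1) ?_
    intro s hs
    have hsw : ContinuousAt (fun z : M × ℝ => (z.2, z.1)) (q, s) := by fun_prop
    refine (hsw.eventually ((hg s hs).eventually (by simp))).and ?_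
    have h1 : ContinuousAt (fderiv ℝ g) (s, q) :=
      ((hg s hs).fderiv_right (m := 0) (by norm_num)).continuousAt
    have h2 := h1.norm.eventually (gt_mem_nhds (lt_of_le_of_lt (hC s hs) (lt_add_one C)))
    exact (hsw.eventually h2).mono fun z hz => hz.le
  have hI : uIoc (0 : ℝ) 1 ⊆ Icc 0 1 := by
    rw [uIoc_of_le zero_le_one]; exact Ioc_subset_Icc_self
  have hcont : ∀ᶠ q' in 𝓝 q, ContinuousOn (fun s => g (s, q')) (Icc (0 : ℝ) 1) := by
    filter_upwards [hev] with q' hq' s hs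
    exact (ContinuousAt.comp (f := fun s : ℝ => (s, q')) (hq' s hs).1.continuousAt
      (by fun_prop)).continuousWithinAt
  refine intervalIntegral.hasFDerivAt_integral_of_dominated_of_fderiv_le (𝕜 := ℝ)
    (F := fun q s => g (s, q))
    (F' := fun q s => (fderiv ℝ g (s, q)).comp (ContinuousLinearMap.inr ℝ ℝ M))
    (bound := fun _ => (C + 1) * ‖ContinuousLinearMap.inr ℝ ℝ M‖) hev ?_ ?_ ?_ ?_ ?_ ?_
  · filter_upwards [hcont] with q' hq'
    exact (hq'.mono hI).aestronglyMeasurable measurableSet_uIoc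
  · refine (hcont.self_of_nhds.mono ?_).intervalIntegrable
    rw [uIcc_of_le zero_le_one]
  · refine ContinuousOn.aestronglyMeasurable ?_ measurableSet_uIoc
    exact (hfc.mono hI).clm_comp continuousOn_const
  · refine Eventually.of_forall fun s hs q' hq' => ?_
    exact (ContinuousLinearMap.opNorm_comp_le _ _).trans
      (mul_le_mul_of_nonneg_right (hq' s (hI hs)).2 (norm_nonneg _))
  · exact intervalIntegrable_const
  · refine Eventually.of_forall fun s hs q' hq' => ?_
    have h1 : HasFDerivAt g (fderiv ℝ g (s, q')) (s, q') :=
      ((hq' s (hI hs)).1.differentiableAt (by simp)).hasFDerivAt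
    exact h1.comp q' (hasFDerivAt_prodMk_right s q')

theorem integral_fderiv_slice_apply [CompleteSpace V] {g : ℝ × M → V} {q : M}
    (hg : ∀ s ∈ Icc (0 : ℝ) 1, ContDiffAt ℝ 1 g (s, q)) (a : M) :
    (∫ s in (0 : ℝ)..1, (fderiv ℝ g (s, q)).comp (ContinuousLinearMap.inr ℝ ℝ M)) a
      = ∫ s in (0 : ℝ)..1, fderiv ℝ g (s, q) (0, a) := by
  rw [ContinuousLinearMap.intervalIntegral_apply]
  · rfl
  · refine ContinuousOn.intervalIntegrable ?_
    rw [uIcc_of_le zero_le_one]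
    exact (continuousOn_fderiv_slice hg).clm_comp continuousOn_const

/-- The primitive of a closed two-form `Ω` that a homotopy `f` defines. -/
def homotopyForm (Ω : E → E →L[ℝ] E →L[ℝ] ℝ) (f : ℝ × M → E) (q : M) : M →L[ℝ] ℝ :=
  ∫ s in (0 : ℝ)..1, (Ω (f (s, q)) (fderiv ℝ f (s, q) (1, 0))).comp
    ((fderiv ℝ f (s, q)).comp (ContinuousLinearMap.inr ℝ ℝ M))

theorem contDiffAt_homotopyForm_integrand {Ω : E → E →L[ℝ] E →L[ℝ] ℝ} {f : ℝ × M → E}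
    {p : ℝ × M} (hf : ContDiffAt ℝ ∞ f p) (hΩ : ContDiffAt ℝ ∞ Ω (f p)) :
    ContDiffAt ℝ 1 (fun p : ℝ × M => (Ω (f p) (fderiv ℝ f p (1, 0))).comp
      ((fderiv ℝ f p).comp (ContinuousLinearMap.inr ℝ ℝ M))) p := by
  have h1 : ContDiffAt ℝ 1 (fderiv ℝ f) p := hf.fderiv_right (m := 1) (by norm_cast)
  have h2 : ContDiffAt ℝ 1 (fun p => Ω (f p)) p :=
    (hΩ.comp p hf).of_le (by norm_cast)
  exact (h2.clm_apply (h1.clm_apply contDiffAt_const)).clm_comp (h1.clm_comp contDiffAt_const)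

theorem intervalIntegrable_homotopyForm_integrand {Ω : E → E →L[ℝ] E →L[ℝ] ℝ} {f : ℝ × M → E}
    {q : M} (hf : ∀ s ∈ Icc (0 : ℝ) 1, ContDiffAt ℝ ∞ f (s, q))
    (hΩ : ∀ s ∈ Icc (0 : ℝ) 1, ContDiffAt ℝ ∞ Ω (f (s, q))) :
    IntervalIntegrable (fun s : ℝ => (Ω (f (s, q)) (fderiv ℝ f (s, q) (1, 0))).comp
      ((fderiv ℝ f (s, q)).comp (ContinuousLinearMap.inr ℝ ℝ M))) volume 0 1 := by
  refine ContinuousOn.intervalIntegrable ?_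
  rw [uIcc_of_le zero_le_one]
  intro s hs
  exact (ContinuousAt.comp (f := fun s : ℝ => (s, q))
    (contDiffAt_homotopyForm_integrand (hf s hs) (hΩ s hs)).continuousAt
    (by fun_prop)).continuousWithinAt

theorem homotopyForm_apply {Ω : E → E →L[ℝ] E →L[ℝ] ℝ} {f : ℝ × M → E} {q : M}
    (hf : ∀ s ∈ Icc (0 : ℝ) 1, ContDiffAt ℝ ∞ f (s, q))
    (hΩ : ∀ s ∈ Icc (0 : ℝ) 1, ContDiffAt ℝ ∞ Ω (f (s, q))) (b : M) :
    homotopyForm Ω f q b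
      = ∫ s in (0 : ℝ)..1, Ω (f (s, q)) (fderiv ℝ f (s, q) (1, 0)) (fderiv ℝ f (s, q) (0, b)) := by
  rw [homotopyForm, ContinuousLinearMap.intervalIntegral_apply
    (intervalIntegrable_homotopyForm_integrand hf hΩ)]
  rfl

theorem homotopyForm_comp {Ω : E → E →L[ℝ] E →L[ℝ] ℝ} {f : ℝ × M → E} {q : M}
    (hf : ∀ s ∈ Icc (0 : ℝ) 1, ContDiffAt ℝ ∞ f (s, q))
    (hΩ : ∀ s ∈ Icc (0 : ℝ) 1, ContDiffAt ℝ ∞ Ω (f (s, q))) (L : V →L[ℝ] M) :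
    (homotopyForm Ω f q).comp L
      = ∫ s in (0 : ℝ)..1, ((Ω (f (s, q)) (fderiv ℝ f (s, q) (1, 0))).comp
        ((fderiv ℝ f (s, q)).comp (ContinuousLinearMap.inr ℝ ℝ M))).comp L := by
  exact (ContinuousLinearMap.intervalIntegral_comp_comm (ContinuousLinearMap.precomp ℝ L)
    (intervalIntegrable_homotopyForm_integrand hf hΩ)).symm

/-- The homotopy formula `d h(Ω) = f₁^* Ω - f₀^* Ω` for a closed two-form. -/
theorem hasFDerivAt_homotopyForm {Ω : E → E →L[ℝ] E →L[ℝ] ℝ} {f : ℝ × M → E} {q : M}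
    (hf : ∀ s ∈ Icc (0 : ℝ) 1, ContDiffAt ℝ ∞ f (s, q))
    (hΩ : ∀ s ∈ Icc (0 : ℝ) 1, ContDiffAt ℝ ∞ Ω (f (s, q)))
    (halt : ∀ y a b, Ω y a b = -Ω y b a)
    (hcl : ∀ s ∈ Icc (0 : ℝ) 1, ∀ a b c, fderiv ℝ Ω (f (s, q)) a b c
      + fderiv ℝ Ω (f (s, q)) b c a + fderiv ℝ Ω (f (s, q)) c a b = 0) :
    ∃ β' : M →L[ℝ] M →L[ℝ] ℝ, HasFDerivAt (homotopyForm Ω f) β' q ∧ ∀ a b, β' a b - β' b a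
      = Ω (f (1, q)) (fderiv ℝ f (1, q) (0, a)) (fderiv ℝ f (1, q) (0, b))
        - Ω (f (0, q)) (fderiv ℝ f (0, q) (0, a)) (fderiv ℝ f (0, q) (0, b)) := by
  set g : ℝ × M → M →L[ℝ] ℝ := fun p => (Ω (f p) (fderiv ℝ f p (1, 0))).comp
      ((fderiv ℝ f p).comp (ContinuousLinearMap.inr ℝ ℝ M)) with hgdef
  have hg : ∀ s ∈ Icc (0 : ℝ) 1, ContDiffAt ℝ 1 g (s, q) := fun s hs =>
    contDiffAt_homotopyForm_integrand (hf s hs) (hΩ s hs)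
  refine ⟨_, hasFDerivAt_integral_of_contDiffAt hg, fun a b => ?_⟩
  have hmaps := continuousOn_fderiv_slice hg
  have happ : ∀ a b, (∫ s in (0 : ℝ)..1, (fderiv ℝ g (s, q)).comp
      (ContinuousLinearMap.inr ℝ ℝ M)) a b
      = ∫ s in (0 : ℝ)..1, fderiv ℝ g (s, q) (0, a) b := by
    intro a b
    rw [integral_fderiv_slice_apply hg, ContinuousLinearMap.intervalIntegral_apply]
    refine ContinuousOn.intervalIntegrable ?_
    rw [uIcc_of_le zero_le_one]
    exact hmaps.clm_apply continuousOn_const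
  have happint : ∀ a b, IntervalIntegrable (fun s : ℝ => fderiv ℝ g (s, q) (0, a) b)
      volume 0 1 := by
    intro a b
    refine ContinuousOn.intervalIntegrable ?_
    rw [uIcc_of_le zero_le_one]
    exact (hmaps.clm_apply (continuousOn_const (c := ((0 : ℝ), a)))).clm_apply
      (continuousOn_const (c := b))
  rw [happ, happ, ← intervalIntegral.integral_sub (happint a b) (happint b a)]
  -- Cartan's formula: closedness of `f^*Ω`, evaluated on `(0, a)`, `(1, 0)`, `(0, b)`, says that
  -- the antisymmetrized derivative of the contraction of `f^*Ω` with `∂_s` is the `s`-derivative of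
  -- `K a b`. Integration over `s` leaves the values at the two ends.
  let K : M → M → ℝ × M → ℝ := fun a b p =>
    Ω (f p) (fderiv ℝ f p (0, a)) (fderiv ℝ f p (0, b))
  have hK : ∀ s ∈ Icc (0 : ℝ) 1, HasFDerivAt (K a b) (fderiv ℝ (K a b) (s, q)) (s, q) := by
    intro s hs
    obtain ⟨K', hK', -⟩ := hasFDerivAt_pullback₂ (f := f) (p := (s, q)) (Ω := Ω)
      ((hΩ s hs).differentiableAt (by simp)) ((hf s hs).of_le (by norm_cast)) (0, a) (0, b)
    exact hK'.differentiableAt.hasFDerivAt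
  have hval : ∀ s ∈ Icc (0 : ℝ) 1, fderiv ℝ g (s, q) (0, a) b - fderiv ℝ g (s, q) (0, b) a
      = fderiv ℝ (K a b) (s, q) (1, 0) := by
    intro s hs
    have hgd : HasFDerivAt g (fderiv ℝ g (s, q)) (s, q) :=
      ((hg s hs).differentiableAt (by simp)).hasFDerivAt
    have hgb : ∀ a b, fderiv ℝ g (s, q) (0, a) b
        = fderiv ℝ (fun p => Ω (f p) (fderiv ℝ f p (1, 0)) (fderiv ℝ f p (0, b))) (s, q)
          (0, a) := by
      intro a b
      have h1 := hgd.clm_apply (hasFDerivAt_const b (s, q))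
      have h2 : (fun p => g p b)
        = fun p => Ω (f p) (fderiv ℝ f p (1, 0)) (fderiv ℝ f p (0, b)) := rfl
      rw [h2] at h1
      rw [h1.fderiv]
      simp
    have hcyc := pullback₂_closed (f := f) (p := (s, q)) (Ω := Ω)
      ((hΩ s hs).differentiableAt (by simp)) ((hf s hs).of_le (by norm_cast)) halt (hcl s hs)
      (0, a) (1, 0) (0, b)
    rw [hgb, hgb]
    have e1 : (fun p => Ω (f p) (fderiv ℝ f p (0, b)) (fderiv ℝ f p (0, a)))
        = fun p => -K a b p := by
      ext p; exact halt _ _ _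
    have e2 : (fun p => Ω (f p) (fderiv ℝ f p (0, a)) (fderiv ℝ f p (1, 0)))
        = fun p => -(Ω (f p) (fderiv ℝ f p (1, 0)) (fderiv ℝ f p (0, a))) := by
      ext p; exact halt _ _ _
    rw [e1, e2, fderiv_fun_neg, fderiv_fun_neg] at hcyc
    simp only [neg_apply] at hcyc
    linarith
  have hderiv : ∀ s ∈ uIcc (0 : ℝ) 1, HasDerivAt (fun s => K a b (s, q))
      (fderiv ℝ g (s, q) (0, a) b - fderiv ℝ g (s, q) (0, b) a) s := by
    intro s hs
    rw [uIcc_of_le zero_le_one] at hs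
    rw [hval s hs]
    exact (hK s hs).comp_hasDerivAt s
      ((hasDerivAt_id s).prodMk (hasDerivAt_const s q))
  exact intervalIntegral.integral_eq_sub_of_hasDerivAt hderiv ((happint a b).sub (happint b a))

end Calculus
end SympVortex

namespace SympVortex

/-! ### Derivatives of maps into and out of the manifold. -/

section Derivatives

variable {E : Type*} [NormedAddCommGroup E] [NormedSpace ℝ E]
  {X : Type*} [TopologicalSpace X] [ChartedSpace E X]
  {M : Type*} [NormedAddCommGroup M] [NormedSpace ℝ M]
  {N : Type*} [NormedAddCommGroup N] [NormedSpace ℝ N]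

/-- The derivative within `Q` of a map from a normed space to `X`. -/
def dW (c : M → X) (Q : Set M) (p : M) : M →L[ℝ] E :=
  mfderivWithin 𝓘(ℝ, M) 𝓘(ℝ, E) c Q p

/-- The derivative of a map from `X` to a normed space. -/
def dX (ψ : X → N) (x : X) : E →L[ℝ] N :=
  mfderiv 𝓘(ℝ, E) 𝓘(ℝ, N) ψ x

theorem fderivWithin_comp_eq {ψ : X → N} {c : M → X} {Q : Set M} {p : M}
    (hψ : MDifferentiableAt 𝓘(ℝ, E) 𝓘(ℝ, N) ψ (c p))
    (hc : MDifferentiableWithinAt 𝓘(ℝ, M) 𝓘(ℝ, E) c Q p) (hQ : UniqueDiffWithinAt ℝ Q p) (v : M) :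
    fderivWithin ℝ (fun p => ψ (c p)) Q p v = dX ψ (c p) (dW (E := E) c Q p v) := by
  have h := mfderiv_comp_mfderivWithin p hψ hc hQ.uniqueMDiffWithinAt
  rw [mfderivWithin_eq_fderivWithin] at h
  exact DFunLike.congr_fun h v

theorem dW_comp {c : M → X} {j : N → M} {Q : Set M} {Q' : Set N} {n : N}
    (hc : MDifferentiableWithinAt 𝓘(ℝ, M) 𝓘(ℝ, E) c Q (j n))
    (hj : DifferentiableWithinAt ℝ j Q' n) (hm : MapsTo j Q' Q) (hQ : UniqueDiffWithinAt ℝ Q' n)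
    (v : N) :
    dW (E := E) (fun n => c (j n)) Q' n v = dW (E := E) c Q (j n) (fderivWithin ℝ j Q' n v) := by
  have h := mfderivWithin_comp n hc hj.mdifferentiableWithinAt hm hQ.uniqueMDiffWithinAt
  rw [mfderivWithin_eq_fderivWithin] at h
  exact DFunLike.congr_fun h v

theorem dW_congr {c c' : M → X} {Q : Set M} {p : M} (h : ∀ q ∈ Q, c q = c' q) (hp : p ∈ Q) :
    dW (E := E) c Q p = dW (E := E) c' Q p := by
  have := mfderivWithin_congr (I := 𝓘(ℝ, M)) (I' := 𝓘(ℝ, E)) (f := c') (f₁ := c) h (h p hp)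
  exact this

theorem dW_mono {c : M → X} {Q Q' : Set M} {p : M}
    (hc : MDifferentiableWithinAt 𝓘(ℝ, M) 𝓘(ℝ, E) c Q p) (hQ : UniqueDiffWithinAt ℝ Q' p)
    (hs : Q' ⊆ Q) : dW (E := E) c Q' p = dW (E := E) c Q p :=
  hc.mfderivWithin_mono hQ.uniqueMDiffWithinAt hs

theorem dW_of_mem_nhds {c : M → X} {Q : Set M} {p : M} (h : Q ∈ 𝓝 p) :
    dW (E := E) c Q p = dW (E := E) c univ p := by
  unfold dW
  rw [mfderivWithin_of_mem_nhds h, mfderivWithin_univ]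

end Derivatives

section Rectangles

theorem uniqueDiffOn_cylRect {a b : ℝ} (hab : a < b) : UniqueDiffOn ℝ (cylRect a b) :=
  (uniqueDiffOn_Icc hab).prod (uniqueDiffOn_Icc (by positivity))

theorem isCompact_cylRect (a b : ℝ) : IsCompact (cylRect a b) :=
  isCompact_Icc.prod isCompact_Icc

theorem cylRect_mem_nhds {a b : ℝ} {p : ℝ × ℝ}
    (hp : p ∈ Ioo a b ×ˢ Ioo (0 : ℝ) (2 * Real.pi)) : cylRect a b ∈ 𝓝 p :=
  prod_mem_nhds (Icc_mem_nhds hp.1.1 hp.1.2) (Icc_mem_nhds hp.2.1 hp.2.2)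

variable {E : Type*} [NormedAddCommGroup E] [NormedSpace ℝ E]
  {X : Type*} [TopologicalSpace X] [ChartedSpace E X]

theorem dW_vertical {c : ℝ × ℝ → X} {a b s θ : ℝ}
    (hc : ContMDiffOn 𝓘(ℝ, ℝ × ℝ) 𝓘(ℝ, E) ∞ c (cylRect a b)) (hs : s ∈ Icc a b)
    (hθ : θ ∈ Icc (0 : ℝ) (2 * Real.pi)) :
    dW (E := E) c (cylRect a b) (s, θ) (0, 1)
      = dW (E := E) (fun θ => c (s, θ)) (Icc 0 (2 * Real.pi)) θ 1 := by
  have hu : UniqueDiffWithinAt ℝ (Icc 0 (2 * Real.pi)) θ :=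
    uniqueDiffOn_Icc (by positivity) θ hθ
  have hj : HasFDerivAt (fun θ : ℝ => (s, θ)) (ContinuousLinearMap.inr ℝ ℝ ℝ) θ :=
    hasFDerivAt_prodMk_right s θ
  rw [dW_comp (j := fun θ : ℝ => (s, θ)) (Q := cylRect a b)
    ((hc (s, θ) ⟨hs, hθ⟩).mdifferentiableWithinAt (by simp))
    hj.hasFDerivWithinAt.differentiableWithinAt (fun τ hτ => ⟨hs, hτ⟩) hu,
    hj.hasFDerivWithinAt.fderivWithin hu]
  simp

theorem dW_horizontal {c : ℝ × ℝ → X} {a b s θ : ℝ} (hab : a < b)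
    (hc : ContMDiffOn 𝓘(ℝ, ℝ × ℝ) 𝓘(ℝ, E) ∞ c (cylRect a b)) (hs : s ∈ Icc a b)
    (hθ : θ ∈ Icc (0 : ℝ) (2 * Real.pi)) :
    dW (E := E) c (cylRect a b) (s, θ) (1, 0)
      = dW (E := E) (fun s => c (s, θ)) (Icc a b) s 1 := by
  have hu : UniqueDiffWithinAt ℝ (Icc a b) s := uniqueDiffOn_Icc hab s hs
  have hj : HasFDerivAt (fun s : ℝ => (s, θ)) (ContinuousLinearMap.inl ℝ ℝ ℝ) s :=
    hasFDerivAt_prodMk_left s θ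
  rw [dW_comp (j := fun s : ℝ => (s, θ)) (Q := cylRect a b)
    ((hc (s, θ) ⟨hs, hθ⟩).mdifferentiableWithinAt (by simp))
    hj.hasFDerivWithinAt.differentiableWithinAt (fun τ hτ => ⟨hτ, hθ⟩) hu,
    hj.hasFDerivWithinAt.fderivWithin hu]
  simp

end Rectangles

/-! ### Primitives of the symplectic form and Stokes' theorem on rectangles. -/

section Stokes

variable {F : Type*} [NormedAddCommGroup F] [NormedSpace ℝ F]
  {E : Type*} [NormedAddCommGroup E] [NormedSpace ℝ E]
  {G : Type*} [TopologicalSpace G] [ChartedSpace F G] [Group G] [LieGroup 𝓘(ℝ, F) ∞ G]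
  {X : Type*} [TopologicalSpace X] [ChartedSpace E X] [IsManifold 𝓘(ℝ, E) ∞ X]
  [MulAction G X] [ContMDiffSMul 𝓘(ℝ, F) 𝓘(ℝ, E) ∞ G X]
  {H : Type*} [NormedAddCommGroup H] [NormedSpace ℝ H]
  {M : Type*} [NormedAddCommGroup M] [NormedSpace ℝ M]

variable (H) in
/-- Near `x₀` the one-form `α` is the pull-back of a one-form on `H`, and `ω = dα`. -/
def HasPrimitiveAt (D : HamiltonianSpace F E G X) (α : X → E →L[ℝ] ℝ) (x₀ : X) : Prop :=
  ∃ (ψ : X → H) (β : H → H →L[ℝ] ℝ), ∀ᶠ x in 𝓝 x₀,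
    ContMDiffAt 𝓘(ℝ, E) 𝓘(ℝ, H) ∞ ψ x ∧ DifferentiableAt ℝ β (ψ x) ∧
    (∀ w, α x w = β (ψ x) (dX ψ x w)) ∧
    ∀ v w, D.om x v w = fderiv ℝ β (ψ x) (dX ψ x v) (dX ψ x w)
      - fderiv ℝ β (ψ x) (dX ψ x w) (dX ψ x v)

variable (D : HamiltonianSpace F E G X)

theorem continuousOn_pullback_om [FiniteDimensional ℝ E] {c : M → X} {Q : Set M}
    (hQ : UniqueDiffOn ℝ Q) (hc : ContMDiffOn 𝓘(ℝ, M) 𝓘(ℝ, E) ∞ c Q) (v w : M) :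
    ContinuousOn (fun p => D.om (c p) (dW c Q p v) (dW c Q p w)) Q := by
  intro p₀ hp₀
  set φ := extChartAt 𝓘(ℝ, E) (c p₀)
  have hsrc : ∀ᶠ p in 𝓝[Q] p₀, c p ∈ φ.source :=
    (hc p₀ hp₀).continuousWithinAt (extChartAt_source_mem_nhds (c p₀))
  have hφ : ∀ x ∈ φ.source, ContMDiffAt 𝓘(ℝ, E) 𝓘(ℝ, E) ∞ φ x := fun x hx =>
    contMDiffAt_extChartAt' (by rwa [extChartAt_source] at hx)
  have hf : ContDiffWithinAt ℝ ∞ (fun p => φ (c p)) Q p₀ :=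
    contMDiffWithinAt_iff_contDiffWithinAt.1
      ((hφ _ (mem_extChartAt_source _)).comp_contMDiffWithinAt p₀ (hc p₀ hp₀))
  have hDf : ContinuousWithinAt (fderivWithin ℝ (fun p => φ (c p)) Q) Q p₀ :=
    (hf.fderivWithin_right (m := 0) hQ (by norm_cast) hp₀).continuousWithinAt
  have hΩ : ContinuousAt (D.omChart (c p₀)) (φ (c p₀)) :=
    (contDiffOn_omChart D (c p₀)).continuousOn.continuousAt
      ((isOpen_extChartAt_target _).mem_nhds (mem_extChartAt_target _))
  have hΩc : ContinuousWithinAt (fun p => D.omChart (c p₀) (φ (c p))) Q p₀ :=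
    ContinuousAt.comp_continuousWithinAt (g := D.omChart (c p₀)) hΩ hf.continuousWithinAt
  have hmain : ContinuousWithinAt (fun p => D.omChart (c p₀) (φ (c p))
      (fderivWithin ℝ (fun p => φ (c p)) Q p v) (fderivWithin ℝ (fun p => φ (c p)) Q p w))
      Q p₀ :=
    (hΩc.clm_apply (hDf.clm_apply continuousWithinAt_const)).clm_apply
      (hDf.clm_apply continuousWithinAt_const)
  refine hmain.congr_of_eventuallyEq_of_mem ?_ hp₀
  filter_upwards [hsrc, self_mem_nhdsWithin] with p hp hpQ
  have hd := fderivWithin_comp_eq (E := E) ((hφ _ hp).mdifferentiableAt (by simp))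
    ((hc p hpQ).mdifferentiableWithinAt (by simp)) (hQ p hpQ)
  rw [om_eq_omChart D (c p₀) hp, hd, hd]
  rfl

/-- Continuity of `β ∘ ψ` and smoothness of `ψ ∘ c` suffice here, so `α` need not be known to be a
smooth form. -/
theorem continuousOn_pullback_primitive {α : X → E →L[ℝ] ℝ} {c : M → X} {Q : Set M}
    (hQ : UniqueDiffOn ℝ Q) (hc : ContMDiffOn 𝓘(ℝ, M) 𝓘(ℝ, E) ∞ c Q)
    (hα : ∀ p ∈ Q, HasPrimitiveAt H D α (c p)) (v : M) :
    ContinuousOn (fun p => α (c p) (dW c Q p v)) Q := by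
  intro p₀ hp₀
  obtain ⟨ψ, β, hev⟩ := hα p₀ hp₀
  have h0 := hev.self_of_nhds
  have hf : ContDiffWithinAt ℝ ∞ (fun p => ψ (c p)) Q p₀ :=
    contMDiffWithinAt_iff_contDiffWithinAt.1 (h0.1.comp_contMDiffWithinAt p₀ (hc p₀ hp₀))
  have hDf : ContinuousWithinAt (fderivWithin ℝ (fun p => ψ (c p)) Q) Q p₀ :=
    (hf.fderivWithin_right (m := 0) hQ (by norm_cast) hp₀).continuousWithinAt
  have hβ : ContinuousWithinAt (fun p => β (ψ (c p))) Q p₀ :=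
    ContinuousAt.comp_continuousWithinAt (g := β) h0.2.1.continuousAt hf.continuousWithinAt
  refine (hβ.clm_apply (hDf.clm_apply (continuousWithinAt_const (b := v)))).congr_of_eventuallyEq_of_mem
    ?_ hp₀
  filter_upwards [(hc p₀ hp₀).continuousWithinAt hev, self_mem_nhdsWithin] with p hp hpQ
  have hp' := mem_preimage.1 hp
  rw [hp'.2.2.1, fderivWithin_comp_eq (E := E) (hp'.1.mdifferentiableAt (by simp))
    ((hc p hpQ).mdifferentiableWithinAt (by simp)) (hQ p hpQ)]

/-- In the coordinates `ψ` the second derivatives of `ψ ∘ c` drop out of the antisymmetrization, and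
the rest is the pull-back of `dβ`. The derivative is asserted only at interior points, which is
where the divergence theorem needs it. -/
theorem hasFDerivAt_pullback_primitive {α : X → E →L[ℝ] ℝ} {c : M → X} {Q : Set M} {p₀ : M}
    (hQ : Q ∈ 𝓝 p₀) (hc : ContMDiffOn 𝓘(ℝ, M) 𝓘(ℝ, E) ∞ c Q)
    (hα : HasPrimitiveAt H D α (c p₀)) :
    ∃ A : M → M →L[ℝ] ℝ, (∀ v, HasFDerivAt (fun p => α (c p) (dW c Q p v)) (A v) p₀) ∧
      ∀ v w, A w v - A v w = D.om (c p₀) (dW c Q p₀ v) (dW c Q p₀ w) := by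
  obtain ⟨ψ, β, hev⟩ := hα
  have h0 := hev.self_of_nhds
  have hcn : ∀ᶠ p in 𝓝 p₀, Q ∈ 𝓝 p ∧ ContMDiffAt 𝓘(ℝ, M) 𝓘(ℝ, E) ∞ c p := by
    filter_upwards [eventually_mem_nhds_iff.2 hQ] with p hp
    exact ⟨hp, hc.contMDiffAt hp⟩
  have hc0 := hcn.self_of_nhds.2
  set f : M → H := fun p => ψ (c p)
  have hf : ContDiffAt ℝ ∞ f p₀ := contMDiffAt_iff_contDiffAt.1 (h0.1.comp p₀ hc0)
  have hf1 : HasFDerivAt f (fderiv ℝ f p₀) p₀ := (hf.differentiableAt (by simp)).hasFDerivAt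
  have hf2 : HasFDerivAt (fderiv ℝ f) (fderiv ℝ (fderiv ℝ f) p₀) p₀ :=
    ((hf.fderiv_right (m := 1) (by norm_cast)).differentiableAt (by simp)).hasFDerivAt
  have hβ : HasFDerivAt (fun p => β (f p)) ((fderiv ℝ β (f p₀)).comp (fderiv ℝ f p₀)) p₀ :=
    HasFDerivAt.comp (g := β) p₀ h0.2.1.hasFDerivAt hf1
  have hev' : ∀ᶠ p in 𝓝 p₀, ∀ v, fderiv ℝ f p v = dX (E := E) ψ (c p) (dW c Q p v) ∧
      α (c p) (dW c Q p v) = β (f p) (fderiv ℝ f p v) := by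
    filter_upwards [hc0.continuousAt.eventually hev, hcn] with p hp hpc v
    have h1 : fderiv ℝ f p v = dX (E := E) ψ (c p) (dW c Q p v) := by
      rw [dW_of_mem_nhds hpc.1, ← fderivWithin_univ]
      exact fderivWithin_comp_eq (hp.1.mdifferentiableAt (by simp))
        ((hpc.2.mdifferentiableAt (by simp)).mdifferentiableWithinAt) uniqueDiffWithinAt_univ v
    exact ⟨h1, by rw [hp.2.2.1, h1]⟩
  refine ⟨_, fun v => ((hβ.clm_apply (hf2.clm_apply (hasFDerivAt_const v p₀)))).congr_of_eventuallyEq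
    (hev'.mono fun p hp => (hp v).2), fun v w => ?_⟩
  have hsym : IsSymmSndFDerivAt ℝ f p₀ := hf.isSymmSndFDerivAt (by simp; norm_cast)
  have hv := (hev'.self_of_nhds v).1
  have hw := (hev'.self_of_nhds w).1
  rw [h0.2.2.2, ← hv, ← hw]
  simp [hsym.eq v w, f]

/-- Stokes' theorem on a rectangle for a primitive `α` of `ω`. -/
theorem area_eq_boundary [FiniteDimensional ℝ E] {α : X → E →L[ℝ] ℝ} {c : ℝ × ℝ → X} {a b : ℝ}
    (hab : a < b) (hc : ContMDiffOn 𝓘(ℝ, ℝ × ℝ) 𝓘(ℝ, E) ∞ c (cylRect a b))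
    (hα : ∀ p ∈ cylRect a b, HasPrimitiveAt H D α (c p)) :
    area D c a b =
      (∫ θ in (0 : ℝ)..(2 * Real.pi),
        α (c (b, θ)) (dW (fun θ => c (b, θ)) (Icc 0 (2 * Real.pi)) θ 1))
      - (∫ θ in (0 : ℝ)..(2 * Real.pi),
        α (c (a, θ)) (dW (fun θ => c (a, θ)) (Icc 0 (2 * Real.pi)) θ 1))
      - ((∫ s in a..b, α (c (s, 2 * Real.pi)) (dW (fun s => c (s, 2 * Real.pi)) (Icc a b) s 1))
        - ∫ s in a..b, α (c (s, 0)) (dW (fun s => c (s, 0)) (Icc a b) s 1)) := by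
  set Q := cylRect a b with hQdef
  have hpi : (0 : ℝ) ≤ 2 * Real.pi := by positivity
  have hQu := uniqueDiffOn_cylRect hab
  have hQI : Q = Icc (a, (0 : ℝ)) (b, 2 * Real.pi) := by
    rw [hQdef, cylRect, Icc_prod_eq]
  let P : ℝ × ℝ → ℝ × ℝ → ℝ := fun v p => α (c p) (dW c Q p v)
  let w : ℝ × ℝ → ℝ := fun p => D.om (c p) (dW c Q p (1, 0)) (dW c Q p (0, 1))
  have hP : ∀ v, ContinuousOn (P v) Q := fun v =>
    continuousOn_pullback_primitive D hQu hc hα v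
  have hw : ContinuousOn w Q := continuousOn_pullback_om D hQu hc _ _
  have hder : ∀ p ∈ Ioo a b ×ˢ Ioo (0 : ℝ) (2 * Real.pi), ∃ A : ℝ × ℝ → ℝ × ℝ →L[ℝ] ℝ,
      (∀ v, HasFDerivAt (P v) (A v) p) ∧ ∀ v w, A w v - A v w
        = D.om (c p) (dW c Q p v) (dW c Q p w) := fun p hp =>
    hasFDerivAt_pullback_primitive D (cylRect_mem_nhds hp) hc
      (hα p (mem_of_mem_nhds (cylRect_mem_nhds hp)))
  classical
  let I : Set (ℝ × ℝ) := Ioo a b ×ˢ Ioo (0 : ℝ) (2 * Real.pi)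
  -- The divergence theorem is applied to the field `(P (0, 1), -P (1, 0))`. Outside the open
  -- rectangle the values of the derivatives are immaterial; they are chosen so that the divergence
  -- is `w` everywhere, and its integrability is then the continuity of `w`.
  let f' : ℝ × ℝ → ℝ × ℝ →L[ℝ] ℝ := fun p =>
    if p ∈ I then fderiv ℝ (P (0, 1)) p else w p • ContinuousLinearMap.fst ℝ ℝ ℝ
  let g' : ℝ × ℝ → ℝ × ℝ →L[ℝ] ℝ := fun p =>
    if p ∈ I then -fderiv ℝ (P (1, 0)) p else 0
  have hsum : (fun p => f' p (1, 0) + g' p (0, 1)) = w := by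
    ext p
    by_cases hp : p ∈ I
    · obtain ⟨A, hA, hA'⟩ := hder p hp
      simp only [f', g', hp, if_true, (hA _).fderiv, neg_apply]
      rw [← sub_eq_add_neg, hA']
    · simp [f', g', hp]
  have key := integral_divergence_prod_Icc_of_hasFDerivAt_of_le (P (0, 1)) (fun p => -P (1, 0) p)
    f' g' (a, 0) (b, 2 * Real.pi) ⟨hab.le, hpi⟩ (by rw [← hQI]; exact hP _)
    (by rw [← hQI]; exact (hP _).neg)
    (fun p hp => by
      obtain ⟨A, hA, -⟩ := hder p hp
      have hp' : p ∈ I := hp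
      simp only [f', hp', if_true]
      exact (hA _).differentiableAt.hasFDerivAt)
    (fun p hp => by
      obtain ⟨A, hA, -⟩ := hder p hp
      have hp' : p ∈ I := hp
      simp only [g', hp', if_true]
      exact (hA _).differentiableAt.hasFDerivAt.neg)
    (by
      rw [hsum, ← hQI]
      exact hw.integrableOn_compact (isCompact_cylRect a b))
  rw [hsum, ← hQI] at key
  have hv : ∀ s ∈ Icc a b, (∫ θ in (0 : ℝ)..(2 * Real.pi), P (0, 1) (s, θ))
      = ∫ θ in (0 : ℝ)..(2 * Real.pi),
        α (c (s, θ)) (dW (fun θ => c (s, θ)) (Icc 0 (2 * Real.pi)) θ 1) := by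
    intro s hs
    refine intervalIntegral.integral_congr fun θ hθ => ?_
    rw [uIcc_of_le hpi] at hθ
    simp only [P]
    rw [dW_vertical hc hs hθ]
  have hh : ∀ θ ∈ Icc (0 : ℝ) (2 * Real.pi), (∫ s in a..b, -P (1, 0) (s, θ))
      = -∫ s in a..b, α (c (s, θ)) (dW (fun s => c (s, θ)) (Icc a b) s 1) := by
    intro θ hθ
    rw [intervalIntegral.integral_neg]
    congr 1
    refine intervalIntegral.integral_congr fun s hs => ?_
    rw [uIcc_of_le hab.le] at hs
    simp only [P]
    rw [dW_horizontal hab hc hs hθ]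
  rw [hv b (right_mem_Icc.2 hab.le), hv a (left_mem_Icc.2 hab.le),
    hh _ (right_mem_Icc.2 hpi), hh _ (left_mem_Icc.2 hpi)] at key
  have harea : area D c a b = ∫ p in Q, w p := rfl
  rw [harea, key]
  ring

end Stokes
end SympVortex

namespace SympVortex

/-! ### The infinitesimal action and its pairing with the moment map. -/

section ActionDerivatives

variable {F : Type*} [NormedAddCommGroup F] [NormedSpace ℝ F]
  {E : Type*} [NormedAddCommGroup E] [NormedSpace ℝ E]
  {G : Type*} [TopologicalSpace G] [ChartedSpace F G] [Group G] [LieGroup 𝓘(ℝ, F) ∞ G]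
  {X : Type*} [TopologicalSpace X] [ChartedSpace E X] [IsManifold 𝓘(ℝ, E) ∞ X]
  [MulAction G X] [ContMDiffSMul 𝓘(ℝ, F) 𝓘(ℝ, E) ∞ G X]
  {N : Type*} [NormedAddCommGroup N] [NormedSpace ℝ N]

variable (G) in
/-- The infinitesimal action as a map between the model spaces. -/
def inf (x : X) : F →L[ℝ] E := infAction G x

/-- The derivative of a self-map of `X`. -/
def dT (R : X → X) (x : X) : E →L[ℝ] E := mfderiv 𝓘(ℝ, E) 𝓘(ℝ, E) R x

variable (G) in
theorem contMDiff_orbit (x : X) : ContMDiff 𝓘(ℝ, F) 𝓘(ℝ, E) ∞ (fun g : G => g • x) :=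
  contMDiff_id.smul contMDiff_const

theorem hasMFDerivAt_orbit (x : X) :
    HasMFDerivAt 𝓘(ℝ, F) 𝓘(ℝ, E) (fun g : G => g • x) 1 (inf (F := F) (E := E) G x) :=
  ((contMDiff_orbit G x).mdifferentiableAt (by simp)).hasMFDerivAt

/-- The derivative in an orbit direction depends only on the restriction of `ψ` to the orbit. For
the moment map on the zero level and for an invariant radius this restriction is constant. -/
theorem dX_inf_eq {ψ : X → N} {x : X} (hψ : MDifferentiableAt 𝓘(ℝ, E) 𝓘(ℝ, N) ψ x)
    {A : F →L[ℝ] N}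
    (hA : HasMFDerivAt 𝓘(ℝ, F) 𝓘(ℝ, N) (fun g : G => ψ (g • x)) 1 A) (ξ : F) :
    dX (E := E) ψ x (inf (F := F) (E := E) G x ξ) = A ξ := by
  have h1 : HasMFDerivAt 𝓘(ℝ, E) 𝓘(ℝ, N) ψ ((1 : G) • x) (dX (E := E) (N := N) ψ x) := by
    have := hψ.hasMFDerivAt
    rw [one_smul]; exact this
  have h2 := HasMFDerivAt.comp (I' := 𝓘(ℝ, E)) (1 : G) h1 (hasMFDerivAt_orbit (F := F) (E := E) (G := G) x)
  have h3 := hasMFDerivAt_unique h2 hA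
  exact DFunLike.congr_fun h3 ξ

theorem dT_inf_eq {R : X → X} {x : X} (hR : MDifferentiableAt 𝓘(ℝ, E) 𝓘(ℝ, E) R x)
    (heq : ∀ g : G, R (g • x) = g • R x) (ξ : F) :
    dT (E := E) R x (inf (F := F) (E := E) G x ξ) = inf (F := F) (E := E) G (R x) ξ := by
  have h1 : HasMFDerivAt 𝓘(ℝ, E) 𝓘(ℝ, E) R ((1 : G) • x) (dT (E := E) R x) := by
    have := hR.hasMFDerivAt
    rw [one_smul]; exact this
  have h2 := HasMFDerivAt.comp (I' := 𝓘(ℝ, E)) (1 : G) h1 (hasMFDerivAt_orbit (F := F) (E := E) (G := G) x)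
  have h3 : HasMFDerivAt 𝓘(ℝ, F) 𝓘(ℝ, E) (R ∘ fun g : G => g • x) 1 (inf (F := F) (E := E) G (R x)) := by
    have : (R ∘ fun g : G => g • x) = fun g : G => g • R x := funext heq
    rw [this]; exact hasMFDerivAt_orbit (R x)
  exact DFunLike.congr_fun (hasMFDerivAt_unique h2 h3) ξ

/-- The tangent vectors of an orbit are values of the infinitesimal action. -/
theorem exists_inf_eq_of_orbit (x : X) (g : G) (ζ : F) :
    ∃ ξ : F, (mfderiv 𝓘(ℝ, F) 𝓘(ℝ, E) (fun h : G => h • x) g : F →L[ℝ] E) ζ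
      = inf (F := F) (E := E) G (g • x) ξ := by
  -- Writing `h • x = (h * g⁻¹) • (g • x)` moves the differentiation from `g` to the unit.
  have h1 : HasMFDerivAt 𝓘(ℝ, F) 𝓘(ℝ, E) (fun k : G => k • (g • x)) (g * g⁻¹) (inf (F := F) (E := E) G (g • x)) := by
    rw [mul_inv_cancel]; exact hasMFDerivAt_orbit (g • x)
  have h2 : MDifferentiableAt 𝓘(ℝ, F) 𝓘(ℝ, F) (fun h : G => h * g⁻¹) g :=
    (contMDiff_mul_right (I := 𝓘(ℝ, F)) (n := ∞) (a := g⁻¹)).mdifferentiableAt (by simp)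
  have h3 := HasMFDerivAt.comp g h1 h2.hasMFDerivAt
  have h4 : ((fun k : G => k • (g • x)) ∘ fun h : G => h * g⁻¹) = fun h : G => h • x := by
    ext h; simp [smul_smul]
  rw [h4] at h3
  exact ⟨_, DFunLike.congr_fun h3.mfderiv ζ⟩

/-- Applied to the blown-up centre `θ ↦ g θ • z₀` of a capping: its velocity is an orbit direction,
on which the primitive is given by the moment map. -/
theorem exists_inf_eq_of_curve {c : N → G} {Q : Set N} {n : N}
    (hc : MDifferentiableWithinAt 𝓘(ℝ, N) 𝓘(ℝ, F) c Q n) (hQ : UniqueDiffWithinAt ℝ Q n)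
    (x : X) (v : N) :
    ∃ ξ : F, dW (E := E) (fun n => c n • x) Q n v = inf (F := F) (E := E) G (c n • x) ξ := by
  have h1 : MDifferentiableAt 𝓘(ℝ, F) 𝓘(ℝ, E) (fun h : G => h • x) (c n) :=
    (contMDiff_orbit G x).mdifferentiableAt (by simp)
  have h2 := mfderiv_comp_mfderivWithin n h1 hc hQ.uniqueMDiffWithinAt
  obtain ⟨ξ, hξ⟩ := exists_inf_eq_of_orbit (F := F) (E := E) x (c n)
    ((mfderivWithin 𝓘(ℝ, N) 𝓘(ℝ, F) c Q n : N →L[ℝ] F) v)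
  exact ⟨ξ, (DFunLike.congr_fun h2 v).trans hξ⟩

variable (D : HamiltonianSpace F E G X)

theorem ham (x : X) (ξ : F) (v : E) : D.om x (inf (F := F) (E := E) G x ξ) v = D.ip (dX (E := E) D.μ x v) ξ :=
  D.μ_hamiltonian x ξ v

theorem mu_smul_eq_zero {x : X} (hx : D.μ x = 0) (g : G) : D.μ (g • x) = 0 := by
  rw [D.μ_equivariant, hx, map_zero]

theorem dX_mu_inf {x : X} (hx : D.μ x = 0) (ξ : F) : dX (E := E) D.μ x (inf (F := F) (E := E) G x ξ) = 0 := by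
  have hA : HasMFDerivAt 𝓘(ℝ, F) 𝓘(ℝ, F) (fun g : G => D.μ (g • x)) 1 (0 : F →L[ℝ] F) := by
    have : (fun g : G => D.μ (g • x)) = fun _ => 0 := funext fun g => mu_smul_eq_zero D hx g
    rw [this]
    exact hasMFDerivAt_const (0 : F) (1 : G)
  rw [dX_inf_eq (D.μ_smooth.mdifferentiableAt (by simp)) hA]
  rfl

/-- The moment map is constant along an orbit in the zero level, hence such an orbit is isotropic.
This removes the end `s = 0` from the homotopy formula. -/
theorem om_inf_inf {x : X} (hx : D.μ x = 0) (ξ ζ : F) : D.om x (inf (F := F) (E := E) G x ξ) (inf (F := F) (E := E) G x ζ) = 0 := by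
  rw [ham, dX_mu_inf D hx]; simp

end ActionDerivatives
end SympVortex

namespace SympVortex

/-! ### Local and uniform bounds in the metric of the manifold. -/

section Bounds

variable {F : Type*} [NormedAddCommGroup F] [NormedSpace ℝ F]
  {E : Type*} [NormedAddCommGroup E] [NormedSpace ℝ E] [FiniteDimensional ℝ E]
  {G : Type*} [TopologicalSpace G] [ChartedSpace F G] [Group G] [LieGroup 𝓘(ℝ, F) ∞ G]
  {X : Type*} [TopologicalSpace X] [ChartedSpace E X] [IsManifold 𝓘(ℝ, E) ∞ X]
  [MulAction G X] [ContMDiffSMul 𝓘(ℝ, F) 𝓘(ℝ, E) ∞ G X]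
  {H : Type*} [NormedAddCommGroup H] [NormedSpace ℝ H]

theorem normTan_nonneg (D : HamiltonianSpace F E G X) (x : X) (w : E) : 0 ≤ D.normTan x w :=
  Real.sqrt_nonneg _

/-- The derivative of a smooth map is locally bounded with respect to the metric of `X`. -/
theorem exists_norm_dX_le (D : HamiltonianSpace F E G X) {ψ : X → H} {x₀ : X}
    (hψ : ∀ᶠ x in 𝓝 x₀, ContMDiffAt 𝓘(ℝ, E) 𝓘(ℝ, H) ∞ ψ x) :
    ∃ C : ℝ, 0 ≤ C ∧ ∀ᶠ x in 𝓝 x₀, ∀ w : E, ‖dX ψ x w‖ ≤ C * D.normTan x w := by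
  set φ := extChartAt 𝓘(ℝ, E) x₀
  have hs : ∀ᶠ x in 𝓝 x₀, x ∈ φ.source := extChartAt_source_mem_nhds x₀
  set f : E → H := fun y => ψ (φ.symm y)
  have hf : ContDiffAt ℝ ∞ f (φ x₀) := by
    rw [← contMDiffAt_iff_contDiffAt]
    refine ContMDiffAt.comp (I' := 𝓘(ℝ, E)) (g := ψ) (φ x₀) ?_
      ((contMDiffOn_extChartAt_symm x₀).contMDiffAt
        ((isOpen_extChartAt_target x₀).mem_nhds (mem_extChartAt_target x₀)))
    rw [φ.left_inv (mem_extChartAt_source x₀)]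
    exact hψ.self_of_nhds
  have hDf : ContinuousAt (fun x => fderiv ℝ f (φ x)) x₀ :=
    ContinuousAt.comp (f := φ) (g := fderiv ℝ f)
      (hf.fderiv_right (m := 0) (by norm_cast)).continuousAt (continuousAt_extChartAt x₀)
  have hfd : ∀ᶠ x in 𝓝 x₀, DifferentiableAt ℝ f (φ x) :=
    (continuousAt_extChartAt (I := 𝓘(ℝ, E)) x₀).eventually
      (((hf.of_le (m := 1) (by norm_cast)).eventually (by simp)).mono
        fun y hy => hy.differentiableAt (by simp))
  obtain ⟨C, hC, hev⟩ := exists_norm_chartD_le D x₀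
  refine ⟨(‖fderiv ℝ f (φ x₀)‖ + 1) * C, by positivity, ?_⟩
  have hb := hDf.norm.eventually (gt_mem_nhds (lt_add_one ‖fderiv ℝ f (φ x₀)‖))
  filter_upwards [hev, hs.eventually_nhds, hfd, hb] with x hx hxs hxd hxb w
  have hxs0 := hxs.self_of_nhds
  have h1 : HasMFDerivAt 𝓘(ℝ, E) 𝓘(ℝ, H) (f ∘ φ) x ((fderiv ℝ f (φ x)).comp (chartD (E := E) x₀ x) : E →L[ℝ] H) :=
    HasMFDerivAt.comp (I' := 𝓘(ℝ, E)) x hxd.hasFDerivAt.hasMFDerivAt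
      (mdifferentiableAt_extChartAt (by rwa [extChartAt_source] at hxs0)).hasMFDerivAt
  have h2 : ψ =ᶠ[𝓝 x] f ∘ φ := by
    filter_upwards [hxs] with y hy
    simp [f, φ.left_inv hy]
  have h3 : dX ψ x = (fderiv ℝ f (φ x)).comp (chartD x₀ x) := (h1.congr_of_eventuallyEq h2).mfderiv
  rw [h3, ContinuousLinearMap.comp_apply, mul_assoc]
  exact (ContinuousLinearMap.le_opNorm _ _).trans
    (mul_le_mul hxb.le (hx w) (norm_nonneg _) (by positivity))

theorem HasPrimitiveAt.exists_bound {D : HamiltonianSpace F E G X} {α : X → E →L[ℝ] ℝ} {x₀ : X}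
    (h : HasPrimitiveAt H D α x₀) :
    ∃ C : ℝ, 0 ≤ C ∧ ∀ᶠ x in 𝓝 x₀, ∀ w : E, |α x w| ≤ C * D.normTan x w := by
  obtain ⟨ψ, β, hev⟩ := h
  obtain ⟨C, hC, hCev⟩ := exists_norm_dX_le D (hev.mono fun x hx => hx.1)
  have h0 := hev.self_of_nhds
  have hβ : ContinuousAt (fun x => β (ψ x)) x₀ :=
    ContinuousAt.comp (g := β) h0.2.1.continuousAt h0.1.continuousAt
  refine ⟨(‖β (ψ x₀)‖ + 1) * C, by positivity, ?_⟩
  filter_upwards [hev, hCev, hβ.norm.eventually (gt_mem_nhds (lt_add_one ‖β (ψ x₀)‖))]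
    with x hx hxC hxb w
  rw [hx.2.2.1, ← Real.norm_eq_abs, mul_assoc]
  exact (ContinuousLinearMap.le_opNorm _ _).trans
    (mul_le_mul hxb.le (hxC w) (norm_nonneg _) (by positivity))

/-- Local bounds are uniform on compact sets. -/
theorem exists_uniform_bound {K : Set X} (hK : IsCompact K) {P : ℝ → X → Prop}
    (hmono : ∀ C C' x, C ≤ C' → P C x → P C' x)
    (h : ∀ x ∈ K, ∃ C : ℝ, 0 ≤ C ∧ ∀ᶠ y in 𝓝 x, P C y) :
    ∃ C : ℝ, 0 ≤ C ∧ ∀ x ∈ K, P C x := by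
  refine hK.induction_on (p := fun s => ∃ C : ℝ, 0 ≤ C ∧ ∀ x ∈ s, P C x) ⟨0, le_rfl, by simp⟩ ?_ ?_ ?_
  · rintro s t hst ⟨C, hC, ht⟩
    exact ⟨C, hC, fun x hx => ht x (hst hx)⟩
  · rintro s t ⟨C, hC, hs⟩ ⟨C', hC', ht⟩
    refine ⟨max C C', le_max_of_le_left hC, fun x hx => ?_⟩
    rcases hx with hx | hx
    · exact hmono _ _ _ (le_max_left _ _) (hs x hx)
    · exact hmono _ _ _ (le_max_right _ _) (ht x hx)
  · intro x hx
    obtain ⟨C, hC, hev⟩ := h x hx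
    exact ⟨_, nhdsWithin_le_nhds hev, C, hC, fun y hy => hy⟩

end Bounds

/-! ### Slices, tubes, the contraction and the radius. -/

section SliceDef

variable {F : Type*} [NormedAddCommGroup F] [NormedSpace ℝ F]
  {E : Type*} [NormedAddCommGroup E] [NormedSpace ℝ E]
  {G : Type*} [TopologicalSpace G] [ChartedSpace F G] [Group G] [LieGroup 𝓘(ℝ, F) ∞ G]
  {X : Type*} [TopologicalSpace X] [ChartedSpace E X] [IsManifold 𝓘(ℝ, E) ∞ X]
  [MulAction G X] [ContMDiffSMul 𝓘(ℝ, F) 𝓘(ℝ, E) ∞ G X]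

/-- A slice of the action at `z`: a submanifold `σ(B)` through `z`, parametrized by a ball
`B = {q < r}` of a linear representation `S` of the finite stabilizer of `z`, such that
`G ×_{Stab z} B → X` is a diffeomorphism onto an open neighbourhood of the orbit of `z`. In the
parametrization the moment map is linear and `pr` is an equivariant projection to its kernel. -/
structure Slice (D : HamiltonianSpace F E G X) (z : X) where
  /-- the representation space -/
  S : Submodule ℝ E
  /-- the parametrization of the slice -/
  σ : S → X
  /-- an invariant quadratic form -/
  q : S → ℝ
  /-- the size of the slice -/
  r : ℝ
  /-- the action of the stabilizer -/
  act : G → S →L[ℝ] S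
  /-- the equivariant projection to the kernel of the moment map -/
  pr : S →L[ℝ] S
  /-- the moment map in the slice -/
  mom : S →L[ℝ] F
  r_pos : 0 < r
  q_smooth : ContDiff ℝ ∞ q
  q_smul : ∀ (s : ℝ) v, q (s • v) = s ^ 2 * q v
  q_lower : ∃ c : ℝ, 0 < c ∧ ∀ v, c * ‖v‖ ^ 2 ≤ q v
  q_act : ∀ γ : G, γ • z = z → ∀ v, q (act γ v) = q v
  σ_zero : σ 0 = z
  σ_smooth : ∀ v, q v < r → ContMDiffAt 𝓘(ℝ, S) 𝓘(ℝ, E) ∞ σ v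
  σ_act : ∀ γ : G, γ • z = z → ∀ v, q v < r → σ (act γ v) = γ • σ v
  exists_section : ∀ v₀, q v₀ < r → ∃ (κ : X → G) (π : X → S), κ (σ v₀) = 1 ∧ π (σ v₀) = v₀ ∧
    ∀ᶠ x in 𝓝 (σ v₀), ContMDiffAt 𝓘(ℝ, E) 𝓘(ℝ, F) ∞ κ x ∧ ContMDiffAt 𝓘(ℝ, E) 𝓘(ℝ, S) ∞ π x ∧
      κ x • σ (π x) = x
  slice : ∀ (k : G) v v', q v < r → q v' < r → k • σ v = σ v' → k • z = z ∧ act k v = v'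
  stab_finite : {k : G | k • z = z}.Finite
  -- Each translate of the slice lies in one chart, so that the homotopy formula, which concerns
  -- forms on a vector space, applies to a whole contraction path.
  exists_chart : ∀ k : G, ∃ x₁ : X, ∀ v, q v < r → k • σ v ∈ (chartAt E x₁).source
  pr_act : ∀ γ : G, γ • z = z → ∀ v, pr (act γ v) = act γ (pr v)
  mu_σ : ∀ v, q v < r → D.μ (σ v) = mom v
  mom_pr : ∀ v, mom (pr v) = 0

end SliceDef

namespace Slice

variable {F : Type*} [NormedAddCommGroup F] [NormedSpace ℝ F]
  {E : Type*} [NormedAddCommGroup E] [NormedSpace ℝ E]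
  {G : Type*} [TopologicalSpace G] [ChartedSpace F G] [Group G] [LieGroup 𝓘(ℝ, F) ∞ G]
  {X : Type*} [TopologicalSpace X] [ChartedSpace E X] [IsManifold 𝓘(ℝ, E) ∞ X]
  [MulAction G X] [ContMDiffSMul 𝓘(ℝ, F) 𝓘(ℝ, E) ∞ G X]
  {D : HamiltonianSpace F E G X} {z : X} (𝒮 : Slice D z)

theorem q_nonneg (v : 𝒮.S) : 0 ≤ 𝒮.q v := by
  obtain ⟨c, hc, h⟩ := 𝒮.q_lower
  exact le_trans (by positivity) (h v)

theorem q_zero : 𝒮.q 0 = 0 := by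
  have := 𝒮.q_smul 0 0
  simpa using this

theorem q_smul_le {s : ℝ} (hs : s ∈ Icc (0 : ℝ) 1) (v : 𝒮.S) : 𝒮.q (s • v) ≤ 𝒮.q v := by
  rw [𝒮.q_smul]
  exact mul_le_of_le_one_left (𝒮.q_nonneg v) (pow_le_one₀ hs.1 hs.2)

/-- The tubular neighbourhood of size `r'` of the orbit. -/
def tube (r' : ℝ) : Set X := {x | ∃ (k : G) (v : 𝒮.S), 𝒮.q v < r' ∧ k • 𝒮.σ v = x}

theorem smul_mem_tube {r' : ℝ} {x : X} (hx : x ∈ 𝒮.tube r') (g : G) : g • x ∈ 𝒮.tube r' := by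
  obtain ⟨k, v, hv, rfl⟩ := hx
  exact ⟨g * k, v, hv, mul_smul _ _ _⟩

theorem tube_mono {r₁ r₂ : ℝ} (h : r₁ ≤ r₂) : 𝒮.tube r₁ ⊆ 𝒮.tube r₂ := by
  rintro x ⟨k, v, hv, rfl⟩
  exact ⟨k, v, hv.trans_le h, rfl⟩

theorem mem_tube_self {r' : ℝ} (hr : 0 < r') : z ∈ 𝒮.tube r' :=
  ⟨1, 0, by rwa [𝒮.q_zero], by rw [one_smul, 𝒮.σ_zero]⟩

open Classical in
/-- The contraction of the tube to the orbit. -/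
def contr (s : ℝ) (x : X) : X :=
  if h : x ∈ 𝒮.tube 𝒮.r then h.choose • 𝒮.σ (s • h.choose_spec.choose) else x

open Classical in
/-- The invariant function `k • σ v ↦ q v`. -/
def radius (x : X) : ℝ :=
  if h : x ∈ 𝒮.tube 𝒮.r then 𝒮.q h.choose_spec.choose else 0

theorem slice_eq {k k' : G} {v v' : 𝒮.S} (hv : 𝒮.q v < 𝒮.r) (hv' : 𝒮.q v' < 𝒮.r)
    (h : k' • 𝒮.σ v' = k • 𝒮.σ v) :
    (k'⁻¹ * k) • z = z ∧ 𝒮.act (k'⁻¹ * k) v = v' := by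
  refine 𝒮.slice _ v v' hv hv' ?_
  rw [mul_smul, ← h, inv_smul_smul]

/-- Two representations `k • σ v` of a point differ by an element of the stabilizer, which acts
linearly and so commutes with scaling; the choice in the definition is therefore harmless. The
parameter `s` may leave `[0, 1]` slightly, which makes the derivatives at `s = 0` and `s = 1`
two-sided. -/
theorem contr_apply {s : ℝ} {k : G} {v : 𝒮.S} (hv : 𝒮.q v < 𝒮.r) (hs : 𝒮.q (s • v) < 𝒮.r) :
    𝒮.contr s (k • 𝒮.σ v) = k • 𝒮.σ (s • v) := by
  have hx : k • 𝒮.σ v ∈ 𝒮.tube 𝒮.r := ⟨k, v, hv, rfl⟩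
  rw [contr, dif_pos hx]
  obtain ⟨hv', h⟩ := hx.choose_spec.choose_spec
  obtain ⟨h1, h2⟩ := 𝒮.slice_eq hv hv' h
  rw [← h2, ← map_smul, 𝒮.σ_act _ h1 _ hs, mul_smul, smul_inv_smul]

theorem radius_apply {k : G} {v : 𝒮.S} (hv : 𝒮.q v < 𝒮.r) : 𝒮.radius (k • 𝒮.σ v) = 𝒮.q v := by
  have hx : k • 𝒮.σ v ∈ 𝒮.tube 𝒮.r := ⟨k, v, hv, rfl⟩
  rw [radius, dif_pos hx]
  obtain ⟨hv', h⟩ := hx.choose_spec.choose_spec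
  obtain ⟨h1, h2⟩ := 𝒮.slice_eq hv hv' h
  rw [← h2, 𝒮.q_act _ h1]

theorem contr_smul {s : ℝ} (hs : s ∈ Icc (0 : ℝ) 1) {x : X} (hx : x ∈ 𝒮.tube 𝒮.r) (g : G) :
    𝒮.contr s (g • x) = g • 𝒮.contr s x := by
  obtain ⟨k, v, hv, rfl⟩ := hx
  have h := (𝒮.q_smul_le hs v).trans_lt hv
  rw [← mul_smul, 𝒮.contr_apply hv h, 𝒮.contr_apply hv h, mul_smul]

theorem contr_one {x : X} (hx : x ∈ 𝒮.tube 𝒮.r) : 𝒮.contr 1 x = x := by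
  obtain ⟨k, v, hv, rfl⟩ := hx
  rw [𝒮.contr_apply hv (by rwa [one_smul]), one_smul]

theorem radius_smul {x : X} (hx : x ∈ 𝒮.tube 𝒮.r) (g : G) :
    𝒮.radius (g • x) = 𝒮.radius x := by
  obtain ⟨k, v, hv, rfl⟩ := hx
  rw [← mul_smul, 𝒮.radius_apply hv, 𝒮.radius_apply hv]

/-- A local section of the tube near one of its points. -/
theorem exists_section_at {k₀ : G} {v₀ : 𝒮.S} (hv₀ : 𝒮.q v₀ < 𝒮.r) :
    ∃ (κ : X → G) (π : X → 𝒮.S), κ (k₀ • 𝒮.σ v₀) = k₀ ∧ π (k₀ • 𝒮.σ v₀) = v₀ ∧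
      ∀ᶠ x in 𝓝 (k₀ • 𝒮.σ v₀), ContMDiffAt 𝓘(ℝ, E) 𝓘(ℝ, F) ∞ κ x ∧
        ContMDiffAt 𝓘(ℝ, E) 𝓘(ℝ, 𝒮.S) ∞ π x ∧ κ x • 𝒮.σ (π x) = x := by
  obtain ⟨κ, π, h1, h2, hev⟩ := 𝒮.exists_section v₀ hv₀
  have hsm : ContMDiff 𝓘(ℝ, E) 𝓘(ℝ, E) ∞ (fun x : X => k₀⁻¹ • x) :=
    ContMDiffSMul.contMDiff_const_smul (I := 𝓘(ℝ, F)) k₀⁻¹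
  refine ⟨fun x => k₀ * κ (k₀⁻¹ • x), fun x => π (k₀⁻¹ • x), by simp [h1], by simp [h2], ?_⟩
  have hc : Tendsto (fun x : X => k₀⁻¹ • x) (𝓝 (k₀ • 𝒮.σ v₀)) (𝓝 (𝒮.σ v₀)) := by
    have := hsm.continuous.tendsto (k₀ • 𝒮.σ v₀)
    rwa [inv_smul_smul] at this
  filter_upwards [hc.eventually hev] with x hx
  refine ⟨?_, ?_, ?_⟩
  · exact contMDiffAt_const.mul (ContMDiffAt.comp x hx.1 (hsm x))
  · exact ContMDiffAt.comp x hx.2.1 (hsm x)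
  · rw [mul_smul, hx.2.2, smul_inv_smul]

theorem isOpen_tube {r' : ℝ} (hr : r' ≤ 𝒮.r) : IsOpen (𝒮.tube r') := by
  rw [isOpen_iff_mem_nhds]
  rintro x ⟨k, v, hv, rfl⟩
  obtain ⟨κ, π, -, h2, hev⟩ := 𝒮.exists_section_at (k₀ := k) (hv.trans_le hr)
  have hc : ContinuousAt (fun x => 𝒮.q (π x)) (k • 𝒮.σ v) :=
    ContinuousAt.comp (g := 𝒮.q) 𝒮.q_smooth.continuous.continuousAt
      hev.self_of_nhds.2.1.continuousAt
  have hlt : ∀ᶠ x in 𝓝 (k • 𝒮.σ v), 𝒮.q (π x) < r' :=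
    hc.eventually (gt_mem_nhds (by simpa only [h2] using hv))
  filter_upwards [hev, hlt] with x hx hxr
  exact ⟨κ x, π x, hxr, hx.2.2⟩

theorem isCompact_ball [FiniteDimensional ℝ E] (r' : ℝ) : IsCompact {v : 𝒮.S | 𝒮.q v ≤ r'} := by
  obtain ⟨c, hc, h⟩ := 𝒮.q_lower
  refine Metric.isCompact_of_isClosed_isBounded
    (isClosed_le 𝒮.q_smooth.continuous continuous_const) ?_
  refine (Metric.isBounded_closedBall (x := (0 : 𝒮.S)) (r := √(r' / c))).subset fun v hv => ?_
  rw [mem_closedBall_zero_iff]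
  refine Real.le_sqrt_of_sq_le ?_
  rw [le_div_iff₀ hc]
  have := h v
  have hv' : 𝒮.q v ≤ r' := hv
  linarith

/-- It is the image of the compact set `G × {q ≤ r'}`. Compactness makes local bounds uniform, and
closedness enters the continuity argument for curves. -/
theorem isCompact_closedTube [FiniteDimensional ℝ E] [CompactSpace G] {r' : ℝ} (hr : r' < 𝒮.r) :
    IsCompact {x : X | ∃ (k : G) (v : 𝒮.S), 𝒮.q v ≤ r' ∧ k • 𝒮.σ v = x} := by
  have h1 : IsCompact ((univ : Set G) ×ˢ {v : 𝒮.S | 𝒮.q v ≤ r'}) :=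
    isCompact_univ.prod (𝒮.isCompact_ball r')
  have : ContinuousSMul G X := ContMDiffSMul.continuousSMul (I := 𝓘(ℝ, F)) (I' := 𝓘(ℝ, E)) ∞
  have h2 : ContinuousOn (fun p : G × 𝒮.S => p.1 • 𝒮.σ p.2) (univ ×ˢ {v : 𝒮.S | 𝒮.q v ≤ r'}) := by
    rintro ⟨k, v⟩ ⟨-, hv⟩
    have hσ : ContinuousAt 𝒮.σ v := (𝒮.σ_smooth v (lt_of_le_of_lt hv hr)).continuousAt
    exact (continuousAt_fst.smul
      (ContinuousAt.comp (f := Prod.snd) (x := (k, v)) hσ continuousAt_snd)).continuousWithinAt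
  convert h1.image_of_continuousOn h2 using 1
  ext x
  simp

end Slice
end SympVortex

/-! ### The primitive that the contraction of a tube defines. -/

namespace SympVortex
namespace Slice

variable {F : Type*} [NormedAddCommGroup F] [NormedSpace ℝ F]
  {E : Type*} [NormedAddCommGroup E] [NormedSpace ℝ E]
  {G : Type*} [TopologicalSpace G] [ChartedSpace F G] [Group G] [LieGroup 𝓘(ℝ, F) ∞ G]
  {X : Type*} [TopologicalSpace X] [ChartedSpace E X] [IsManifold 𝓘(ℝ, E) ∞ X]
  [MulAction G X] [ContMDiffSMul 𝓘(ℝ, F) 𝓘(ℝ, E) ∞ G X]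
  {D : HamiltonianSpace F E G X} {z : X} (𝒮 : Slice D z)

/-- The contraction and the radius in local coordinates of the tube. -/
theorem exists_local_form {x₀ : X} (hx₀ : x₀ ∈ 𝒮.tube 𝒮.r) :
    ∃ (ψ : X → F × 𝒮.S) (Θ : ℝ × (F × 𝒮.S) → X) (κ : X → G), ∀ᶠ x in 𝓝 x₀,
      ContMDiffAt 𝓘(ℝ, E) 𝓘(ℝ, F × 𝒮.S) ∞ ψ x ∧ x ∈ 𝒮.tube 𝒮.r ∧
      MDifferentiableAt 𝓘(ℝ, E) 𝓘(ℝ, F) κ x ∧ 𝒮.contr 0 x = κ x • z ∧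
      𝒮.radius x = 𝒮.q (ψ x).2 ∧
      ∀ s ∈ Icc (0 : ℝ) 1, ContMDiffAt 𝓘(ℝ, ℝ × (F × 𝒮.S)) 𝓘(ℝ, E) ∞ Θ (s, ψ x) ∧
        ∀ᶠ s' in 𝓝 s, 𝒮.contr s' x = Θ (s', ψ x) := by
  obtain ⟨k₀, v₀, hv₀, rfl⟩ := hx₀
  obtain ⟨κ, π, h1, h2, hev⟩ := 𝒮.exists_section_at (k₀ := k₀) hv₀
  set φ := extChartAt 𝓘(ℝ, F) k₀
  have hκ := hev.self_of_nhds.1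
  have hπ := hev.self_of_nhds.2.1
  have hsrc : ∀ᶠ x in 𝓝 (k₀ • 𝒮.σ v₀), κ x ∈ φ.source := by
    refine hκ.continuousAt.eventually ?_
    rw [h1]
    exact extChartAt_source_mem_nhds k₀
  have hq : ∀ᶠ x in 𝓝 (k₀ • 𝒮.σ v₀), 𝒮.q (π x) < 𝒮.r := by
    have hc : ContinuousAt (fun x => 𝒮.q (π x)) (k₀ • 𝒮.σ v₀) :=
      ContinuousAt.comp (g := 𝒮.q) 𝒮.q_smooth.continuous.continuousAt hπ.continuousAt
    exact hc.eventually (gt_mem_nhds (by simpa only [h2] using hv₀))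
  -- In these coordinates the contraction leaves the group variable fixed and scales the slice
  -- variable, so it is smooth jointly in `s` and the point.
  refine ⟨fun x => (φ (κ x), π x), fun p => φ.symm p.2.1 • 𝒮.σ (p.1 • p.2.2), κ, ?_⟩
  filter_upwards [hev, hsrc, hq] with x hx hxs hxq
  have hs0 : 𝒮.q ((0 : ℝ) • π x) < 𝒮.r := by rw [zero_smul, 𝒮.q_zero]; exact 𝒮.r_pos
  refine ⟨?_, ⟨κ x, π x, hxq, hx.2.2⟩, hx.1.mdifferentiableAt (by simp), ?_, ?_, ?_⟩
  · refine ContMDiffAt.prodMk_space ?_ hx.2.1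
    exact ContMDiffAt.comp (I' := 𝓘(ℝ, F)) x
      (contMDiffAt_extChartAt' (by rwa [extChartAt_source] at hxs)) hx.1
  · conv_lhs => rw [← hx.2.2]
    rw [𝒮.contr_apply hxq hs0, zero_smul, 𝒮.σ_zero]
  · conv_lhs => rw [← hx.2.2]
    rw [𝒮.radius_apply hxq]
  · intro s hs
    have hsq := (𝒮.q_smul_le hs (π x)).trans_lt hxq
    constructor
    · refine ContMDiffAt.smul (I := 𝓘(ℝ, F)) (f := fun p : ℝ × (F × 𝒮.S) => φ.symm p.2.1)
        (g := fun p : ℝ × (F × 𝒮.S) => 𝒮.σ (p.1 • p.2.2)) ?_ ?_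
      · have ha : ContMDiffAt 𝓘(ℝ, F) 𝓘(ℝ, F) ∞ φ.symm (φ (κ x)) :=
          (contMDiffOn_extChartAt_symm k₀).contMDiffAt
            ((isOpen_extChartAt_target k₀).mem_nhds (φ.map_source hxs))
        refine ContMDiffAt.comp (I' := 𝓘(ℝ, F)) (g := φ.symm)
          (f := fun p : ℝ × (F × 𝒮.S) => p.2.1) _ ha ?_
        exact contMDiffAt_iff_contDiffAt.2 (by fun_prop)
      · refine ContMDiffAt.comp (I' := 𝓘(ℝ, 𝒮.S)) (g := 𝒮.σ)
          (f := fun p : ℝ × (F × 𝒮.S) => p.1 • p.2.2) _ (𝒮.σ_smooth _ hsq) ?_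
        exact contMDiffAt_iff_contDiffAt.2 (by fun_prop)
    · have hc : ContinuousAt (fun s' : ℝ => 𝒮.q (s' • π x)) s :=
        (𝒮.q_smooth.continuous.comp (by fun_prop)).continuousAt
      filter_upwards [hc.eventually (gt_mem_nhds hsq)] with s' hs'
      conv_lhs => rw [← hx.2.2]
      rw [𝒮.contr_apply hxq hs', φ.left_inv hxs]

/-- The primitive of `ω` on the tube that the contraction defines. -/
def alpha (x : X) : E →L[ℝ] ℝ :=
  ∫ s in (0 : ℝ)..1, (D.om (𝒮.contr s x) (dW (fun s => 𝒮.contr s x) univ s 1)).comp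
    (dT (𝒮.contr s) x)

/-- Allows the form `alpha` to be computed with the coefficients of `ω` in a single chart. -/
theorem contr_mem_chart {x : X} (hx : x ∈ 𝒮.tube 𝒮.r) :
    ∃ x₁ : X, ∀ s ∈ Icc (0 : ℝ) 1, 𝒮.contr s x ∈ (extChartAt 𝓘(ℝ, E) x₁).source := by
  obtain ⟨k, v, hv, rfl⟩ := hx
  obtain ⟨x₁, h⟩ := 𝒮.exists_chart k
  refine ⟨x₁, fun s hs => ?_⟩
  have hsq := (𝒮.q_smul_le hs v).trans_lt hv
  rw [𝒮.contr_apply hv hsq, extChartAt_source]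
  exact h _ hsq

/-- The form `alpha` in local coordinates. -/
theorem exists_alpha_local_form [FiniteDimensional ℝ E] {x₀ : X} (hx₀ : x₀ ∈ 𝒮.tube 𝒮.r) :
    ∃ (ψ : X → F × 𝒮.S) (f : ℝ × (F × 𝒮.S) → E) (κ : X → G) (x₁ : X), ∀ᶠ x in 𝓝 x₀,
      ContMDiffAt 𝓘(ℝ, E) 𝓘(ℝ, F × 𝒮.S) ∞ ψ x ∧ x ∈ 𝒮.tube 𝒮.r ∧
      MDifferentiableAt 𝓘(ℝ, E) 𝓘(ℝ, F) κ x ∧ 𝒮.contr 0 =ᶠ[𝓝 x] (fun x => κ x • z) ∧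
      ∀ s ∈ Icc (0 : ℝ) 1, ContDiffAt ℝ ∞ f (s, ψ x) ∧
        𝒮.contr s x ∈ (extChartAt 𝓘(ℝ, E) x₁).source ∧
        extChartAt 𝓘(ℝ, E) x₁ (𝒮.contr s x) = f (s, ψ x) ∧
        MDifferentiableAt 𝓘(ℝ, ℝ) 𝓘(ℝ, E) (fun s => 𝒮.contr s x) s ∧
        MDifferentiableAt 𝓘(ℝ, E) 𝓘(ℝ, E) (𝒮.contr s) x ∧
        chartD x₁ (𝒮.contr s x) (dW (fun s => 𝒮.contr s x) univ s 1)
          = fderiv ℝ f (s, ψ x) (1, 0) ∧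
        ∀ w, chartD x₁ (𝒮.contr s x) (dT (𝒮.contr s) x w) = fderiv ℝ f (s, ψ x) (0, dX ψ x w) := by
  obtain ⟨ψ, Θ, κ, hev⟩ := 𝒮.exists_local_form hx₀
  obtain ⟨x₁, hx₁⟩ := 𝒮.contr_mem_chart hx₀
  set φ := extChartAt 𝓘(ℝ, E) x₁
  have h0 := hev.self_of_nhds
  -- The chart that contains the contraction path of `x₀` also contains those of nearby points, by
  -- compactness of `[0, 1]`.
  have hsrc : ∀ᶠ x in 𝓝 x₀, ∀ s ∈ Icc (0 : ℝ) 1, Θ (s, ψ x) ∈ φ.source := by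
    refine isCompact_Icc.eventually_forall_of_forall_eventually
      (P := fun x s => Θ (s, ψ x) ∈ φ.source) fun s hs => ?_
    have hc : ContinuousAt (fun p : X × ℝ => Θ (p.2, ψ p.1)) (x₀, s) := by
      refine ContinuousAt.comp (g := Θ) (f := fun p : X × ℝ => (p.2, ψ p.1))
        (h0.2.2.2.2.2 s hs).1.continuousAt ?_
      exact continuousAt_snd.prodMk
        (ContinuousAt.comp (f := Prod.fst) (x := (x₀, s)) h0.1.continuousAt continuousAt_fst)
    refine hc.eventually ((isOpen_extChartAt_source x₁).mem_nhds ?_)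
    have := (h0.2.2.2.2.2 s hs).2.self_of_nhds
    simp only
    rw [← this]
    exact hx₁ s hs
  refine ⟨ψ, fun p => φ (Θ p), κ, x₁, ?_⟩
  filter_upwards [hev.eventually_nhds, hsrc] with x hxev hxs
  have hx := hxev.self_of_nhds
  refine ⟨hx.1, hx.2.1, hx.2.2.1, hxev.mono fun y hy => hy.2.2.2.1, fun s hs => ?_⟩
  obtain ⟨hΘ, hΘeq⟩ := hx.2.2.2.2.2 s hs
  have heq : 𝒮.contr s x = Θ (s, ψ x) := hΘeq.self_of_nhds
  have hφ : ContMDiffAt 𝓘(ℝ, E) 𝓘(ℝ, E) ∞ φ (Θ (s, ψ x)) :=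
    contMDiffAt_extChartAt' (by have := hxs s hs; rwa [extChartAt_source] at this)
  have hf : ContDiffAt ℝ ∞ (fun p => φ (Θ p)) (s, ψ x) :=
    contMDiffAt_iff_contDiffAt.1 (ContMDiffAt.comp (I' := 𝓘(ℝ, E)) _ hφ hΘ)
  have hfd : HasFDerivAt (fun p => φ (Θ p)) (fderiv ℝ (fun p => φ (Θ p)) (s, ψ x)) (s, ψ x) :=
    (hf.differentiableAt (by simp)).hasFDerivAt
  have hcs : MDifferentiableAt 𝓘(ℝ, ℝ) 𝓘(ℝ, E) (fun s => 𝒮.contr s x) s := by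
    refine MDifferentiableAt.congr_of_eventuallyEq ?_ hΘeq
    refine MDifferentiableAt.comp (I' := 𝓘(ℝ, ℝ × (F × 𝒮.S))) (g := Θ)
      (f := fun s : ℝ => (s, ψ x)) s (hΘ.mdifferentiableAt (by simp)) ?_
    exact (by fun_prop : DifferentiableAt ℝ (fun s : ℝ => (s, ψ x)) s).mdifferentiableAt
  have hxeq : 𝒮.contr s =ᶠ[𝓝 x] fun y => Θ (s, ψ y) :=
    hxev.mono fun y hy => (hy.2.2.2.2.2 s hs).2.self_of_nhds
  have hψ2 : HasMFDerivAt 𝓘(ℝ, E) 𝓘(ℝ, ℝ × (F × 𝒮.S)) (fun y => (s, ψ y)) x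
      ((ContinuousLinearMap.inr ℝ ℝ (F × 𝒮.S)).comp (dX (E := E) ψ x) :
        E →L[ℝ] ℝ × (F × 𝒮.S)) :=
    HasMFDerivAt.comp (I' := 𝓘(ℝ, F × 𝒮.S)) (f := ψ) x (hasFDerivAt_prodMk_right s (ψ x)).hasMFDerivAt
      (hx.1.mdifferentiableAt (by simp)).hasMFDerivAt
  have hcx : MDifferentiableAt 𝓘(ℝ, E) 𝓘(ℝ, E) (𝒮.contr s) x := by
    refine MDifferentiableAt.congr_of_eventuallyEq ?_ hxeq
    exact MDifferentiableAt.comp (I' := 𝓘(ℝ, ℝ × (F × 𝒮.S))) (g := Θ)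
      (f := fun y => (s, ψ y)) x (hΘ.mdifferentiableAt (by simp)) hψ2.mdifferentiableAt
  have hφ' : MDifferentiableAt 𝓘(ℝ, E) 𝓘(ℝ, E) φ (𝒮.contr s x) := by
    rw [heq]; exact hφ.mdifferentiableAt (by simp)
  refine ⟨hf, by rw [heq]; exact hxs s hs, by rw [heq], hcs, hcx, ?_, fun w => ?_⟩
  · have h3 := fderivWithin_comp_eq (E := E) (Q := univ) (c := fun s => 𝒮.contr s x) hφ'
      hcs.mdifferentiableWithinAt uniqueDiffWithinAt_univ 1
    have h4 : HasFDerivAt (fun s => φ (𝒮.contr s x)) ((fderiv ℝ (fun p => φ (Θ p)) (s, ψ x)).comp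
        (ContinuousLinearMap.inl ℝ ℝ (F × 𝒮.S))) s := by
      refine HasFDerivAt.congr_of_eventuallyEq (f := fun s => φ (Θ (s, ψ x))) ?_
        (hΘeq.mono fun s' hs' => by simp only [hs'])
      exact HasFDerivAt.comp (f := fun s : ℝ => (s, ψ x)) s hfd (hasFDerivAt_prodMk_left s (ψ x))
    rw [fderivWithin_univ, h4.fderiv] at h3
    exact h3.symm.trans (by simp)
  · have h3 : HasMFDerivAt 𝓘(ℝ, E) 𝓘(ℝ, E) (fun y => φ (𝒮.contr s y)) x
        ((chartD (E := E) x₁ (𝒮.contr s x)).comp (dT (E := E) (𝒮.contr s) x) : E →L[ℝ] E) :=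
      HasMFDerivAt.comp (I' := 𝓘(ℝ, E)) x hφ'.hasMFDerivAt hcx.hasMFDerivAt
    have h4 : HasMFDerivAt 𝓘(ℝ, E) 𝓘(ℝ, E) (fun y => φ (𝒮.contr s y)) x
        ((fderiv ℝ (fun p => φ (Θ p)) (s, ψ x)).comp
          ((ContinuousLinearMap.inr ℝ ℝ (F × 𝒮.S)).comp (dX (E := E) ψ x)) : E →L[ℝ] E) := by
      refine HasMFDerivAt.congr_of_eventuallyEq (f := fun y => φ (Θ (s, ψ y))) ?_
        (hxeq.mono fun s' hs' => by simp only [hs'])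
      exact HasMFDerivAt.comp (I' := 𝓘(ℝ, ℝ × (F × 𝒮.S))) (f := fun y => (s, ψ y)) x
        hfd.hasMFDerivAt hψ2
    exact DFunLike.congr_fun (hasMFDerivAt_unique h3 h4) w

end Slice
end SympVortex

namespace SympVortex
namespace Slice

variable {F : Type*} [NormedAddCommGroup F] [NormedSpace ℝ F]
  {E : Type*} [NormedAddCommGroup E] [NormedSpace ℝ E] [FiniteDimensional ℝ E]
  {G : Type*} [TopologicalSpace G] [ChartedSpace F G] [Group G] [LieGroup 𝓘(ℝ, F) ∞ G]
  {X : Type*} [TopologicalSpace X] [ChartedSpace E X] [IsManifold 𝓘(ℝ, E) ∞ X]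
  [MulAction G X] [ContMDiffSMul 𝓘(ℝ, F) 𝓘(ℝ, E) ∞ G X]
  {D : HamiltonianSpace F E G X} {z : X} (𝒮 : Slice D z)

theorem contDiffAt_omChart (D : HamiltonianSpace F E G X) {x₁ : X} {y : E}
    (hy : y ∈ (extChartAt 𝓘(ℝ, E) x₁).target) : ContDiffAt ℝ ∞ (D.omChart x₁) y :=
  (contDiffOn_omChart D x₁).contDiffAt ((isOpen_extChartAt_target x₁).mem_nhds hy)

theorem omChart_skew (D : HamiltonianSpace F E G X) (x₁ : X) (y a b : E) :
    D.omChart x₁ y a b = -D.omChart x₁ y b a := by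
  simp only [HamiltonianSpace.omChart, ContinuousLinearMap.bilinearComp_apply]
  exact om_skew D _ _ _

/-- The form `alpha` is the pull-back of the form of the homotopy formula. -/
theorem exists_alpha_eq {x₀ : X} (hx₀ : x₀ ∈ 𝒮.tube 𝒮.r) :
    ∃ (ψ : X → F × 𝒮.S) (f : ℝ × (F × 𝒮.S) → E) (κ : X → G) (x₁ : X), ∀ᶠ x in 𝓝 x₀,
      (ContMDiffAt 𝓘(ℝ, E) 𝓘(ℝ, F × 𝒮.S) ∞ ψ x ∧ x ∈ 𝒮.tube 𝒮.r ∧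
      MDifferentiableAt 𝓘(ℝ, E) 𝓘(ℝ, F) κ x ∧ 𝒮.contr 0 =ᶠ[𝓝 x] (fun x => κ x • z) ∧
      ∀ s ∈ Icc (0 : ℝ) 1, ContDiffAt ℝ ∞ f (s, ψ x) ∧
        f (s, ψ x) ∈ (extChartAt 𝓘(ℝ, E) x₁).target ∧
        MDifferentiableAt 𝓘(ℝ, ℝ) 𝓘(ℝ, E) (fun s => 𝒮.contr s x) s ∧
        MDifferentiableAt 𝓘(ℝ, E) 𝓘(ℝ, E) (𝒮.contr s) x ∧
        (∀ v w, D.om (𝒮.contr s x) (dT (𝒮.contr s) x v) (dT (𝒮.contr s) x w)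
          = D.omChart x₁ (f (s, ψ x)) (fderiv ℝ f (s, ψ x) (0, dX ψ x v))
            (fderiv ℝ f (s, ψ x) (0, dX ψ x w))) ∧
        ∀ w, D.om (𝒮.contr s x) (dW (fun s => 𝒮.contr s x) univ s 1) (dT (𝒮.contr s) x w)
          = D.omChart x₁ (f (s, ψ x)) (fderiv ℝ f (s, ψ x) (1, 0))
            (fderiv ℝ f (s, ψ x) (0, dX ψ x w))) ∧
      𝒮.alpha x = (homotopyForm (D.omChart x₁) f (ψ x)).comp (dX ψ x) := by
  obtain ⟨ψ, f, κ, x₁, hev⟩ := 𝒮.exists_alpha_local_form hx₀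
  refine ⟨ψ, f, κ, x₁, hev.mono fun x hx => ?_⟩
  have hloc : ∀ s ∈ Icc (0 : ℝ) 1, ContDiffAt ℝ ∞ f (s, ψ x) ∧
        f (s, ψ x) ∈ (extChartAt 𝓘(ℝ, E) x₁).target ∧
        MDifferentiableAt 𝓘(ℝ, ℝ) 𝓘(ℝ, E) (fun s => 𝒮.contr s x) s ∧
        MDifferentiableAt 𝓘(ℝ, E) 𝓘(ℝ, E) (𝒮.contr s) x ∧
        (∀ v w, D.om (𝒮.contr s x) (dT (𝒮.contr s) x v) (dT (𝒮.contr s) x w)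
          = D.omChart x₁ (f (s, ψ x)) (fderiv ℝ f (s, ψ x) (0, dX ψ x v))
            (fderiv ℝ f (s, ψ x) (0, dX ψ x w))) ∧
        ∀ w, D.om (𝒮.contr s x) (dW (fun s => 𝒮.contr s x) univ s 1) (dT (𝒮.contr s) x w)
          = D.omChart x₁ (f (s, ψ x)) (fderiv ℝ f (s, ψ x) (1, 0))
            (fderiv ℝ f (s, ψ x) (0, dX ψ x w)) := by
    intro s hs
    obtain ⟨h1, h2, h3, h4, h5, h6, h7⟩ := hx.2.2.2.2 s hs
    refine ⟨h1, h3 ▸ (extChartAt 𝓘(ℝ, E) x₁).map_source h2, h4, h5, fun v w => ?_, fun w => ?_⟩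
    · rw [om_eq_omChart D x₁ h2, h7, h7, h3]
    · rw [om_eq_omChart D x₁ h2, h6, h7, h3]
  refine ⟨⟨hx.1, hx.2.1, hx.2.2.1, hx.2.2.2.1, hloc⟩, ?_⟩
  rw [homotopyForm_comp (fun s hs => (hloc s hs).1)
    (fun s hs => contDiffAt_omChart D (hloc s hs).2.1)]
  refine intervalIntegral.integral_congr fun s hs => ?_
  rw [uIcc_of_le zero_le_one] at hs
  ext w
  exact (hloc s hs).2.2.2.2.2 w

/-- The homotopy formula gives `d alpha = (contr 1)^*ω - (contr 0)^*ω`. The map `contr 1` is the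
identity of the tube, and `contr 0` maps to the orbit of `z`, on which `ω` vanishes. -/
theorem hasPrimitiveAt_alpha (hz : D.μ z = 0) {x₀ : X} (hx₀ : x₀ ∈ 𝒮.tube 𝒮.r) :
    HasPrimitiveAt (F × 𝒮.S) D 𝒮.alpha x₀ := by
  obtain ⟨ψ, f, κ, x₁, hev⟩ := 𝒮.exists_alpha_eq hx₀
  refine ⟨ψ, homotopyForm (D.omChart x₁) f, hev.mono fun x hx => ?_⟩
  obtain ⟨⟨hψ, hxt, hκ, hκeq, hloc⟩, hα⟩ := hx
  obtain ⟨β', hβ', hd⟩ := hasFDerivAt_homotopyForm (Ω := D.omChart x₁) (f := f) (q := ψ x)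
    (fun s hs => (hloc s hs).1) (fun s hs => contDiffAt_omChart D (hloc s hs).2.1)
    (omChart_skew D x₁) (fun s hs => omChart_closed D x₁ (hloc s hs).2.1)
  refine ⟨hψ, hβ'.differentiableAt, fun w => by rw [hα]; rfl, fun v w => ?_⟩
  rw [hβ'.fderiv, hd]
  have e1 := (hloc 1 (by simp)).2.2.2.2.1 v w
  have e0 := (hloc 0 (by simp)).2.2.2.2.1 v w
  rw [← e1, ← e0]
  have hid : dT (E := E) (𝒮.contr 1) x = ContinuousLinearMap.id ℝ E := by
    have h1 : 𝒮.contr 1 =ᶠ[𝓝 x] id := by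
      filter_upwards [(𝒮.isOpen_tube le_rfl).mem_nhds hxt] with y hy
      exact 𝒮.contr_one hy
    exact ((hasMFDerivAt_id x).congr_of_eventuallyEq h1).mfderiv
  have hor : ∀ v : E, ∃ ξ : F, dT (E := E) (𝒮.contr 0) x v = inf G (𝒮.contr 0 x) ξ := by
    intro v
    have h1 : MDifferentiableAt 𝓘(ℝ, F) 𝓘(ℝ, E) (fun h : G => h • z) (κ x) :=
      (contMDiff_orbit G z).mdifferentiableAt (by simp)
    have h2 := (HasMFDerivAt.comp x h1.hasMFDerivAt hκ.hasMFDerivAt).congr_of_eventuallyEq hκeq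
    obtain ⟨ξ, hξ⟩ := exists_inf_eq_of_orbit (F := F) (E := E) z (κ x)
      ((mfderiv 𝓘(ℝ, E) 𝓘(ℝ, F) κ x : E →L[ℝ] F) v)
    refine ⟨ξ, ?_⟩
    rw [hκeq.self_of_nhds]
    exact (DFunLike.congr_fun h2.mfderiv v).trans hξ
  obtain ⟨ξ, hξ⟩ := hor v
  obtain ⟨ζ, hζ⟩ := hor w
  have hmu : D.μ (𝒮.contr 0 x) = 0 := by
    rw [hκeq.self_of_nhds]; exact mu_smul_eq_zero D hz _
  rw [hξ, hζ, om_inf_inf D hmu, hid, 𝒮.contr_one hxt]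
  simp

/-- An equivariant map carries `X_ξ` to `X_ξ`. The integrand that defines `alpha` is thus `ω(∂_s,
X_ξ)` along the contraction path, which is the derivative of `-⟨μ, ξ⟩` by the moment map equation.
The path ends at `x` and starts in the zero level. -/
theorem alpha_inf (hz : D.μ z = 0) {x : X} (hx : x ∈ 𝒮.tube 𝒮.r) (ξ : F) :
    𝒮.alpha x (inf G x ξ) = -D.ip (D.μ x) ξ := by
  obtain ⟨ψ, f, κ, x₁, hev⟩ := 𝒮.exists_alpha_eq hx
  obtain ⟨⟨hψ, hxt, hκ, hκeq, hloc⟩, hα⟩ := hev.self_of_nhds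
  rw [hα, ContinuousLinearMap.comp_apply, homotopyForm_apply (fun s hs => (hloc s hs).1)
    (fun s hs => contDiffAt_omChart D (hloc s hs).2.1)]
  have hder : ∀ s ∈ Icc (0 : ℝ) 1, HasDerivAt (fun s => -D.ip (D.μ (𝒮.contr s x)) ξ)
      (D.omChart x₁ (f (s, ψ x)) (fderiv ℝ f (s, ψ x) (1, 0))
        (fderiv ℝ f (s, ψ x) (0, dX (E := E) ψ x (inf G x ξ)))) s := by
    intro s hs
    obtain ⟨-, -, h3, h4, -, h6⟩ := hloc s hs
    rw [← h6, dT_inf_eq h4 (fun g => 𝒮.contr_smul hs hx g), om_skew, ham]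
    have hμ : MDifferentiableAt 𝓘(ℝ, E) 𝓘(ℝ, F) D.μ (𝒮.contr s x) :=
      D.μ_smooth.mdifferentiableAt (by simp)
    have h7 := fderivWithin_comp_eq (E := E) (Q := univ) (c := fun s => 𝒮.contr s x) hμ
      h3.mdifferentiableWithinAt uniqueDiffWithinAt_univ 1
    rw [fderivWithin_univ] at h7
    have hdm : DifferentiableAt ℝ (fun s => D.μ (𝒮.contr s x)) s :=
      mdifferentiableAt_iff_differentiableAt.1 (hμ.comp (I' := 𝓘(ℝ, E)) s h3)
    have h8 : HasDerivAt (fun s => D.μ (𝒮.contr s x))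
        (dX D.μ (𝒮.contr s x) (dW (E := E) (fun s => 𝒮.contr s x) univ s 1)) s := by
      rw [← h7]; exact hdm.hasFDerivAt.hasDerivAt
    have h9 : HasFDerivAt (fun m : F => D.ip m ξ) ((ContinuousLinearMap.flip D.ip) ξ)
        (D.μ (𝒮.contr s x)) := ((ContinuousLinearMap.flip D.ip) ξ).hasFDerivAt
    exact (h9.comp_hasDerivAt s h8).neg
  have hint : IntervalIntegrable (fun s : ℝ => D.omChart x₁ (f (s, ψ x))
      (fderiv ℝ f (s, ψ x) (1, 0)) (fderiv ℝ f (s, ψ x) (0, dX (E := E) ψ x (inf G x ξ)))) volume 0 1 := by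
    refine ContinuousOn.intervalIntegrable ?_
    rw [uIcc_of_le zero_le_one]
    intro s hs
    have h1 := ContinuousAt.comp (f := fun s : ℝ => (s, ψ x)) (x := s)
      (contDiffAt_homotopyForm_integrand (hloc s hs).1
        (contDiffAt_omChart D (hloc s hs).2.1)).continuousAt (by fun_prop)
    exact (h1.clm_apply (continuousAt_const (y := dX (E := E) ψ x (inf G x ξ)))).continuousWithinAt
  rw [intervalIntegral.integral_eq_sub_of_hasDerivAt
    (by rw [uIcc_of_le zero_le_one]; exact hder) hint, 𝒮.contr_one hx, hκeq.self_of_nhds,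
    mu_smul_eq_zero D hz]
  simp

/-- The radius is smooth. -/
theorem contMDiffAt_radius {x₀ : X} (hx₀ : x₀ ∈ 𝒮.tube 𝒮.r) :
    ContMDiffAt 𝓘(ℝ, E) 𝓘(ℝ, ℝ) ∞ 𝒮.radius x₀ := by
  obtain ⟨ψ, Θ, κ, hev⟩ := 𝒮.exists_local_form hx₀
  have h : ContMDiffAt 𝓘(ℝ, E) 𝓘(ℝ, ℝ) ∞ (fun x => 𝒮.q (ψ x).2) x₀ := by
    refine ContMDiffAt.comp (I' := 𝓘(ℝ, F × 𝒮.S)) (g := fun p : F × 𝒮.S => 𝒮.q p.2) x₀ ?_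
      hev.self_of_nhds.1
    exact contMDiffAt_iff_contDiffAt.2 (𝒮.q_smooth.comp contDiff_snd).contDiffAt
  exact h.congr_of_eventuallyEq (hev.mono fun x hx => hx.2.2.2.2.1)

/-- The radius is invariant. Because of this, a small covariant derivative suffices to control it
along a loop, even when the ordinary derivative is large. -/
theorem dX_radius_inf {x : X} (hx : x ∈ 𝒮.tube 𝒮.r) (ξ : F) :
    dX (E := E) 𝒮.radius x (inf G x ξ) = 0 := by
  have hA : HasMFDerivAt 𝓘(ℝ, F) 𝓘(ℝ, ℝ) (fun g : G => 𝒮.radius (g • x)) 1 (0 : F →L[ℝ] ℝ) := by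
    have : (fun g : G => 𝒮.radius (g • x)) = fun _ => 𝒮.radius x :=
      funext fun g => 𝒮.radius_smul hx g
    rw [this]
    exact hasMFDerivAt_const (𝒮.radius x) (1 : G)
  rw [dX_inf_eq ((𝒮.contMDiffAt_radius hx).mdifferentiableAt (by simp)) hA]
  rfl

/-- Uniform bounds on a smaller tube. -/
theorem exists_bound [CompactSpace G] (hz : D.μ z = 0) {r' : ℝ} (hr : r' < 𝒮.r) :
    ∃ C : ℝ, 0 ≤ C ∧ ∀ (k : G) (v : 𝒮.S), 𝒮.q v ≤ r' → ∀ w : E,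
      |𝒮.alpha (k • 𝒮.σ v) w| ≤ C * D.normTan (k • 𝒮.σ v) w ∧
      |dX (E := E) 𝒮.radius (k • 𝒮.σ v) w| ≤ C * D.normTan (k • 𝒮.σ v) w := by
  obtain ⟨C, hC, h⟩ := exists_uniform_bound (𝒮.isCompact_closedTube hr)
    (P := fun C x => ∀ w : E, |𝒮.alpha x w| ≤ C * D.normTan x w ∧
      |dX (E := E) 𝒮.radius x w| ≤ C * D.normTan x w)
    (fun C C' x hCC h w => ⟨(h w).1.trans (mul_le_mul_of_nonneg_right hCC (normTan_nonneg D x w)),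
      (h w).2.trans (mul_le_mul_of_nonneg_right hCC (normTan_nonneg D x w))⟩) (by
    rintro x ⟨k, v, hv, rfl⟩
    have hx : k • 𝒮.σ v ∈ 𝒮.tube 𝒮.r := ⟨k, v, hv.trans_lt hr, rfl⟩
    obtain ⟨C₁, hC₁, h₁⟩ := (𝒮.hasPrimitiveAt_alpha hz hx).exists_bound
    obtain ⟨C₂, hC₂, h₂⟩ := exists_norm_dX_le D (ψ := 𝒮.radius) (x₀ := k • 𝒮.σ v) (by
      filter_upwards [(𝒮.isOpen_tube le_rfl).mem_nhds hx] with y hy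
      exact 𝒮.contMDiffAt_radius hy)
    refine ⟨C₁ + C₂, by positivity, ?_⟩
    filter_upwards [h₁, h₂] with y hy₁ hy₂ w
    have := normTan_nonneg D y w
    constructor
    · refine (hy₁ w).trans (mul_le_mul_of_nonneg_right (by linarith) this)
    · have h3 := hy₂ w
      rw [Real.norm_eq_abs] at h3
      exact h3.trans (mul_le_mul_of_nonneg_right (by linarith) this))
  exact ⟨C, hC, fun k v hv w => h _ ⟨k, v, hv, rfl⟩ w⟩

end Slice
end SympVortex

namespace SympVortex

/-! ### Consequences of the inverse function theorem. -/

section InverseFunction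

variable {V : Type*} [NormedAddCommGroup V] [NormedSpace ℝ V] [CompleteSpace V]
  {W : Type*} [NormedAddCommGroup W] [NormedSpace ℝ W]

/-- The inverse function theorem for smooth maps, with an inverse that is smooth near the
image point. -/
theorem exists_smooth_inverse {f : V → W} {a : V} (hf : ∀ᶠ y in 𝓝 a, ContDiffAt ℝ ∞ f y)
    (f' : V ≃L[ℝ] W) (hf' : HasFDerivAt f (f' : V →L[ℝ] W) a) :
    ∃ τ : W → V, τ (f a) = a ∧ (∀ᶠ w in 𝓝 (f a), ContDiffAt ℝ ∞ τ w ∧ f (τ w) = w) ∧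
      ∀ᶠ y in 𝓝 a, τ (f y) = y := by
  have h0 := hf.self_of_nhds
  have hn : (∞ : WithTop ℕ∞) ≠ 0 := by simp
  set h := h0.toOpenPartialHomeomorph f hf' hn
  have hcoe : (h : V → W) = f := rfl
  have hs : a ∈ h.source := h0.mem_toOpenPartialHomeomorph_source hf' hn
  have ht : f a ∈ h.target := h0.image_mem_toOpenPartialHomeomorph_target hf' hn
  have hinv : h.symm (f a) = a := h.left_inv hs
  refine ⟨h.symm, hinv, ?_, ?_⟩
  · have hc : Tendsto h.symm (𝓝 (f a)) (𝓝 a) := by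
      have := h.continuousAt_symm ht
      rwa [ContinuousAt, hinv] at this
    have hD : ContinuousAt (fderiv ℝ f) a :=
      (h0.fderiv_right (m := 0) (by norm_cast)).continuousAt
    -- Invertible maps form an open set, so the derivative stays invertible near `a` and the inverse
    -- is smooth at all points near `f a`.
    have hD' : ∀ᶠ y in 𝓝 a, fderiv ℝ f y ∈ range ((↑) : (V ≃L[ℝ] W) → V →L[ℝ] W) := by
      refine hD.eventually ?_
      rw [hf'.fderiv]
      exact f'.nhds
    filter_upwards [hc.eventually (hf.and hD'), h.open_target.mem_nhds ht] with w hw hwt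
    refine ⟨?_, h.right_inv hwt⟩
    obtain ⟨e, he⟩ := hw.2
    refine h.contDiffAt_symm hwt (f₀' := e) ?_ hw.1
    rw [he]
    exact (hw.1.differentiableAt (by simp)).hasFDerivAt
  · filter_upwards [h.open_source.mem_nhds hs] with y hy
    exact h.left_inv hy

/-- Composed with a left inverse of its derivative, `f` becomes a local diffeomorphism at `a`, hence
is injective near `a`. -/
theorem eventually_eq_of_injective_fderiv [FiniteDimensional ℝ V] [FiniteDimensional ℝ W]
    {f : V → W} {a : V} (hf : ∀ᶠ y in 𝓝 a, ContDiffAt ℝ ∞ f y) {f' : V →L[ℝ] W}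
    (hf' : HasFDerivAt f f' a) (hinj : Function.Injective f') :
    ∀ᶠ y in 𝓝 a, f y = f a → y = a := by
  obtain ⟨P, hP⟩ := (f' : V →ₗ[ℝ] W).exists_leftInverse_of_injective
    (LinearMap.ker_eq_bot.2 hinj)
  let Pc : W →L[ℝ] V := LinearMap.toContinuousLinearMap P
  have hPf : Pc.comp f' = ContinuousLinearMap.id ℝ V := by
    ext v
    exact LinearMap.congr_fun hP v
  have h1 : HasFDerivAt (fun y => Pc (f y))
      ((ContinuousLinearEquiv.refl ℝ V : V ≃L[ℝ] V) : V →L[ℝ] V) a := by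
    have := Pc.hasFDerivAt.comp a hf'
    rw [hPf] at this
    exact this
  obtain ⟨τ, hτa, -, hτ⟩ := exists_smooth_inverse (f := fun y => Pc (f y)) (a := a)
    (hf.mono fun y hy => Pc.contDiff.contDiffAt.comp y hy) _ h1
  filter_upwards [hτ] with y hy h
  rw [← hy, ← hτa, h]

theorem exists_quadratic_lower_bound {V : Type*} [NormedAddCommGroup V] [NormedSpace ℝ V]
    [FiniteDimensional ℝ V] {q : V → ℝ}
    (hq : Continuous q) (hs : ∀ (s : ℝ) v, q (s • v) = s ^ 2 * q v) (hpos : ∀ v, v ≠ 0 → 0 < q v) :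
    ∃ c : ℝ, 0 < c ∧ ∀ v, c * ‖v‖ ^ 2 ≤ q v := by
  have h0 : q 0 = 0 := by simpa using hs 0 0
  rcases (Metric.sphere (0 : V) 1).eq_empty_or_nonempty with he | hne
  · refine ⟨1, one_pos, fun v => ?_⟩
    rcases eq_or_ne v 0 with rfl | hv
    · simp [h0]
    · have : ‖v‖⁻¹ • v ∈ Metric.sphere (0 : V) 1 := by
        simp [norm_smul, norm_ne_zero_iff.2 hv]
      rw [he] at this
      exact absurd this (notMem_empty _)
  obtain ⟨a, ha, hmin⟩ := (isCompact_sphere (0 : V) 1).exists_isMinOn hne hq.continuousOn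
  have ha0 : a ≠ 0 := by rintro rfl; simp at ha
  refine ⟨q a, hpos a ha0, fun v => ?_⟩
  rcases eq_or_ne v 0 with rfl | hv
  · simp [h0]
  have hn : 0 < ‖v‖ := norm_pos_iff.2 hv
  have h1 : q a ≤ q (‖v‖⁻¹ • v) := hmin (by simp [norm_smul, hn.ne'])
  rw [hs] at h1
  have : ‖v‖⁻¹ ^ 2 * q v = q v / ‖v‖ ^ 2 := by field_simp
  rw [this, le_div_iff₀ (by positivity)] at h1
  exact h1

end InverseFunction

section Charts

variable {E : Type*} [NormedAddCommGroup E] [NormedSpace ℝ E]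
  {X : Type*} [TopologicalSpace X] [ChartedSpace E X] [IsManifold 𝓘(ℝ, E) ∞ X]

theorem hasMFDerivAt_extChartAt_self (z : X) : HasMFDerivAt 𝓘(ℝ, E) 𝓘(ℝ, E)
    (extChartAt 𝓘(ℝ, E) z) z (ContinuousLinearMap.id ℝ E) := by
  have : IsManifold 𝓘(ℝ, E) 1 X := IsManifold.of_le (n := ∞) (by norm_cast)
  have h := mfderiv_extChartAt_self (I := 𝓘(ℝ, E)) (x := z)
  have h4 := (mdifferentiableAt_extChartAt (I := 𝓘(ℝ, E)) (mem_chart_source E z)).hasMFDerivAt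
  rw [h] at h4
  exact h4

theorem contMDiffAt_extChartAt_symm {z : X} {y : E} (hy : y ∈ (extChartAt 𝓘(ℝ, E) z).target) :
    ContMDiffAt 𝓘(ℝ, E) 𝓘(ℝ, E) ∞ (extChartAt 𝓘(ℝ, E) z).symm y :=
  (contMDiffOn_extChartAt_symm z).contMDiffAt ((isOpen_extChartAt_target z).mem_nhds hy)

theorem hasMFDerivAt_extChartAt_symm_self (z : X) : HasMFDerivAt 𝓘(ℝ, E) 𝓘(ℝ, E)
    (extChartAt 𝓘(ℝ, E) z).symm (extChartAt 𝓘(ℝ, E) z z) (ContinuousLinearMap.id ℝ E) := by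
  have : IsManifold 𝓘(ℝ, E) 1 X := IsManifold.of_le (n := ∞) (by norm_cast)
  have h := mfderivWithin_range_extChartAt_symm (I := 𝓘(ℝ, E)) (x := z)
  simp only [modelWithCornersSelf_coe, range_id, mfderivWithin_univ] at h
  have h2 := ((contMDiffAt_extChartAt_symm (E := E) (z := z) (mem_extChartAt_target z)).mdifferentiableAt
    (by simp)).hasMFDerivAt
  rw [h] at h2
  exact h2

end Charts

/-! ### Linear algebra at a point of the zero level and finiteness of stabilizers. -/

section Linear

variable {F : Type*} [NormedAddCommGroup F] [NormedSpace ℝ F]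
  {E : Type*} [NormedAddCommGroup E] [NormedSpace ℝ E]
  {G : Type*} [TopologicalSpace G] [ChartedSpace F G] [Group G] [LieGroup 𝓘(ℝ, F) ∞ G]
  {X : Type*} [TopologicalSpace X] [ChartedSpace E X] [IsManifold 𝓘(ℝ, E) ∞ X]
  [MulAction G X] [ContMDiffSMul 𝓘(ℝ, F) 𝓘(ℝ, E) ∞ G X]
  (D : HamiltonianSpace F E G X) {z : X}

/-- If `X_ξ` vanishes at `z`, then `⟨dμ(v), ξ⟩ = ω(X_ξ, v) = 0` for all `v`; regularity provides a
`v` with `dμ(v) = ξ`, which forces `ξ = 0`. -/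
theorem inf_injective (hz : D.μ z = 0) : Function.Injective (inf (F := F) (E := E) G z) := by
  rw [injective_iff_map_eq_zero]
  intro ξ hξ
  by_contra hne
  obtain ⟨v, hv⟩ := D.μ_regular z hz ξ
  have h1 := ham D z ξ v
  have h2 : dX (E := E) D.μ z v = ξ := hv
  rw [hξ, h2] at h1
  simp only [map_zero] at h1
  exact (D.ip_pos ξ hne).ne h1

theorem cx_cx (x : X) (v : E) : D.cx x (D.cx x v) = -v := D.J_sq x v

theorem om_cx_pos (x : X) {v : E} (hv : v ≠ 0) : 0 < D.om x v (D.cx x v) := D.J_pos x v hv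

/-- One has `⟨dμ(J X_ξ), ξ⟩ = ω(X_ξ, J X_ξ) = |X_ξ|²`. Consequently the endomorphism `dμ ∘ J ∘ L_z`
of the Lie algebra is invertible, and the vectors `J X_ξ` span a complement of the kernel of `dμ`.
-/
theorem moment_cx_inf_injective (hz : D.μ z = 0) {ξ : F}
    (h : dX (E := E) D.μ z (D.cx z (inf G z ξ)) = 0) : ξ = 0 := by
  by_contra hne
  have h1 : inf (E := E) G z ξ ≠ 0 := fun h0 => hne (inf_injective D hz (by rw [h0, map_zero]))
  have h2 := om_cx_pos D z h1
  rw [ham, h] at h2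
  simp at h2

/-- An equivariant right inverse of the derivative of the moment map. -/
theorem exists_right_inverse [FiniteDimensional ℝ F] (hz : D.μ z = 0) :
    ∃ N : F →L[ℝ] E, (∀ m, dX (E := E) D.μ z (N m) = m) ∧
      (∀ m, ∃ ξ : F, N m = D.cx z (inf G z ξ)) ∧
      ∀ m, dX (E := E) D.μ z (D.cx z (N m)) = 0 := by
  -- The right inverse is `J ∘ L_z ∘ B⁻¹`. Applying `J` once more gives orbit directions, which `dμ`
  -- annihilates; this is the last claim.
  let B : F →L[ℝ] F := (dX (E := E) D.μ z).comp ((D.cx z).comp (inf G z))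
  have hB : Function.Injective B := by
    rw [injective_iff_map_eq_zero]
    intro ξ hξ
    exact moment_cx_inf_injective D hz hξ
  let e : F ≃ₗ[ℝ] F := LinearEquiv.ofInjectiveEndo (B : F →ₗ[ℝ] F) hB
  let ec : F →L[ℝ] F := LinearMap.toContinuousLinearMap (e.symm : F →ₗ[ℝ] F)
  have hec : ∀ m, B (ec m) = m := fun m => e.apply_symm_apply m
  refine ⟨((D.cx z).comp (inf G z)).comp ec, hec, fun m => ⟨ec m, rfl⟩, fun m => ?_⟩
  simp only [ContinuousLinearMap.comp_apply, cx_cx, map_neg, dX_mu_inf D hz, neg_zero]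

/-- The derivative of the action of an element at `z`. -/
def isoAct (G : Type*) [Group G] [MulAction G X] (z : X) (γ : G) : E →L[ℝ] E :=
  dT (fun x : X => γ • x) z

theorem hasMFDerivAt_smul (F : Type*) [NormedAddCommGroup F] [NormedSpace ℝ F] {G : Type*}
    [TopologicalSpace G] [ChartedSpace F G] [Group G]
    [MulAction G X] [ContMDiffSMul 𝓘(ℝ, F) 𝓘(ℝ, E) ∞ G X] (x : X) (γ : G) :
    HasMFDerivAt 𝓘(ℝ, E) 𝓘(ℝ, E) (fun x : X => γ • x) x (isoAct (E := E) G x γ) :=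
  ((ContMDiffSMul.contMDiff_const_smul (I := 𝓘(ℝ, F)) (n := ∞) γ).mdifferentiableAt
    (by simp)).hasMFDerivAt

theorem isoAct_one : isoAct (E := E) G z 1 = ContinuousLinearMap.id ℝ E := by
  have h : (fun x : X => (1 : G) • x) = id := by ext; simp
  rw [isoAct, dT, h]
  exact mfderiv_id

theorem isoAct_mul (_D : HamiltonianSpace F E G X) (γ : G) {γ' : G} (h : γ' • z = z) (v : E) :
    isoAct (E := E) G z (γ * γ') v = isoAct G z γ (isoAct G z γ' v) := by
  have h1 : HasMFDerivAt 𝓘(ℝ, E) 𝓘(ℝ, E) (fun x : X => γ • x) (γ' • z) (isoAct (E := E) G z γ) := by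
    rw [h]; exact hasMFDerivAt_smul F z γ
  have h2 := HasMFDerivAt.comp z h1 (hasMFDerivAt_smul F z γ')
  have h3 : ((fun x : X => γ • x) ∘ fun x : X => γ' • x) = fun x : X => (γ * γ') • x := by
    ext x; simp [mul_smul]
  rw [h3] at h2
  exact DFunLike.congr_fun h2.mfderiv v

theorem isoAct_cx {γ : G} (h : γ • z = z) (v : E) :
    isoAct (E := E) G z γ (D.cx z v) = D.cx z (isoAct G z γ v) := by
  have h1 : isoAct (E := E) G z γ (D.cx z v) = D.cx (γ • z) (isoAct G z γ v) := D.J_invariant γ z v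
  rw [h1, h]

theorem moment_isoAct {γ : G} (h : γ • z = z) (v : E) :
    dX (E := E) D.μ z (isoAct G z γ v) = Ad (F := F) γ (dX (E := E) D.μ z v) := by
  have hμ : HasMFDerivAt 𝓘(ℝ, E) 𝓘(ℝ, F) D.μ z (dX (E := E) (N := F) D.μ z) :=
    (D.μ_smooth.mdifferentiableAt (by simp)).hasMFDerivAt
  have h1 : HasMFDerivAt 𝓘(ℝ, E) 𝓘(ℝ, F) D.μ (γ • z) (dX (E := E) (N := F) D.μ z) := by rw [h]; exact hμ
  have h2 := HasMFDerivAt.comp z h1 (hasMFDerivAt_smul F z γ)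
  have h3 : HasMFDerivAt 𝓘(ℝ, E) 𝓘(ℝ, F) (fun x => Ad (F := F) γ (D.μ x)) z
      ((Ad (F := F) γ).comp (dX (E := E) (N := F) D.μ z) : E →L[ℝ] F) :=
    HasMFDerivAt.comp (I' := 𝓘(ℝ, F)) z (Ad (F := F) γ).hasFDerivAt.hasMFDerivAt hμ
  have h4 : D.μ ∘ (fun x : X => γ • x) = fun x => Ad (F := F) γ (D.μ x) := by
    ext x; exact D.μ_equivariant γ x
  rw [h4] at h2
  exact DFunLike.congr_fun (hasMFDerivAt_unique h2 h3) v

/-- An element of the stabilizer maps the orbit of `z` to itself. The vector `ζ` is in fact `Ad γ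
ξ`, but its existence is all that is used. -/
theorem exists_isoAct_inf (_D : HamiltonianSpace F E G X) {γ : G} (h : γ • z = z) (ξ : F) :
    ∃ ζ : F, isoAct (E := E) G z γ (inf G z ξ) = inf G z ζ := by
  have h1 : HasMFDerivAt 𝓘(ℝ, E) 𝓘(ℝ, E) (fun x : X => γ • x) ((1 : G) • z)
      (isoAct (E := E) G z γ) := by
    rw [one_smul]; exact hasMFDerivAt_smul F z γ
  have h2 := HasMFDerivAt.comp (1 : G) h1 (hasMFDerivAt_orbit (F := F) (E := E) (G := G) z)
  have hl : MDifferentiableAt 𝓘(ℝ, F) 𝓘(ℝ, F) (fun h : G => γ * h) 1 :=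
    (contMDiff_mul_left (I := 𝓘(ℝ, F)) (n := ∞) (a := γ)).mdifferentiableAt (by simp)
  have h3 : HasMFDerivAt 𝓘(ℝ, F) 𝓘(ℝ, E) (fun h : G => h • z) (γ * 1)
      (mfderiv 𝓘(ℝ, F) 𝓘(ℝ, E) (fun h : G => h • z) γ : F →L[ℝ] E) := by
    rw [mul_one]
    exact ((contMDiff_orbit G z).mdifferentiableAt (by simp)).hasMFDerivAt
  have h4 := HasMFDerivAt.comp (1 : G) h3 hl.hasMFDerivAt
  have h5 : ((fun h : G => h • z) ∘ fun h : G => γ * h)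
      = (fun x : X => γ • x) ∘ fun g : G => g • z := by
    ext g; simp [mul_smul]
  rw [h5] at h4
  obtain ⟨ζ, hζ⟩ := exists_inf_eq_of_orbit (F := F) (E := E) z γ
    ((mfderiv 𝓘(ℝ, F) 𝓘(ℝ, F) (fun h : G => γ * h) 1 : F →L[ℝ] F) ξ)
  rw [h] at hζ
  exact ⟨ζ, (DFunLike.congr_fun (hasMFDerivAt_unique h2 h4) ξ).trans hζ⟩

/-- The right inverse of the derivative of the moment map is equivariant. -/
theorem right_inverse_equivariant (hz : D.μ z = 0) {N : F →L[ℝ] E}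
    (hN : ∀ m, dX (E := E) D.μ z (N m) = m) (hN' : ∀ m, ∃ ξ : F, N m = D.cx z (inf G z ξ))
    {γ : G} (h : γ • z = z) (m : F) : isoAct G z γ (N m) = N (Ad (F := F) γ m) := by
  obtain ⟨ξ, hξ⟩ := hN' m
  obtain ⟨ζ, hζ⟩ := exists_isoAct_inf D h ξ
  obtain ⟨χ, hχ⟩ := hN' (Ad (F := F) γ m)
  have h1 : isoAct G z γ (N m) = D.cx z (inf G z ζ) := by rw [hξ, isoAct_cx D h, hζ]
  have h2 : dX (E := E) D.μ z (isoAct G z γ (N m)) = Ad (F := F) γ m := by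
    rw [moment_isoAct D h, hN]
  have h3 := hN (Ad (F := F) γ m)
  -- Both sides have the form `J X` with an orbit direction `X` and the same image under `dμ`, which
  -- is injective on such vectors.
  have h4 : ζ - χ = 0 := by
    refine moment_cx_inf_injective D hz ?_
    rw [map_sub, map_sub, map_sub, ← h1, ← hχ, h2, h3, sub_self]
  rw [h1, hχ, sub_eq_zero.1 h4]

/-- The derivative of the orbit map in the charts at the unit and at the point. -/
theorem hasFDerivAt_orbit_chart (z : X) :
    HasFDerivAt (fun a : F => extChartAt 𝓘(ℝ, E) z ((extChartAt 𝓘(ℝ, F) (1 : G)).symm a • z))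
      (inf (F := F) (E := E) G z) (extChartAt 𝓘(ℝ, F) (1 : G) 1) := by
  set φ := extChartAt 𝓘(ℝ, E) z
  set χ := extChartAt 𝓘(ℝ, F) (1 : G)
  have hχ1 : χ.symm (χ 1) = 1 := extChartAt_to_inv (1 : G)
  have h1 := hasMFDerivAt_extChartAt_symm_self (E := F) (1 : G)
  have h2 : HasMFDerivAt 𝓘(ℝ, F) 𝓘(ℝ, E) (fun g : G => g • z) (χ.symm (χ 1))
      (inf (F := F) (E := E) G z) := by
    rw [hχ1]
    exact hasMFDerivAt_orbit (F := F) (E := E) (G := G) z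
  have h3 : HasMFDerivAt 𝓘(ℝ, E) 𝓘(ℝ, E) φ (χ.symm (χ 1) • z) (ContinuousLinearMap.id ℝ E) := by
    rw [hχ1, one_smul]
    exact hasMFDerivAt_extChartAt_self z
  have h5 := HasMFDerivAt.comp (I' := 𝓘(ℝ, E)) (χ 1) h3
    (HasMFDerivAt.comp (I' := 𝓘(ℝ, F)) (χ 1) h2 h1)
  exact hasMFDerivAt_iff_hasFDerivAt.1 h5

/-- The stabilizer of a point of the zero level is finite. -/
theorem stabilizer_finite [FiniteDimensional ℝ F] [FiniteDimensional ℝ E] [CompactSpace G]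
    [T2Space X] (hz : D.μ z = 0) : {k : G | k • z = z}.Finite := by
  have hLG : IsTopologicalGroup G := topologicalGroup_of_lieGroup 𝓘(ℝ, F) ∞
  set φ := extChartAt 𝓘(ℝ, E) z
  set χ := extChartAt 𝓘(ℝ, F) (1 : G)
  let f : F → E := fun a => φ (χ.symm a • z)
  have hcont : Continuous (fun g : G => g • z) := (contMDiff_orbit (F := F) (E := E) G z).continuous
  have hχ : ∀ᶠ a in 𝓝 (χ 1), a ∈ χ.target ∧ χ.symm a • z ∈ φ.source := by
    refine (show ∀ᶠ a in 𝓝 (χ 1), a ∈ χ.target from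
      extChartAt_target_mem_nhds (I := 𝓘(ℝ, F)) (1 : G)).and ?_
    have hc : ContinuousAt (fun a => χ.symm a • z) (χ 1) :=
      hcont.continuousAt.comp (continuousAt_extChartAt_symm (1 : G))
    refine hc.eventually ?_
    simp only [χ, extChartAt_to_inv, one_smul]
    exact extChartAt_source_mem_nhds z
  have hf : ∀ᶠ a in 𝓝 (χ 1), ContDiffAt ℝ ∞ f a := by
    filter_upwards [hχ] with a ha
    rw [← contMDiffAt_iff_contDiffAt]
    have h1 : ContMDiffAt 𝓘(ℝ, F) 𝓘(ℝ, F) ∞ χ.symm a :=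
      (contMDiffOn_extChartAt_symm (1 : G)).contMDiffAt
        ((isOpen_extChartAt_target (1 : G)).mem_nhds ha.1)
    have h2 : ContMDiffAt 𝓘(ℝ, F) 𝓘(ℝ, E) ∞ (fun a => χ.symm a • z) a :=
      ContMDiffAt.comp (I' := 𝓘(ℝ, F)) a (contMDiff_orbit G z _) h1
    exact ContMDiffAt.comp (I' := 𝓘(ℝ, E)) a
      (contMDiffAt_extChartAt' (by have := ha.2; rwa [extChartAt_source] at this)) h2
  have hf' : HasFDerivAt f (inf (F := F) (E := E) G z) (χ 1) := hasFDerivAt_orbit_chart z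
  -- The orbit map is an immersion at the unit, so the unit is isolated in the stabilizer. By
  -- translation every element is isolated, and a compact set of isolated points is finite.
  have hone : ∀ᶠ g in 𝓝 (1 : G), g • z = z → g = 1 := by
    have h1 := eventually_eq_of_injective_fderiv hf hf' (inf_injective D hz)
    have h2 := (continuousAt_extChartAt (I := 𝓘(ℝ, F)) (1 : G)).eventually h1
    filter_upwards [h2, extChartAt_source_mem_nhds (I := 𝓘(ℝ, F)) (1 : G)] with g hg hgs hgz
    have h3 := hg (by simp only [f, χ, PartialEquiv.left_inv _ hgs, extChartAt_to_inv, one_smul, hgz])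
    exact χ.injOn hgs (mem_extChartAt_source (1 : G)) h3
  have hclosed : IsClosed {k : G | k • z = z} := isClosed_eq hcont continuous_const
  have hev : ∀ γ ∈ {k : G | k • z = z}, {g : G | g • z = z → g = γ} ∈ 𝓝 γ := by
    intro γ hγ
    have hc : Tendsto (fun g : G => γ⁻¹ * g) (𝓝 γ) (𝓝 1) := by
      have := (continuous_const_mul γ⁻¹).tendsto γ
      rwa [inv_mul_cancel] at this
    have h1 : ∀ᶠ g in 𝓝 γ, (γ⁻¹ * g) • z = z → γ⁻¹ * g = 1 :=
      hc.eventually (p := fun h => h • z = z → h = 1) hone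
    filter_upwards [h1] with g hg hgz
    have hγ' : γ⁻¹ • z = z := by rw [inv_smul_eq_iff]; exact hγ.symm
    have := hg (by rw [mul_smul, hgz, hγ'])
    rw [inv_mul_eq_one] at this
    exact this.symm
  obtain ⟨t, -, hcov⟩ := hclosed.isCompact.elim_nhds_subcover _ hev
  refine t.finite_toSet.subset fun k hk => ?_
  obtain ⟨γ, hγt, hγ⟩ := mem_iUnion₂.1 (hcov hk)
  rw [hγ hk]
  exact hγt

end Linear
end SympVortex

namespace SympVortex

/-! ### Equivariant coordinates near a point of the zero level. -/

section Construction

variable {F : Type*} [NormedAddCommGroup F] [NormedSpace ℝ F] [FiniteDimensional ℝ F]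
  {E : Type*} [NormedAddCommGroup E] [NormedSpace ℝ E] [FiniteDimensional ℝ E]
  {G : Type*} [TopologicalSpace G] [ChartedSpace F G] [Group G] [LieGroup 𝓘(ℝ, F) ∞ G]
  [CompactSpace G]
  {X : Type*} [TopologicalSpace X] [T2Space X] [ChartedSpace E X] [IsManifold 𝓘(ℝ, E) ∞ X]
  [MulAction G X] [ContMDiffSMul 𝓘(ℝ, F) 𝓘(ℝ, E) ∞ G X]
  (D : HamiltonianSpace F E G X) {z : X}

theorem contMDiff_smul_left (F : Type*) [NormedAddCommGroup F] [NormedSpace ℝ F] {G : Type*}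
    [TopologicalSpace G] [ChartedSpace F G] [Group G]
    [MulAction G X] [ContMDiffSMul 𝓘(ℝ, F) 𝓘(ℝ, E) ∞ G X] (g : G) :
    ContMDiff 𝓘(ℝ, E) 𝓘(ℝ, E) ∞ (fun x : X => g • x) :=
  ContMDiffSMul.contMDiff_const_smul (I := 𝓘(ℝ, F)) g

/-- Averaging a chart over the stabilizer gives an equivariant chart. -/
theorem exists_equivariant_coordinates (hz : D.μ z = 0) :
    ∃ f : X → E, f z = 0 ∧ (∀ᶠ x in 𝓝 z, ContMDiffAt 𝓘(ℝ, E) 𝓘(ℝ, E) ∞ f x) ∧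
      HasMFDerivAt 𝓘(ℝ, E) 𝓘(ℝ, E) f z (ContinuousLinearMap.id ℝ E) ∧
      ∀ γ : G, γ • z = z → ∀ x, f (γ • x) = isoAct G z γ (f x) := by
  let Γ := MulAction.stabilizer G z
  have : Finite Γ := (stabilizer_finite D hz).to_subtype
  have : Fintype Γ := Fintype.ofFinite Γ
  have hn : (Fintype.card Γ : ℝ) ≠ 0 := Nat.cast_ne_zero.2 Fintype.card_ne_zero
  set φ := extChartAt 𝓘(ℝ, E) z
  have hΓ : ∀ γ : Γ, (γ : G) • z = z := fun γ => γ.2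
  have hΓ' : ∀ γ : Γ, (γ⁻¹ : G) • z = z := fun γ => (γ⁻¹).2
  -- Each term is the chart conjugated by an element of the stabilizer and has the identity as
  -- derivative at `z`, so the average does too. Equivariance of the average comes from reindexing
  -- the sum by right translation.
  let t : Γ → X → E := fun γ x => isoAct G z (γ⁻¹ : G) (φ ((γ : G) • x) - φ z)
  refine ⟨fun x => (Fintype.card Γ : ℝ)⁻¹ • (∑ γ : Γ, t γ) x, ?_, ?_, ?_, ?_⟩
  · simp [t, hΓ]
  · have h : ∀ᶠ x in 𝓝 z, ∀ γ : Γ, (γ : G) • x ∈ φ.source := by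
      rw [eventually_all]
      intro γ
      have hc := (contMDiff_smul_left (E := E) (X := X) F (γ : G)).continuous.tendsto z
      rw [hΓ γ] at hc
      exact hc.eventually (extChartAt_source_mem_nhds z)
    filter_upwards [h] with x hx
    have hsum : ContMDiffAt 𝓘(ℝ, E) 𝓘(ℝ, E) ∞ (fun x => ∑ γ : Γ, t γ x) x := by
      refine contMDiffAt_finsetSum fun γ _ => ?_
      have h1 : ContMDiffAt 𝓘(ℝ, E) 𝓘(ℝ, E) ∞ (fun x => φ ((γ : G) • x)) x :=
        ContMDiffAt.comp (I' := 𝓘(ℝ, E)) x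
          (contMDiffAt_extChartAt' (by have := hx γ; rwa [extChartAt_source] at this))
          (contMDiff_smul_left F (γ : G) x)
      have h2 : ContDiff ℝ ∞ (fun y : E => isoAct (E := E) G z (γ⁻¹ : G) (y - φ z)) :=
        (ContinuousLinearMap.contDiff _).comp (contDiff_id.sub contDiff_const)
      exact ContMDiffAt.comp (I' := 𝓘(ℝ, E))
        (g := fun y : E => isoAct (E := E) G z (γ⁻¹ : G) (y - φ z)) x h2.contMDiff.contMDiffAt h1
    have h3 : ContDiff ℝ ∞ (fun y : E => (Fintype.card Γ : ℝ)⁻¹ • y) := contDiff_const_smul _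
    have h4 := ContMDiffAt.comp (I' := 𝓘(ℝ, E)) x h3.contMDiff.contMDiffAt hsum
    refine h4.congr_of_eventuallyEq (Eventually.of_forall fun y => ?_)
    simp
  · have h1 : ∀ γ : Γ, HasMFDerivAt 𝓘(ℝ, E) 𝓘(ℝ, E) (t γ) z (ContinuousLinearMap.id ℝ E) := by
      intro γ
      have hφ : HasMFDerivAt 𝓘(ℝ, E) 𝓘(ℝ, E) φ ((γ : G) • z) (ContinuousLinearMap.id ℝ E) := by
        rw [hΓ γ]; exact hasMFDerivAt_extChartAt_self z
      have h2 := HasMFDerivAt.comp (I' := 𝓘(ℝ, E)) z hφ (hasMFDerivAt_smul F z (γ : G))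
      have h3 : HasFDerivAt (fun y : E => isoAct (E := E) G z (γ⁻¹ : G) (y - φ z))
          (isoAct (E := E) G z (γ⁻¹ : G)) (φ ((γ : G) • z)) :=
        (ContinuousLinearMap.hasFDerivAt _).comp _ ((hasFDerivAt_id _).sub_const _)
      have h4 := HasMFDerivAt.comp (I' := 𝓘(ℝ, E)) z h3.hasMFDerivAt h2
      have h5 : (isoAct (E := E) G z (γ⁻¹ : G)).comp (isoAct (E := E) G z (γ : G))
          = ContinuousLinearMap.id ℝ E := by
        ext v
        rw [ContinuousLinearMap.comp_apply, ← isoAct_mul D _ (hΓ γ), inv_mul_cancel, isoAct_one]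
      rw [← h5]
      exact h4
    have hsum : ∀ s : Finset Γ, HasMFDerivAt 𝓘(ℝ, E) 𝓘(ℝ, E) (∑ γ ∈ s, t γ) z
        (∑ _γ ∈ s, ContinuousLinearMap.id ℝ E : E →L[ℝ] E) := by
      classical
      intro s
      induction s using Finset.induction_on with
      | empty =>
        rw [Finset.sum_empty, Finset.sum_empty]
        exact hasMFDerivAt_const (0 : E) z
      | insert γ s hγ ih =>
        rw [Finset.sum_insert hγ, Finset.sum_insert hγ]
        exact (h1 γ).add ih
    have h2 := (hsum Finset.univ).const_smul ((Fintype.card Γ : ℝ)⁻¹)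
    have h3 : (Fintype.card Γ : ℝ)⁻¹ • ∑ _γ : Γ, ContinuousLinearMap.id ℝ E
        = ContinuousLinearMap.id ℝ E := by
      rw [Finset.sum_const, Finset.card_univ, ← Nat.cast_smul_eq_nsmul ℝ, smul_smul,
        inv_mul_cancel₀ hn, one_smul]
    rw [← h3]
    exact h2
  · intro γ hγ x
    have hγ' : γ ∈ Γ := hγ
    simp only [map_smul, Finset.sum_apply, map_sum]
    congr 1
    refine Fintype.sum_equiv (Equiv.mulRight (⟨γ, hγ'⟩ : Γ)) _ _ fun δ => ?_
    simp only [t, Equiv.coe_mulRight, Subgroup.coe_mul, mul_inv_rev, mul_smul]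
    rw [← isoAct_mul D γ (by rw [mul_smul, hΓ' δ, inv_smul_eq_iff, hγ]), mul_inv_cancel_left]

/-- An equivariant parametrization of a neighbourhood of `z` that makes the moment map linear. -/
theorem exists_equivariant_parametrization (hz : D.μ z = 0) :
    ∃ σ : E → X, σ 0 = z ∧ (∀ᶠ w in 𝓝 0, ContMDiffAt 𝓘(ℝ, E) 𝓘(ℝ, E) ∞ σ w) ∧
      HasMFDerivAt 𝓘(ℝ, E) 𝓘(ℝ, E) σ 0 (ContinuousLinearMap.id ℝ E) ∧
      (∀ γ : G, γ • z = z → ∀ᶠ w in 𝓝 0, σ (isoAct G z γ w) = γ • σ w) ∧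
      ∀ᶠ w in 𝓝 0, D.μ (σ w) = dX (E := E) D.μ z w := by
  obtain ⟨f, hfz, hfs, hfd, hfeq⟩ := exists_equivariant_coordinates D hz
  obtain ⟨N, hN, hN', -⟩ := exists_right_inverse D hz
  set M : E →L[ℝ] F := dX (E := E) D.μ z
  -- `T` projects to the kernel of `M = dμ` along the range of `N`. In `Φ` the component of the
  -- chart along `N` is replaced by the moment map itself; this preserves the derivative and
  -- equivariance and gives `M ∘ Φ = μ`. The parametrization is the local inverse of `Φ`.
  let T : E →L[ℝ] E := ContinuousLinearMap.id ℝ E - N.comp M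
  let Φ : X → E := fun x => T (f x) + N (D.μ x)
  have hMΦ : ∀ x, M (Φ x) = D.μ x := fun x => by simp [Φ, T, hN]
  have hΦz : Φ z = 0 := by simp [Φ, hfz, hz]
  have hΦs : ∀ᶠ x in 𝓝 z, ContMDiffAt 𝓘(ℝ, E) 𝓘(ℝ, E) ∞ Φ x := by
    filter_upwards [hfs] with x hx
    exact (ContMDiffAt.comp (I' := 𝓘(ℝ, E)) x T.contMDiff.contMDiffAt hx).add
      (ContMDiffAt.comp (I' := 𝓘(ℝ, F)) x N.contMDiff.contMDiffAt (D.μ_smooth x))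
  have hμd : HasMFDerivAt 𝓘(ℝ, E) 𝓘(ℝ, F) D.μ z M :=
    (D.μ_smooth.mdifferentiableAt (by simp)).hasMFDerivAt
  have hΦd : HasMFDerivAt 𝓘(ℝ, E) 𝓘(ℝ, E) Φ z (ContinuousLinearMap.id ℝ E) := by
    have h1 := HasMFDerivAt.comp (I' := 𝓘(ℝ, E)) z T.hasMFDerivAt hfd
    have h2 := HasMFDerivAt.comp (I' := 𝓘(ℝ, F)) z N.hasMFDerivAt hμd
    have h3 : T.comp (ContinuousLinearMap.id ℝ E) + N.comp M = ContinuousLinearMap.id ℝ E := by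
      ext v; simp [T]
    rw [← h3]
    exact h1.add h2
  have hΦeq : ∀ γ : G, γ • z = z → ∀ x, Φ (γ • x) = isoAct G z γ (Φ x) := by
    intro γ hγ x
    simp only [Φ, T, hfeq γ hγ, D.μ_equivariant, sub_apply,
      ContinuousLinearMap.comp_apply, ContinuousLinearMap.id_apply, map_add, map_sub,
      right_inverse_equivariant D hz hN hN' hγ]
    rw [moment_isoAct D hγ]
  set φ := extChartAt 𝓘(ℝ, E) z
  have hφz : φ.symm (φ z) = z := extChartAt_to_inv z
  have hφc : Tendsto φ.symm (𝓝 (φ z)) (𝓝 z) := by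
    have := continuousAt_extChartAt_symm (I := 𝓘(ℝ, E)) z
    rwa [ContinuousAt, extChartAt_to_inv] at this
  have hf : ∀ᶠ y in 𝓝 (φ z), ContDiffAt ℝ ∞ (fun y => Φ (φ.symm y)) y := by
    filter_upwards [hφc.eventually hΦs, extChartAt_target_mem_nhds (I := 𝓘(ℝ, E)) z] with y hy hyt
    rw [← contMDiffAt_iff_contDiffAt]
    exact ContMDiffAt.comp (I' := 𝓘(ℝ, E)) y hy (contMDiffAt_extChartAt_symm hyt)
  have hd : HasFDerivAt (fun y => Φ (φ.symm y))
      ((ContinuousLinearEquiv.refl ℝ E : E ≃L[ℝ] E) : E →L[ℝ] E) (φ z) := by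
    have h1 : HasMFDerivAt 𝓘(ℝ, E) 𝓘(ℝ, E) Φ (φ.symm (φ z)) (ContinuousLinearMap.id ℝ E) := by
      rw [hφz]; exact hΦd
    exact hasMFDerivAt_iff_hasFDerivAt.1
      (HasMFDerivAt.comp (I' := 𝓘(ℝ, E)) (φ z) h1 (hasMFDerivAt_extChartAt_symm_self z))
  obtain ⟨τ, hτ0, hτ, hτ'⟩ := exists_smooth_inverse hf _ hd
  simp only [hφz, hΦz] at hτ0 hτ
  have hτc : Tendsto τ (𝓝 0) (𝓝 (φ z)) := by
    have := hτ.self_of_nhds.1.continuousAt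
    rwa [ContinuousAt, hτ0] at this
  have hσ0 : φ.symm (τ 0) = z := by rw [hτ0, hφz]
  have hσs : ∀ᶠ w in 𝓝 (0 : E), ContMDiffAt 𝓘(ℝ, E) 𝓘(ℝ, E) ∞ (fun w => φ.symm (τ w)) w := by
    filter_upwards [hτ, hτc.eventually (extChartAt_target_mem_nhds (I := 𝓘(ℝ, E)) z)] with w hw hwt
    exact ContMDiffAt.comp (I' := 𝓘(ℝ, E)) w (contMDiffAt_extChartAt_symm hwt)
      (contMDiffAt_iff_contDiffAt.2 hw.1)
  refine ⟨fun w => φ.symm (τ w), hσ0, hσs, ?_, ?_, ?_⟩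
  · have h1 := (hσs.self_of_nhds.mdifferentiableAt (by simp)).hasMFDerivAt
    have h2 : HasMFDerivAt 𝓘(ℝ, E) 𝓘(ℝ, E) Φ (φ.symm (τ 0)) (ContinuousLinearMap.id ℝ E) := by
      rw [hσ0]; exact hΦd
    have h3 := HasMFDerivAt.comp (I' := 𝓘(ℝ, E)) (0 : E) h2 h1
    have h4 : HasMFDerivAt 𝓘(ℝ, E) 𝓘(ℝ, E) (Φ ∘ fun w => φ.symm (τ w)) 0
        (ContinuousLinearMap.id ℝ E) :=
      (hasMFDerivAt_id (0 : E)).congr_of_eventuallyEq (hτ.mono fun w hw => hw.2)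
    have h5 := hasMFDerivAt_unique h3 h4
    rw [← h5]
    exact h1
  · intro γ hγ
    have hc : Tendsto (fun w => γ • φ.symm (τ w)) (𝓝 0) (𝓝 z) := by
      have h1 := (contMDiff_smul_left (E := E) (X := X) F γ).continuous.tendsto z
      rw [hγ] at h1
      exact h1.comp (hφc.comp hτc)
    have hφ' : Tendsto φ (𝓝 z) (𝓝 (φ z)) := continuousAt_extChartAt (I := 𝓘(ℝ, E)) z
    filter_upwards [hτ, hc.eventually (hφ'.eventually hτ'),
      hc.eventually (extChartAt_source_mem_nhds (I := 𝓘(ℝ, E)) z)] with w hw hw' hws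
    rw [φ.left_inv hws, hΦeq γ hγ, hw.2] at hw'
    rw [hw', φ.left_inv hws]
  · filter_upwards [hτ] with w hw
    rw [← hMΦ, hw.2]

/-- The complement of the tangent space of the orbit. -/
def sliceSpace (z : X) : Submodule ℝ E :=
  LinearMap.ker (((dX (E := E) D.μ z).comp (D.cx z) : E →L[ℝ] F) : E →ₗ[ℝ] F)

/-- Since `⟨dμ(J v), ξ⟩ = ω(X_ξ, J v)`, these are the vectors orthogonal to the orbit in the metric
`ω(·, J ·)`. -/
theorem mem_sliceSpace {v : E} : v ∈ sliceSpace D z ↔ dX (E := E) D.μ z (D.cx z v) = 0 := Iff.rfl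

theorem isoAct_mem_sliceSpace {γ : G} (hγ : γ • z = z) {v : E} (hv : v ∈ sliceSpace D z) :
    isoAct G z γ v ∈ sliceSpace D z := by
  rw [mem_sliceSpace] at hv ⊢
  rw [← isoAct_cx D hγ, moment_isoAct D hγ, hv, map_zero]

/-- The tangent space at `z` is the sum of the tangent space of the orbit and the slice. -/
theorem exists_tangent_splitting (hz : D.μ z = 0) :
    ∃ T : (F × sliceSpace D z) ≃L[ℝ] E, ∀ ξ v, T (ξ, v) = inf G z ξ + v := by
  let T : (F × sliceSpace D z) →L[ℝ] E :=
    (inf (F := F) (E := E) G z).coprod (sliceSpace D z).subtypeL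
  have hT : ∀ ξ v, T (ξ, v) = inf G z ξ + v := fun ξ v => by simp [T]
  have hinj : Function.Injective T := by
    rw [injective_iff_map_eq_zero]
    rintro ⟨ξ, v⟩ h
    rw [hT] at h
    have hξ : ξ = 0 := by
      refine moment_cx_inf_injective D hz ?_
      rw [eq_neg_of_add_eq_zero_left h, map_neg, map_neg, neg_eq_zero]
      exact v.2
    rw [hξ, map_zero, zero_add] at h
    rw [hξ, Prod.mk_eq_zero]
    exact ⟨rfl, Subtype.ext h⟩
  let B : F →L[ℝ] F := (dX (E := E) D.μ z).comp ((D.cx z).comp (inf G z))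
  have hB : Function.Injective B := by
    rw [injective_iff_map_eq_zero]
    exact fun ξ hξ => moment_cx_inf_injective D hz hξ
  have hsurj : Function.Surjective T := by
    intro w
    obtain ⟨ξ, hξ⟩ := (LinearMap.injective_iff_surjective (f := (B : F →ₗ[ℝ] F))).1 hB
      (dX (E := E) D.μ z (D.cx z w))
    have hξ' : dX (E := E) D.μ z (D.cx z (inf G z ξ)) = dX (E := E) D.μ z (D.cx z w) := hξ
    refine ⟨(ξ, ⟨w - inf G z ξ, ?_⟩), ?_⟩
    · rw [mem_sliceSpace, map_sub, map_sub, hξ', sub_self]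
    · rw [hT]; simp
  refine ⟨(LinearEquiv.ofBijective (T : (F × sliceSpace D z) →ₗ[ℝ] E)
    ⟨hinj, hsurj⟩).toContinuousLinearEquiv, hT⟩

/-- The action gives coordinates near `z`: a point near `z` is uniquely of the form `k • σ v` with
`k` near the unit and `v` in the slice. -/
theorem exists_slice_coordinates (hz : D.μ z = 0) {σ : E → X} (hσ0 : σ 0 = z)
    (hσs : ∀ᶠ w in 𝓝 0, ContMDiffAt 𝓘(ℝ, E) 𝓘(ℝ, E) ∞ σ w)
    (hσd : HasMFDerivAt 𝓘(ℝ, E) 𝓘(ℝ, E) σ 0 (ContinuousLinearMap.id ℝ E)) :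
    ∃ (κ : X → G) (π : X → sliceSpace D z),
      (∀ᶠ x in 𝓝 z, ContMDiffAt 𝓘(ℝ, E) 𝓘(ℝ, F) ∞ κ x ∧
        ContMDiffAt 𝓘(ℝ, E) 𝓘(ℝ, sliceSpace D z) ∞ π x ∧ κ x • σ (π x) = x) ∧
      ∀ᶠ p : G × sliceSpace D z in 𝓝 (1, 0), κ (p.1 • σ p.2) = p.1 ∧ π (p.1 • σ p.2) = p.2 := by
  have : ContinuousSMul G X := ContMDiffSMul.continuousSMul (I := 𝓘(ℝ, F)) (I' := 𝓘(ℝ, E)) ∞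
  set S := sliceSpace D z
  set φ := extChartAt 𝓘(ℝ, E) z
  set χ := extChartAt 𝓘(ℝ, F) (1 : G)
  have hχ1 : χ.symm (χ 1) = 1 := extChartAt_to_inv (1 : G)
  let ψ : F × S → X := fun p => χ.symm p.1 • σ p.2
  have hψ0 : ψ (χ 1, 0) = z := by simp [ψ, hχ1, hσ0]
  have hval : Tendsto (fun p : F × S => (p.2 : E)) (𝓝 (χ 1, 0)) (𝓝 0) :=
    (continuous_subtype_val.comp continuous_snd).tendsto' _ _ (by simp)
  have hfst : Tendsto (fun p : F × S => p.1) (𝓝 (χ 1, 0)) (𝓝 (χ 1)) := continuous_fst.tendsto' _ _ rfl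
  have hψs : ∀ᶠ p in 𝓝 ((χ 1, 0) : F × S), ContMDiffAt 𝓘(ℝ, F × S) 𝓘(ℝ, E) ∞ ψ p := by
    filter_upwards [hfst.eventually (extChartAt_target_mem_nhds (I := 𝓘(ℝ, F)) (1 : G)),
      hval.eventually hσs] with p hp hp'
    have h1 : ContMDiffAt 𝓘(ℝ, F × S) 𝓘(ℝ, F) ∞ (fun p : F × S => χ.symm p.1) p :=
      ContMDiffAt.comp (I' := 𝓘(ℝ, F)) p (contMDiffAt_extChartAt_symm hp)
        contDiff_fst.contMDiff.contMDiffAt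
    have h2 : ContMDiffAt 𝓘(ℝ, F × S) 𝓘(ℝ, E) ∞ (fun p : F × S => σ p.2) p :=
      ContMDiffAt.comp (I' := 𝓘(ℝ, E)) (g := σ) (f := fun p : F × S => (p.2 : E)) p hp'
        (S.subtypeL.contDiff.comp contDiff_snd).contMDiff.contMDiffAt
    exact h1.smul h2
  have hψc : Tendsto ψ (𝓝 (χ 1, 0)) (𝓝 z) := by
    have := hψs.self_of_nhds.continuousAt
    rwa [ContinuousAt, hψ0] at this
  have hsrc := extChartAt_source_mem_nhds (I := 𝓘(ℝ, E)) z
  have hf : ∀ᶠ p in 𝓝 ((χ 1, 0) : F × S), ContDiffAt ℝ ∞ (fun p => φ (ψ p)) p := by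
    filter_upwards [hψs, hψc.eventually hsrc] with p hp hps
    rw [← contMDiffAt_iff_contDiffAt]
    exact ContMDiffAt.comp (I' := 𝓘(ℝ, E)) p
      (contMDiffAt_extChartAt' (by rwa [extChartAt_source] at hps)) hp
  obtain ⟨T, hT⟩ := exists_tangent_splitting D hz
  have hd : HasFDerivAt (fun p => φ (ψ p)) (T : F × S →L[ℝ] E) (χ 1, 0) := by
    have h1 := (hf.self_of_nhds.differentiableAt (by simp)).hasFDerivAt
    set A := fderiv ℝ (fun p => φ (ψ p)) (χ 1, 0)
    -- The partial derivative in the group variable is the infinitesimal action, and the one in the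
    -- slice variable is the inclusion, because `σ` has the identity as derivative at 0.
    have h2 : A = T := by
      have hl : A.comp (ContinuousLinearMap.inl ℝ F S) = inf (F := F) (E := E) G z := by
        have h3 : HasFDerivAt (fun a : F => (a, (0 : S))) (ContinuousLinearMap.inl ℝ F S) (χ 1) :=
          hasFDerivAt_prodMk_left _ _
        have h4 := h1.comp (χ 1) h3
        have h5 := hasFDerivAt_orbit_chart (F := F) (E := E) (G := G) z
        refine h4.unique (h5.congr_of_eventuallyEq (Eventually.of_forall fun a => ?_))
        simp [ψ, hσ0, φ, χ]
      have hr : A.comp (ContinuousLinearMap.inr ℝ F S) = S.subtypeL := by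
        have h3 : HasFDerivAt (fun v : S => (χ 1, v)) (ContinuousLinearMap.inr ℝ F S) 0 :=
          hasFDerivAt_prodMk_right _ _
        have h4 := h1.comp (0 : S) h3
        have h5 : HasMFDerivAt 𝓘(ℝ, E) 𝓘(ℝ, E) φ (σ 0) (ContinuousLinearMap.id ℝ E) := by
          rw [hσ0]; exact hasMFDerivAt_extChartAt_self z
        have h6 : HasFDerivAt (φ ∘ σ) (ContinuousLinearMap.id ℝ E) (S.subtypeL 0) :=
          hasMFDerivAt_iff_hasFDerivAt.1 (HasMFDerivAt.comp (I' := 𝓘(ℝ, E)) (0 : E) h5 hσd)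
        have h7 := h6.comp (0 : S) S.subtypeL.hasFDerivAt
        refine h4.unique (h7.congr_of_eventuallyEq (Eventually.of_forall fun a => ?_))
        simp [ψ, hχ1]
      ext p
      · exact DFunLike.congr_fun hl p |>.trans (by simp [hT])
      · exact DFunLike.congr_fun hr p |>.trans (by simp [hT])
    rw [← h2]
    exact h1
  obtain ⟨τ, hτ0, hτ, hτ'⟩ := exists_smooth_inverse hf _ hd
  simp only [hψ0] at hτ0 hτ
  have hφ' : Tendsto φ (𝓝 z) (𝓝 (φ z)) := continuousAt_extChartAt (I := 𝓘(ℝ, E)) z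
  have hτc : Tendsto τ (𝓝 (φ z)) (𝓝 (χ 1, 0)) := by
    have := hτ.self_of_nhds.1.continuousAt
    rwa [ContinuousAt, hτ0] at this
  refine ⟨fun x => χ.symm (τ (φ x)).1, fun x => (τ (φ x)).2, ?_, ?_⟩
  · filter_upwards [hφ'.eventually hτ, hφ'.eventually (hτc.eventually (hψc.eventually hsrc)), hsrc,
      hφ'.eventually (hτc.eventually (hfst.eventually
        (extChartAt_target_mem_nhds (I := 𝓘(ℝ, F)) (1 : G))))] with x hx hxs hxs' hxt
    have h1 : ContMDiffAt 𝓘(ℝ, E) 𝓘(ℝ, F × S) ∞ (fun x => τ (φ x)) x :=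
      ContMDiffAt.comp (I' := 𝓘(ℝ, E)) x (contMDiffAt_iff_contDiffAt.2 hx.1)
        (contMDiffAt_extChartAt' (by rwa [extChartAt_source] at hxs'))
    have h2 : ContMDiffAt 𝓘(ℝ, E) 𝓘(ℝ, F) ∞ (fun x => (τ (φ x)).1) x :=
      ContMDiffAt.comp (I' := 𝓘(ℝ, F × S)) x contDiff_fst.contMDiff.contMDiffAt h1
    have h3 : ContMDiffAt 𝓘(ℝ, E) 𝓘(ℝ, S) ∞ (fun x => (τ (φ x)).2) x :=
      ContMDiffAt.comp (I' := 𝓘(ℝ, F × S)) x contDiff_snd.contMDiff.contMDiffAt h1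
    refine ⟨ContMDiffAt.comp (I' := 𝓘(ℝ, F)) x (contMDiffAt_extChartAt_symm hxt) h2, h3, ?_⟩
    exact φ.injOn hxs hxs' hx.2
  · have hk : Tendsto (fun p : G × S => (χ p.1, p.2)) (𝓝 (1, 0)) (𝓝 (χ 1, 0)) :=
      (ContinuousAt.comp (g := χ) (f := Prod.fst) (x := ((1, 0) : G × S))
        (continuousAt_extChartAt (1 : G)) continuousAt_fst).prodMk_nhds continuousAt_snd
    have hk1 : Tendsto (fun p : G × S => p.1) (𝓝 (1, 0)) (𝓝 1) := continuous_fst.tendsto' _ _ rfl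
    filter_upwards [hk.eventually hτ',
      hk1.eventually (extChartAt_source_mem_nhds (I := 𝓘(ℝ, F)) (1 : G))] with p hp hps
    simp only [ψ, χ.left_inv hps] at hp
    rw [hp]
    exact ⟨χ.left_inv hps, rfl⟩

end Construction
end SympVortex

namespace SympVortex

/-! ### The slice theorem. -/

section SliceTheorem

variable {F : Type*} [NormedAddCommGroup F] [NormedSpace ℝ F] [FiniteDimensional ℝ F]
  {E : Type*} [NormedAddCommGroup E] [NormedSpace ℝ E] [FiniteDimensional ℝ E]
  {G : Type*} [TopologicalSpace G] [ChartedSpace F G] [Group G] [LieGroup 𝓘(ℝ, F) ∞ G]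
  [CompactSpace G]
  {X : Type*} [TopologicalSpace X] [T2Space X] [ChartedSpace E X] [IsManifold 𝓘(ℝ, E) ∞ X]
  [MulAction G X] [ContMDiffSMul 𝓘(ℝ, F) 𝓘(ℝ, E) ∞ G X]
  (D : HamiltonianSpace F E G X) {z : X}

/-- A positive definite quadratic form that is invariant under the stabilizer. -/
theorem exists_invariant_form (hz : D.μ z = 0) :
    ∃ q : E → ℝ, ContDiff ℝ ∞ q ∧ (∀ (s : ℝ) v, q (s • v) = s ^ 2 * q v) ∧
      (∃ c : ℝ, 0 < c ∧ ∀ v, c * ‖v‖ ^ 2 ≤ q v) ∧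
      ∀ γ : G, γ • z = z → ∀ v, q (isoAct G z γ v) = q v := by
  let Γ := MulAction.stabilizer G z
  have : Finite Γ := (stabilizer_finite D hz).to_subtype
  have : Fintype Γ := Fintype.ofFinite Γ
  let Q : E → ℝ := fun v => D.om z v (D.cx z v)
  -- Summation over the finite stabilizer makes the form invariant by reindexing; no invariance of
  -- `ω` is needed.
  let q : E → ℝ := fun v => ∑ γ : Γ, Q (isoAct G z (γ : G) v)
  have hQ : ContDiff ℝ ∞ Q :=
    (D.om z).contDiff.clm_apply (D.cx z).contDiff
  have hq : ContDiff ℝ ∞ q :=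
    ContDiff.sum fun γ _ => hQ.comp (ContinuousLinearMap.contDiff _)
  have hqs : ∀ (s : ℝ) v, q (s • v) = s ^ 2 * q v := by
    intro s v
    simp only [q, Q, map_smul, smul_apply, smul_eq_mul, Finset.mul_sum]
    exact Finset.sum_congr rfl fun γ _ => by ring
  have hQ0 : ∀ v, 0 ≤ Q v := fun v => by
    rcases eq_or_ne v 0 with rfl | hv
    · simp [Q]
    · exact (om_cx_pos D z hv).le
  refine ⟨q, hq, hqs, exists_quadratic_lower_bound hq.continuous hqs fun v hv => ?_, ?_⟩
  · refine Finset.sum_pos' (fun γ _ => hQ0 _) ⟨1, Finset.mem_univ _, ?_⟩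
    simp only [OneMemClass.coe_one, isoAct_one]
    exact om_cx_pos D z hv
  · intro γ hγ v
    have hγ' : γ ∈ Γ := hγ
    refine Fintype.sum_equiv (Equiv.mulRight (⟨γ, hγ'⟩ : Γ)) _ _ fun δ => ?_
    simp only [Equiv.coe_mulRight, Subgroup.coe_mul]
    rw [isoAct_mul D _ hγ]

/-- The slice theorem at a point of the zero level of the moment map. -/
theorem nonempty_slice (hz : D.μ z = 0) : Nonempty (Slice D z) := by
  classical
  have hLG : IsTopologicalGroup G := topologicalGroup_of_lieGroup 𝓘(ℝ, F) ∞
  have hcs : ContinuousSMul G X := ContMDiffSMul.continuousSMul (I := 𝓘(ℝ, F)) (I' := 𝓘(ℝ, E)) ∞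
  obtain ⟨q, hqs, hqsm, ⟨c, hc, hqc⟩, hqa⟩ := exists_invariant_form D hz
  obtain ⟨N, hN, hN', hNS⟩ := exists_right_inverse D hz
  obtain ⟨σ, hσ0, hσs, hσd, hσa, hσμ⟩ := exists_equivariant_parametrization D hz
  obtain ⟨κ, π, hκ, hκ'⟩ := exists_slice_coordinates D hz hσ0 hσs hσd
  have hfin := stabilizer_finite D hz
  let S := sliceSpace D z
  set M : E →L[ℝ] F := dX (E := E) D.μ z
  let act : G → S →L[ℝ] S := fun γ => if h : γ • z = z then
    ((isoAct (E := E) G z γ).comp S.subtypeL).codRestrict S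
      (fun v => isoAct_mem_sliceSpace D h v.2) else 0
  have hact : ∀ γ : G, γ • z = z → ∀ v : S, (act γ v : E) = isoAct G z γ (v : E) := by
    intro γ h v
    simp only [act, dif_pos h]
    rfl
  -- The range of `N` lies in the slice space, because `dμ ∘ J ∘ N = 0`, so the projection along it
  -- preserves the slice space.
  let pr : S →L[ℝ] S := ((ContinuousLinearMap.id ℝ E - N.comp M).comp S.subtypeL).codRestrict S
    (fun v => by
      rw [mem_sliceSpace]
      have h1 : M (D.cx z v) = 0 := v.2
      simp only [ContinuousLinearMap.comp_apply, sub_apply, ContinuousLinearMap.id_apply, map_sub,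
        Submodule.subtypeL_apply]
      rw [hNS, sub_zero]
      exact h1)
  have hpr : ∀ v : S, (pr v : E) = v - N (M v) := fun v => rfl
  have hval : Tendsto (fun v : S => (v : E)) (𝓝 0) (𝓝 0) :=
    continuous_subtype_val.tendsto' _ _ (by simp)
  have hσc : Tendsto (fun v : S => σ v) (𝓝 0) (𝓝 z) := by
    have h := hσs.self_of_nhds.continuousAt
    rw [ContinuousAt, hσ0] at h
    exact h.comp hval
  have hσact : ∀ᶠ v : S in 𝓝 0, ∀ γ : G, γ • z = z → σ (act γ v) = γ • σ v := by
    have h1 : ∀ᶠ v : S in 𝓝 0, ∀ γ ∈ {k : G | k • z = z}, σ (isoAct G z γ v) = γ • σ v := by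
      rw [hfin.eventually_all]
      exact fun γ hγ => hval.eventually (hσa γ hγ)
    filter_upwards [h1] with v hv γ hγ
    rw [hact γ hγ]
    exact hv γ hγ
  have hsec : ∀ᶠ v : S in 𝓝 0, κ (σ v) = 1 ∧ π (σ v) = v := by
    have h1 : Tendsto (fun v : S => ((1 : G), v)) (𝓝 0) (𝓝 (1, 0)) :=
      tendsto_const_nhds.prodMk_nhds tendsto_id
    filter_upwards [h1.eventually hκ'] with v hv
    simpa using hv
  -- Slice coordinates are unique only for group elements near the unit. Compactness of `G` reduces
  -- the global statement to one near each `k₀`.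
  have hslice : ∀ᶠ p : S × S in 𝓝 (0, 0), ∀ k ∈ (univ : Set G), k • σ p.1 = σ p.2 →
      k • z = z ∧ act k p.1 = p.2 := by
    refine isCompact_univ.eventually_forall_of_forall_eventually
      (P := fun (p : S × S) (k : G) => k • σ p.1 = σ p.2 → k • z = z ∧ act k p.1 = p.2)
      fun k₀ _ => ?_
    have t1 : Tendsto (fun a : (S × S) × G => a.1.1) (𝓝 ((0, 0), k₀)) (𝓝 0) :=
      (continuous_fst.comp continuous_fst).tendsto' _ _ rfl
    have t2 : Tendsto (fun a : (S × S) × G => a.1.2) (𝓝 ((0, 0), k₀)) (𝓝 0) :=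
      (continuous_snd.comp continuous_fst).tendsto' _ _ rfl
    have t3 : Tendsto (fun a : (S × S) × G => a.2) (𝓝 ((0, 0), k₀)) (𝓝 k₀) :=
      continuous_snd.tendsto' _ _ rfl
    by_cases hk₀ : k₀ • z = z
    -- If `k₀` fixes `z`, then `k • σ v = (k * k₀⁻¹) • σ (act k₀ v)` with `k * k₀⁻¹` near the unit,
    -- so local uniqueness gives `k = k₀`. If `k₀` moves `z`, the points `k • σ v` and `σ v'` are
    -- far apart.
    · have ta : Tendsto (fun a : (S × S) × G => (a.2 * k₀⁻¹, act k₀ a.1.1)) (𝓝 ((0, 0), k₀))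
          (𝓝 (1, 0)) := by
        refine Tendsto.prodMk_nhds ?_ ?_
        · have := t3.mul_const k₀⁻¹
          rwa [mul_inv_cancel] at this
        · exact ((act k₀).continuous.tendsto' 0 0 (map_zero _)).comp t1
      filter_upwards [ta.eventually hκ', t2.eventually hsec, t1.eventually hσact]
        with a ha1 ha2 ha3 heq
      simp only [ha3 k₀ hk₀, smul_smul, inv_mul_cancel_right] at ha1
      rw [heq] at ha1
      have h1 : a.2 = k₀ := by
        rw [← mul_inv_eq_one, ← ha1.1, ha2.1]
      rw [h1]
      exact ⟨hk₀, ha1.2.symm.trans ha2.2⟩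
    · have hl := t3.smul (hσc.comp t1)
      filter_upwards [(hl.prodMk_nhds (hσc.comp t2)).eventually
        (isOpen_ne_fun continuous_fst continuous_snd |>.mem_nhds hk₀)] with a ha heq
      exact absurd heq ha
  -- By compactness of `G` one neighbourhood `U` serves all translates; the chart may depend on `k`.
  have hchart : ∃ U ∈ 𝓝 (0 : S), ∀ k ∈ (univ : Set G), ∃ x₁ : X, ∀ v ∈ U,
      k • σ v ∈ (chartAt E x₁).source := by
    refine isCompact_univ.induction_on (p := fun s => ∃ U ∈ 𝓝 (0 : S), ∀ k ∈ s, ∃ x₁ : X, ∀ v ∈ U,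
      k • σ v ∈ (chartAt E x₁).source) ⟨univ, univ_mem, by simp⟩ ?_ ?_ ?_
    · rintro s t hst ⟨U, hU, h⟩
      exact ⟨U, hU, fun k hk => h k (hst hk)⟩
    · rintro s t ⟨U, hU, h⟩ ⟨U', hU', h'⟩
      refine ⟨U ∩ U', inter_mem hU hU', fun k hk => ?_⟩
      rcases hk with hk | hk
      · obtain ⟨x₁, hx⟩ := h k hk
        exact ⟨x₁, fun v hv => hx v hv.1⟩
      · obtain ⟨x₁, hx⟩ := h' k hk
        exact ⟨x₁, fun v hv => hx v hv.2⟩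
    · intro k₀ _
      have ht : Tendsto (fun a : G × S => a.1 • σ a.2) (𝓝 k₀ ×ˢ 𝓝 0) (𝓝 (k₀ • z)) :=
        tendsto_fst.smul (hσc.comp tendsto_snd)
      have hev : ∀ᶠ a : G × S in 𝓝 k₀ ×ˢ 𝓝 0, a.1 • σ a.2 ∈ (chartAt E (k₀ • z)).source :=
        ht.eventually (chart_source_mem_nhds E (k₀ • z))
      obtain ⟨s, hs, U, hU, hsU⟩ := mem_prod_iff.1 hev
      exact ⟨s, nhdsWithin_le_nhds hs, U, hU, fun k hk => ⟨k₀ • z, fun v hv => hsU (a := (k, v)) ⟨hk, hv⟩⟩⟩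
  obtain ⟨U, hU, hUchart⟩ := hchart
  have hall : ∀ᶠ v : S in 𝓝 0, ContMDiffAt 𝓘(ℝ, E) 𝓘(ℝ, E) ∞ σ v ∧
      (∀ γ : G, γ • z = z → σ (act γ v) = γ • σ v) ∧ (κ (σ v) = 1 ∧ π (σ v) = v) ∧
      (∀ᶠ x in 𝓝 (σ v), ContMDiffAt 𝓘(ℝ, E) 𝓘(ℝ, F) ∞ κ x ∧
        ContMDiffAt 𝓘(ℝ, E) 𝓘(ℝ, S) ∞ π x ∧ κ x • σ (π x) = x) ∧ v ∈ U ∧ D.μ (σ v) = M v := by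
    filter_upwards [hval.eventually hσs, hσact, hsec, hσc.eventually hκ.eventually_nhds, hU,
      hval.eventually hσμ] with v h1 h2 h3 h4 h5 h6
    exact ⟨h1, h2, h3, h4, h5, h6⟩
  obtain ⟨δ, hδ, hball⟩ := Metric.eventually_nhds_iff_ball.1 hall
  obtain ⟨δ', hδ', hball'⟩ := Metric.eventually_nhds_iff_ball.1 hslice
  set d := min δ δ'
  have hd : 0 < d := lt_min hδ hδ'
  -- The lower bound `c ‖v‖² ≤ q v` turns sublevel sets of `q` into subsets of balls; hence the size
  -- `c d²` of the slice.
  have hnorm : ∀ v : S, q v < c * d ^ 2 → ‖v‖ < d := by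
    intro v hv
    have h1 := (hqc v).trans_lt hv
    have h2 := lt_of_mul_lt_mul_left h1 hc.le
    exact lt_of_pow_lt_pow_left₀ 2 hd.le h2
  have hgood : ∀ v : S, q v < c * d ^ 2 → _ := fun v hv =>
    hball v (mem_ball_zero_iff.2 ((hnorm v hv).trans_le (min_le_left _ _)))
  exact ⟨{
    S := S
    σ := fun v => σ v
    q := fun v => q v
    r := c * d ^ 2
    act := act
    pr := pr
    mom := M.comp S.subtypeL
    r_pos := by positivity
    q_smooth := hqs.comp S.subtypeL.contDiff
    q_smul := fun s v => hqsm s v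
    q_lower := ⟨c, hc, fun v => hqc v⟩
    q_act := fun γ hγ v => by rw [hact γ hγ, hqa γ hγ]
    σ_zero := hσ0
    σ_smooth := fun v hv => ContMDiffAt.comp (I' := 𝓘(ℝ, E)) (g := σ) (f := fun v : S => (v : E)) v
      (hgood v hv).1 S.subtypeL.contDiff.contMDiff.contMDiffAt
    σ_act := fun γ hγ v hv => (hgood v hv).2.1 γ hγ
    exists_section := fun v hv => ⟨κ, π, (hgood v hv).2.2.1.1, (hgood v hv).2.2.1.2,
      (hgood v hv).2.2.2.1⟩
    slice := fun k v v' hv hv' heq => hball' (v, v') (by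
      rw [Prod.mk_zero_zero, mem_ball_zero_iff, Prod.norm_def]
      exact max_lt ((hnorm v hv).trans_le (min_le_right _ _))
        ((hnorm v' hv').trans_le (min_le_right _ _))) k (mem_univ k) heq
    stab_finite := hfin
    exists_chart := fun k => (hUchart k (mem_univ k)).imp fun x₁ h v hv =>
      h v (hgood v hv).2.2.2.2.1
    pr_act := fun γ hγ v => Subtype.ext (by
      rw [hpr, hact γ hγ, hact γ hγ, hpr, map_sub, right_inverse_equivariant D hz hN hN' hγ]
      congr 2
      exact moment_isoAct D hγ v)
    mu_σ := fun v hv => (hgood v hv).2.2.2.2.2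
    mom_pr := fun v => by
      simp only [ContinuousLinearMap.comp_apply, Submodule.subtypeL_apply, hpr, map_sub]
      rw [hN, sub_self] }⟩

end SliceTheorem
end SympVortex

namespace SympVortex

/-! ### Curves in a tube and their lifts to the slice. -/

section Loop

variable {F : Type*} [NormedAddCommGroup F] [NormedSpace ℝ F]
  {E : Type*} [NormedAddCommGroup E] [NormedSpace ℝ E]
  (G : Type*) [TopologicalSpace G] [ChartedSpace F G] [Group G]
  {X : Type*} [TopologicalSpace X] [ChartedSpace E X] [MulAction G X]

/-- The covariant derivative `x' + X_η(x)` of the curve `x`. -/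
def curveD (x : ℝ → X) (η : ℝ → F) (θ : ℝ) : E := dW x univ θ 1 + inf G (x θ) (η θ)

end Loop

namespace Slice

variable {F : Type*} [NormedAddCommGroup F] [NormedSpace ℝ F]
  {E : Type*} [NormedAddCommGroup E] [NormedSpace ℝ E] [FiniteDimensional ℝ E]
  {G : Type*} [TopologicalSpace G] [ChartedSpace F G] [Group G] [LieGroup 𝓘(ℝ, F) ∞ G]
  {X : Type*} [TopologicalSpace X] [T2Space X] [ChartedSpace E X] [IsManifold 𝓘(ℝ, E) ∞ X]
  [MulAction G X] [ContMDiffSMul 𝓘(ℝ, F) 𝓘(ℝ, E) ∞ G X]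
  {D : HamiltonianSpace F E G X} {z : X} (𝒮 : Slice D z)

/-- The radius changes along a curve only through the covariant derivative of the curve. -/
theorem hasDerivAt_radius {x : ℝ → X} {θ : ℝ} (hx : MDifferentiableAt 𝓘(ℝ, ℝ) 𝓘(ℝ, E) x θ)
    (hxt : x θ ∈ 𝒮.tube 𝒮.r) (η : ℝ → F) :
    HasDerivAt (fun θ => 𝒮.radius (x θ))
      (dX (E := E) 𝒮.radius (x θ) (curveD G x η θ)) θ := by
  have h1 : HasMFDerivAt 𝓘(ℝ, E) 𝓘(ℝ, ℝ) 𝒮.radius (x θ) (dX (E := E) (N := ℝ) 𝒮.radius (x θ)) :=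
    ((𝒮.contMDiffAt_radius hxt).mdifferentiableAt (by simp)).hasMFDerivAt
  have h2 : HasMFDerivAt 𝓘(ℝ, ℝ) 𝓘(ℝ, E) x θ (dW (E := E) x univ θ) := by
    rw [dW, mfderivWithin_univ]
    exact hx.hasMFDerivAt
  have h3 : HasFDerivAt (fun θ => 𝒮.radius (x θ))
      ((dX (E := E) 𝒮.radius (x θ)).comp (dW (E := E) x univ θ)) θ :=
    hasMFDerivAt_iff_hasFDerivAt.1 (HasMFDerivAt.comp (I' := 𝓘(ℝ, E)) θ h1 h2)
  rw [curveD, map_add, 𝒮.dX_radius_inf hxt, add_zero]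
  exact h3.hasDerivAt

/-- A curve with a small covariant derivative that starts near the orbit stays near it. -/
theorem curve_mem_tube [CompactSpace G] {r₁ r' C ε T K : ℝ} (hr' : r' < 𝒮.r)
    (hC : ∀ (k : G) (v : 𝒮.S), 𝒮.q v ≤ r' → ∀ w : E,
      |dX (E := E) 𝒮.radius (k • 𝒮.σ v) w| ≤ C * D.normTan (k • 𝒮.σ v) w)
    (hC0 : 0 ≤ C) (hK : C * ε < K) (hK0 : 0 ≤ K) (hKT : r₁ + K * T ≤ r') {x : ℝ → X} {η : ℝ → F}
    (hx : ContMDiff 𝓘(ℝ, ℝ) 𝓘(ℝ, E) ∞ x) (hx0 : x 0 ∈ 𝒮.tube r₁) (hT : 0 ≤ T)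
    (hε : ∀ θ ∈ Icc (0 : ℝ) T, D.normTan (x θ) (curveD (E := E) G x η θ) ≤ ε) :
    ∀ θ ∈ Icc (0 : ℝ) T, ∃ (k : G) (v : 𝒮.S), 𝒮.q v ≤ r' ∧ k • 𝒮.σ v = x θ := by
  set B : Set X := {x : X | ∃ (k : G) (v : 𝒮.S), 𝒮.q v ≤ r' ∧ k • 𝒮.σ v = x}
  have hB : IsClosed B := (𝒮.isCompact_closedTube hr').isClosed
  have hBt : B ⊆ 𝒮.tube 𝒮.r := by
    rintro y ⟨k, v, hv, rfl⟩
    exact ⟨k, v, hv.trans_lt hr', rfl⟩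
  -- A continuity argument on `[0, T]`. The bound on the radius, which is at most `r'` throughout,
  -- prevents the curve from leaving the closed tube.
  let s : Set ℝ := {θ | x θ ∈ B ∧ 𝒮.radius (x θ) ≤ r₁ + K * θ}
  suffices h : Icc 0 T ⊆ s from fun θ hθ => (h hθ).1
  refine IsClosed.Icc_subset_of_forall_mem_nhdsWithin ?_ ?_ ?_
  · have hc : ContinuousOn (fun θ => 𝒮.radius (x θ) - (r₁ + K * θ)) (x ⁻¹' B) := by
      intro θ hθ
      refine ContinuousAt.continuousWithinAt (ContinuousAt.sub ?_ (by fun_prop))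
      exact ContinuousAt.comp (g := 𝒮.radius) (𝒮.contMDiffAt_radius (hBt hθ)).continuousAt
        hx.continuous.continuousAt
    have h := hc.preimage_isClosed_of_isClosed (hB.preimage hx.continuous) (isClosed_Iic (a := 0))
    have hs : s = x ⁻¹' B ∩ (fun θ => 𝒮.radius (x θ) - (r₁ + K * θ)) ⁻¹' Iic 0 := by
      ext θ
      simp [s]
    rw [hs]
    exact h.inter isClosed_Icc
  · obtain ⟨k, v, hv, hkv⟩ := hx0
    have hvr : 𝒮.q v ≤ r' := hv.le.trans (by nlinarith [mul_nonneg hK0 hT])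
    refine ⟨⟨k, v, hvr, hkv⟩, ?_⟩
    rw [← hkv, 𝒮.radius_apply (hvr.trans_lt hr'), mul_zero, add_zero]
    exact hv.le
  · rintro θ ⟨⟨hθB, hθr⟩, hθ⟩
    have hd := (𝒮.hasDerivAt_radius (hx.mdifferentiableAt (by simp)) (hBt hθB) η).sub
      ((hasDerivAt_id θ).const_mul K)
    have hneg : dX (E := E) 𝒮.radius (x θ) (curveD G x η θ) - K * 1 < 0 := by
      obtain ⟨k, v, hv, hkv⟩ := hθB
      have h1 := hC k v hv (curveD G x η θ)
      rw [hkv] at h1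
      have h2 := mul_le_mul_of_nonneg_left (hε θ ⟨hθ.1, hθ.2.le⟩) hC0
      have h3 := le_abs_self (dX (E := E) 𝒮.radius (x θ) (curveD G x η θ))
      linarith
    -- The strict inequality `C ε < K` makes the slope of `radius - K θ` negative just to the right
    -- of `θ`, so the bound persists there.
    have hsl := (hasDerivAt_iff_tendsto_slope.1 hd).eventually (gt_mem_nhds hneg)
    have hsl' := hsl.filter_mono (nhdsWithin_mono θ (s := Ioi θ) fun t ht => ne_of_gt ht)
    have hopen : ∀ᶠ t in 𝓝[>] θ, x t ∈ 𝒮.tube 𝒮.r :=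
      nhdsWithin_le_nhds (hx.continuous.continuousAt.eventually
        ((𝒮.isOpen_tube le_rfl).mem_nhds (hBt hθB)))
    have hT' : ∀ᶠ t in 𝓝[>] θ, t < T := nhdsWithin_le_nhds (gt_mem_nhds hθ.2)
    filter_upwards [hsl', hopen, hT', self_mem_nhdsWithin] with t ht hto htT htθ
    have htθ' : θ < t := htθ
    have h1 : 𝒮.radius (x t) ≤ r₁ + K * t := by
      rw [slope_def_field, div_neg_iff] at ht
      rcases ht with ht | ht
      · linarith [ht.2]
      · have := ht.1
        simp only [Pi.sub_apply, id] at this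
        linarith
    refine ⟨?_, h1⟩
    obtain ⟨k, v, hv, hkv⟩ := hto
    refine ⟨k, v, ?_, hkv⟩
    rw [← hkv, 𝒮.radius_apply hv] at h1
    have : K * t ≤ K * T := mul_le_mul_of_nonneg_left htT.le hK0
    linarith

/-- A lift of the curve `x` to the slice coordinates near the parameter `θ`. -/
structure IsLiftAt (x : ℝ → X) (k : ℝ → G) (p : ℝ → 𝒮.S) (θ : ℝ) : Prop where
  gauge : ContMDiffAt 𝓘(ℝ, ℝ) 𝓘(ℝ, F) ∞ k θ
  point : ContMDiffAt 𝓘(ℝ, ℝ) 𝓘(ℝ, 𝒮.S) ∞ p θ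
  eq : ∀ᶠ θ' in 𝓝 θ, 𝒮.q (p θ') < 𝒮.r ∧ k θ' • 𝒮.σ (p θ') = x θ'

variable {𝒮} in
theorem IsLiftAt.congr {x : ℝ → X} {k k' : ℝ → G} {p p' : ℝ → 𝒮.S} {θ : ℝ}
    (h : 𝒮.IsLiftAt x k p θ) (hk : k' =ᶠ[𝓝 θ] k) (hp : p' =ᶠ[𝓝 θ] p) :
    𝒮.IsLiftAt x k' p' θ where
  gauge := h.gauge.congr_of_eventuallyEq hk
  point := h.point.congr_of_eventuallyEq hp
  eq := by
    filter_upwards [h.eq, hk, hp] with θ' h1 h2 h3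
    rwa [h2, h3]

theorem exists_local_lift {x : ℝ → X} (hx : ContMDiff 𝓘(ℝ, ℝ) 𝓘(ℝ, E) ∞ x) {θ : ℝ}
    (hxt : x θ ∈ 𝒮.tube 𝒮.r) :
    ∃ (k : ℝ → G) (p : ℝ → 𝒮.S), ∀ᶠ θ' in 𝓝 θ, 𝒮.IsLiftAt x k p θ' := by
  obtain ⟨k₀, v₀, hv₀, h0⟩ := hxt
  obtain ⟨κ, π, h1, h2, hev⟩ := 𝒮.exists_section_at (k₀ := k₀) hv₀
  have hlt : ∀ᶠ y in 𝓝 (k₀ • 𝒮.σ v₀), 𝒮.q (π y) < 𝒮.r := by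
    have hc : ContinuousAt (fun y => 𝒮.q (π y)) (k₀ • 𝒮.σ v₀) :=
      ContinuousAt.comp (g := 𝒮.q) 𝒮.q_smooth.continuous.continuousAt
        hev.self_of_nhds.2.1.continuousAt
    exact hc.eventually (gt_mem_nhds (by simpa only [h2] using hv₀))
  have hc : Tendsto x (𝓝 θ) (𝓝 (k₀ • 𝒮.σ v₀)) := hx.continuous.tendsto' _ _ h0.symm
  refine ⟨fun θ => κ (x θ), fun θ => π (x θ), ?_⟩
  filter_upwards [(hc.eventually (hev.and hlt)).eventually_nhds] with θ' hθ'
  have h := hθ'.self_of_nhds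
  exact ⟨ContMDiffAt.comp (I' := 𝓘(ℝ, E)) θ' h.1.1 (hx θ'),
    ContMDiffAt.comp (I' := 𝓘(ℝ, E)) θ' h.1.2.1 (hx θ'), hθ'.mono fun t ht => ⟨ht.2, ht.1.2.2⟩⟩

theorem σ_act_inv {γ : G} (hγ : γ • z = z) {v : 𝒮.S} (hv : 𝒮.q v < 𝒮.r) :
    𝒮.σ (𝒮.act γ⁻¹ v) = γ⁻¹ • 𝒮.σ v :=
  𝒮.σ_act _ (by rw [inv_smul_eq_iff, hγ]) v hv

/-- Two lifts of a curve differ near a parameter by an element of the stabilizer. -/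
theorem exists_transition {x : ℝ → X} {k₁ k₂ : ℝ → G} {p₁ p₂ : ℝ → 𝒮.S} {θ : ℝ}
    (h₁ : 𝒮.IsLiftAt x k₁ p₁ θ) (h₂ : 𝒮.IsLiftAt x k₂ p₂ θ) :
    ∃ γ : G, γ • z = z ∧ k₁ =ᶠ[𝓝 θ] (fun θ => k₂ θ * γ) ∧ p₁ =ᶠ[𝓝 θ] fun θ => 𝒮.act γ⁻¹ (p₂ θ) := by
  have hLG : IsTopologicalGroup G := topologicalGroup_of_lieGroup 𝓘(ℝ, F) ∞
  have hT1 : T1Space G := ChartedSpace.t1Space F G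
  have hst : ∀ᶠ t in 𝓝 θ, ((k₂ t)⁻¹ * k₁ t) • z = z ∧ 𝒮.act ((k₁ t)⁻¹ * k₂ t) (p₂ t) = p₁ t := by
    filter_upwards [h₁.eq, h₂.eq] with t ht1 ht2
    exact ⟨(𝒮.slice_eq ht1.1 ht2.1 (ht2.2.trans ht1.2.symm)).1,
      (𝒮.slice_eq ht2.1 ht1.1 (ht1.2.trans ht2.2.symm)).2⟩
  set γ := (k₂ θ)⁻¹ * k₁ θ with hγ
  have hc : Tendsto (fun t => (k₂ t)⁻¹ * k₁ t) (𝓝 θ) (𝓝 γ) :=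
    h₂.gauge.continuousAt.inv.mul h₁.gauge.continuousAt
  -- The comparison of the two lifts is a continuous map to the finite stabilizer, hence constant
  -- near `θ`.
  have hfin : ({k : G | k • z = z} \ {γ}).Finite := 𝒮.stab_finite.subset sdiff_subset
  have hev := hc.eventually (hfin.isClosed.isOpen_compl.mem_nhds (by simp))
  have heq : ∀ᶠ t in 𝓝 θ, (k₂ t)⁻¹ * k₁ t = γ := by
    filter_upwards [hst, hev] with t ht1 ht2
    by_contra hne
    exact ht2 ⟨ht1.1, hne⟩
  refine ⟨γ, hst.self_of_nhds.1, ?_, ?_⟩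
  · filter_upwards [heq] with t ht
    rw [← ht, mul_inv_cancel_left]
  · filter_upwards [heq, hst] with t ht hs
    rw [← hs.2, ← ht, mul_inv_rev, inv_inv]

theorem IsLiftAt.twist {x : ℝ → X} {k : ℝ → G} {p : ℝ → 𝒮.S} {θ : ℝ} (h : 𝒮.IsLiftAt x k p θ)
    {γ : G} (hγ : γ • z = z) : 𝒮.IsLiftAt x (fun θ => k θ * γ) (fun θ => 𝒮.act γ⁻¹ (p θ)) θ where
  gauge := h.gauge.mul contMDiffAt_const
  point := ContMDiffAt.comp (I' := 𝓘(ℝ, 𝒮.S)) θ (𝒮.act γ⁻¹).contMDiff.contMDiffAt h.point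
  eq := by
    filter_upwards [h.eq] with t ht
    rw [𝒮.q_act _ (by rw [inv_smul_eq_iff, hγ]), 𝒮.σ_act_inv hγ ht.1, smul_smul,
      mul_inv_cancel_right]
    exact ht

/-- A curve in the tube lifts to the slice coordinates. -/
theorem exists_lift {x : ℝ → X} (hx : ContMDiff 𝓘(ℝ, ℝ) 𝓘(ℝ, E) ∞ x) {T : ℝ} (hT : 0 ≤ T)
    (hxt : ∀ θ ∈ Icc (0 : ℝ) T, x θ ∈ 𝒮.tube 𝒮.r) :
    ∃ (k : ℝ → G) (p : ℝ → 𝒮.S), ∀ θ ∈ Icc (0 : ℝ) T, 𝒮.IsLiftAt x k p θ := by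
  choose k p hkp using fun θ : Icc (0 : ℝ) T => 𝒮.exists_local_lift hx (hxt θ θ.2)
  choose V hV hVo hVmem using fun θ => mem_nhds_iff.1 (hkp θ)
  obtain ⟨t, ht0, htm, ⟨m, hm⟩, hts⟩ := exists_monotone_Icc_subset_open_cover_Icc hT
    (c := fun θ : Icc (0 : ℝ) T => Subtype.val ⁻¹' V θ)
    (fun θ => (hVo θ).preimage continuous_subtype_val)
    (fun θ _ => mem_iUnion.2 ⟨θ, hVmem θ⟩)
  have key : ∀ n : ℕ, ∃ (k : ℝ → G) (p : ℝ → 𝒮.S), ∀ θ ∈ Icc (0 : ℝ) (t n), 𝒮.IsLiftAt x k p θ := by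
    intro n
    induction n with
    | zero =>
      refine ⟨k ⟨0, le_rfl, hT⟩, p ⟨0, le_rfl, hT⟩, fun θ hθ => ?_⟩
      rw [ht0] at hθ
      have : θ = 0 := le_antisymm hθ.2 hθ.1
      rw [this]
      exact (hkp ⟨0, le_rfl, hT⟩).self_of_nhds
    | succ n ih =>
      obtain ⟨k₁, p₁, h₁⟩ := ih
      obtain ⟨i, hi⟩ := hts n
      have h₂ : ∀ θ ∈ Icc (t n : ℝ) (t (n + 1)), 𝒮.IsLiftAt x (k i) (p i) θ := by
        intro θ hθ
        have hθT : θ ∈ Icc (0 : ℝ) T := ⟨(t n).2.1.trans hθ.1, hθ.2.trans (t (n + 1)).2.2⟩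
        exact hV i (hi (a := ⟨θ, hθT⟩) ⟨hθ.1, hθ.2⟩)
      set b : ℝ := (t n : ℝ)
      have hbb : b ≤ t (n + 1) := htm n.le_succ
      -- After a twist by `γ` the next lift agrees with the previous one on a whole neighbourhood of
      -- the junction `b`, so the glued lift is smooth there.
      obtain ⟨γ, hγ, hkγ, hpγ⟩ := 𝒮.exists_transition (h₁ b ⟨(t n).2.1, le_rfl⟩)
        (h₂ b ⟨le_rfl, hbb⟩)
      refine ⟨fun θ => if θ ≤ b then k₁ θ else k i θ * γ,
        fun θ => if θ ≤ b then p₁ θ else 𝒮.act γ⁻¹ (p i θ), fun θ hθ => ?_⟩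
      rcases lt_trichotomy θ b with hlt | rfl | hgt
      · refine (h₁ θ ⟨hθ.1, hlt.le⟩).congr ?_ ?_ <;>
        · filter_upwards [gt_mem_nhds hlt] with s hs
          rw [if_pos (le_of_lt hs)]
      · refine (h₁ b ⟨(t n).2.1, le_rfl⟩).congr ?_ ?_
        · filter_upwards [hkγ] with s hs
          split_ifs
          exacts [rfl, hs.symm]
        · filter_upwards [hpγ] with s hs
          split_ifs
          exacts [rfl, hs.symm]
      · refine ((h₂ θ ⟨hgt.le, hθ.2⟩).twist 𝒮 hγ).congr ?_ ?_ <;>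
        · filter_upwards [lt_mem_nhds hgt] with s hs
          rw [if_neg (not_le.2 hs)]
  obtain ⟨k, p, h⟩ := key m
  rw [hm m le_rfl] at h
  exact ⟨k, p, h⟩

end Slice
end SympVortex

namespace SympVortex

/-! ### Existence of small cappings. -/

section Capping

variable {F : Type*} [NormedAddCommGroup F] [NormedSpace ℝ F]
  {E : Type*} [NormedAddCommGroup E] [NormedSpace ℝ E] [FiniteDimensional ℝ E]
  {G : Type*} [TopologicalSpace G] [ChartedSpace F G] [Group G] [LieGroup 𝓘(ℝ, F) ∞ G]
  [CompactSpace G]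
  {X : Type*} [MetricSpace X] [ChartedSpace E X] [IsManifold 𝓘(ℝ, E) ∞ X]
  [MulAction G X] [ContMDiffSMul 𝓘(ℝ, F) 𝓘(ℝ, E) ∞ G X]
  {D : HamiltonianSpace F E G X} {z : X} (𝒮 : Slice D z)

namespace Slice

theorem exists_radius_of_eventually {P : 𝒮.S → Prop} (h : ∀ᶠ v in 𝓝 0, P v) :
    ∃ r₁ : ℝ, 0 < r₁ ∧ r₁ ≤ 𝒮.r ∧ ∀ v, 𝒮.q v < r₁ → P v := by
  obtain ⟨δ, hδ, hP⟩ := Metric.eventually_nhds_iff_ball.1 h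
  obtain ⟨c, hc, hq⟩ := 𝒮.q_lower
  refine ⟨min 𝒮.r (c * δ ^ 2), lt_min 𝒮.r_pos (by positivity), min_le_left _ _, fun v hv => ?_⟩
  refine hP v (mem_ball_zero_iff.2 ?_)
  have h1 := (hq v).trans_lt (hv.trans_le (min_le_right _ _))
  exact lt_of_pow_lt_pow_left₀ 2 hδ.le (lt_of_mul_lt_mul_left h1 hc.le)

/-- The path in the slice from `0` through the projection `pr v` to `v`. -/
def path (s : ℝ) (v : 𝒮.S) : 𝒮.S :=
  if s ≤ 1 then s • 𝒮.pr v else 𝒮.pr v + (s - 1) • (v - 𝒮.pr v)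

theorem path_of_le {s : ℝ} (hs : s ≤ 1) (v : 𝒮.S) : 𝒮.path s v = s • 𝒮.pr v := if_pos hs

theorem path_of_ge {s : ℝ} (hs : 1 ≤ s) (v : 𝒮.S) :
    𝒮.path s v = 𝒮.pr v + (s - 1) • (v - 𝒮.pr v) := by
  rcases hs.eq_or_lt with rfl | h
  · simp [path]
  · exact if_neg (not_le.2 h)

theorem path_act (s : ℝ) {γ : G} (hγ : γ • z = z) (v : 𝒮.S) :
    𝒮.path s (𝒮.act γ v) = 𝒮.act γ (𝒮.path s v) := by
  unfold path
  split_ifs <;> simp [𝒮.pr_act γ hγ]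

/-- Short vectors have paths that stay in the slice and move only little. -/
theorem exists_path_radius {ρ : ℝ} (hρ : 0 < ρ) :
    ∃ r₁ : ℝ, 0 < r₁ ∧ r₁ ≤ 𝒮.r ∧ ∀ v, 𝒮.q v < r₁ → ∀ s ∈ Icc (0 : ℝ) 2,
      𝒮.q (𝒮.path s v) < 𝒮.r ∧ ∀ k : G, dist (k • 𝒮.σ (𝒮.path s v)) (k • z) < ρ := by
  have hcs : ContinuousSMul G X := ContMDiffSMul.continuousSMul (I := 𝓘(ℝ, F)) (I' := 𝓘(ℝ, E)) ∞
  have hσc : Tendsto 𝒮.σ (𝓝 0) (𝓝 z) := by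
    have := (𝒮.σ_smooth 0 (by rw [𝒮.q_zero]; exact 𝒮.r_pos)).continuousAt
    rwa [ContinuousAt, 𝒮.σ_zero] at this
  -- The estimate has to be uniform in `k`, because the centre of the capping is `k 0 • z` with an
  -- arbitrary `k 0`.
  have hdist : ∀ᶠ w : 𝒮.S in 𝓝 0, ∀ k ∈ (univ : Set G), dist (k • 𝒮.σ w) (k • z) < ρ := by
    refine isCompact_univ.eventually_forall_of_forall_eventually
      (P := fun (w : 𝒮.S) (k : G) => dist (k • 𝒮.σ w) (k • z) < ρ) fun k₀ _ => ?_
    rw [nhds_prod_eq]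
    have h1 : Tendsto (fun a : 𝒮.S × G => dist (a.2 • 𝒮.σ a.1) (a.2 • z)) (𝓝 0 ×ˢ 𝓝 k₀)
        (𝓝 (dist (k₀ • z) (k₀ • z))) :=
      (tendsto_snd.smul (hσc.comp tendsto_fst)).dist (tendsto_snd.smul tendsto_const_nhds)
    rw [dist_self] at h1
    exact h1.eventually (gt_mem_nhds hρ)
  have hq : ∀ᶠ w : 𝒮.S in 𝓝 0, 𝒮.q w < 𝒮.r :=
    𝒮.q_smooth.continuous.continuousAt.eventually
      (gt_mem_nhds (by simpa only [𝒮.q_zero] using 𝒮.r_pos))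
  have hgood := hq.and hdist
  have h1 : ∀ᶠ v : 𝒮.S in 𝓝 0, ∀ s ∈ Icc (0 : ℝ) 1,
      (𝒮.q (s • 𝒮.pr v) < 𝒮.r ∧ ∀ k ∈ (univ : Set G), dist (k • 𝒮.σ (s • 𝒮.pr v)) (k • z) < ρ) := by
    refine isCompact_Icc.eventually_forall_of_forall_eventually (P := fun (v : 𝒮.S) (s : ℝ) =>
      (𝒮.q (s • 𝒮.pr v) < 𝒮.r ∧ ∀ k ∈ (univ : Set G), dist (k • 𝒮.σ (s • 𝒮.pr v)) (k • z) < ρ))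
      fun s₀ _ => ?_
    have hc : Tendsto (fun a : 𝒮.S × ℝ => a.2 • 𝒮.pr a.1) (𝓝 (0, s₀)) (𝓝 0) :=
      Continuous.tendsto' (by fun_prop) _ _ (by simp)
    exact hc.eventually hgood
  have h2 : ∀ᶠ v : 𝒮.S in 𝓝 0, ∀ s ∈ Icc (1 : ℝ) 2,
      (𝒮.q (𝒮.pr v + (s - 1) • (v - 𝒮.pr v)) < 𝒮.r ∧ ∀ k ∈ (univ : Set G),
        dist (k • 𝒮.σ (𝒮.pr v + (s - 1) • (v - 𝒮.pr v))) (k • z) < ρ) := by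
    refine isCompact_Icc.eventually_forall_of_forall_eventually (P := fun (v : 𝒮.S) (s : ℝ) =>
      (𝒮.q (𝒮.pr v + (s - 1) • (v - 𝒮.pr v)) < 𝒮.r ∧ ∀ k ∈ (univ : Set G),
        dist (k • 𝒮.σ (𝒮.pr v + (s - 1) • (v - 𝒮.pr v))) (k • z) < ρ)) fun s₀ _ => ?_
    have hc : Tendsto (fun a : 𝒮.S × ℝ => 𝒮.pr a.1 + (a.2 - 1) • (a.1 - 𝒮.pr a.1)) (𝓝 (0, s₀))
        (𝓝 0) :=
      Continuous.tendsto' (by fun_prop) _ _ (by simp)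
    exact hc.eventually hgood
  obtain ⟨r₁, hr₁, hle, h⟩ := 𝒮.exists_radius_of_eventually (h1.and h2)
  refine ⟨r₁, hr₁, hle, fun v hv s hs => ?_⟩
  rcases le_total s 1 with hs1 | hs1
  · rw [𝒮.path_of_le hs1]
    have := (h v hv).1 s ⟨hs.1, hs1⟩
    exact ⟨this.1, fun k => this.2 k (mem_univ k)⟩
  · rw [𝒮.path_of_ge hs1]
    have := (h v hv).2 s ⟨hs1, hs.2⟩
    exact ⟨this.1, fun k => this.2 k (mem_univ k)⟩

/-- The capping of a loop that is lifted to the slice. -/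
theorem isCapping_of_lift {ρ r₁ : ℝ}
    (hr₁ : ∀ v, 𝒮.q v < r₁ → ∀ s ∈ Icc (0 : ℝ) 2,
      𝒮.q (𝒮.path s v) < 𝒮.r ∧ ∀ k : G, dist (k • 𝒮.σ (𝒮.path s v)) (k • z) < ρ)
    {x : ℝ → X} (hxp : x (2 * Real.pi) = x 0) {k : ℝ → G} {p : ℝ → 𝒮.S}
    (hl : ∀ θ ∈ Icc (0 : ℝ) (2 * Real.pi), 𝒮.IsLiftAt x k p θ)
    (hp : ∀ θ ∈ Icc (0 : ℝ) (2 * Real.pi), 𝒮.q (p θ) < r₁) :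
    IsCapping D ρ x (fun a => k a.2 • 𝒮.σ (𝒮.path a.1 (p a.2))) (k 0 • z)
      (fun θ => k θ * (k 0)⁻¹) := by
  have hpi : (0 : ℝ) ≤ 2 * Real.pi := by positivity
  have hsm : ∀ (f : ℝ × ℝ → 𝒮.S) (a b : ℝ), 0 ≤ a → b ≤ 2 →
      (∀ a' ∈ cylRect a b, ContMDiffWithinAt 𝓘(ℝ, ℝ × ℝ) 𝓘(ℝ, 𝒮.S) ∞ f (cylRect a b) a') →
      (∀ a' ∈ cylRect a b, 𝒮.path a'.1 (p a'.2) = f a') →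
      ContMDiffOn 𝓘(ℝ, ℝ × ℝ) 𝓘(ℝ, E) ∞ (fun a => k a.2 • 𝒮.σ (𝒮.path a.1 (p a.2)))
        (cylRect a b) := by
    intro f a b ha hb hf hpath
    refine ContMDiffOn.congr (f := fun a => k a.2 • 𝒮.σ (f a)) (fun a' ha' => ?_)
      fun a' ha' => by rw [hpath a' ha']
    have h1 : ContMDiffAt 𝓘(ℝ, 𝒮.S) 𝓘(ℝ, E) ∞ 𝒮.σ (f a') := by
      refine 𝒮.σ_smooth _ ?_
      rw [← hpath a' ha']
      exact (hr₁ _ (hp _ ha'.2) _ ⟨ha.trans ha'.1.1, ha'.1.2.trans hb⟩).1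
    have h2 : ContMDiffWithinAt 𝓘(ℝ, ℝ × ℝ) 𝓘(ℝ, E) ∞ (fun a => 𝒮.σ (f a)) (cylRect a b) a' :=
      ContMDiffAt.comp_contMDiffWithinAt (I' := 𝓘(ℝ, 𝒮.S)) a' h1 (hf a' ha')
    have h3 : ContMDiffAt 𝓘(ℝ, ℝ × ℝ) 𝓘(ℝ, F) ∞ (fun a : ℝ × ℝ => k a.2) a' :=
      ContMDiffAt.comp (I' := 𝓘(ℝ, ℝ)) a' (hl _ ha'.2).gauge contDiff_snd.contMDiff.contMDiffAt
    exact h3.contMDiffWithinAt.smul h2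
  have hpa : ∀ a b : ℝ, ∀ a' ∈ cylRect a b, ContDiffAt ℝ ∞ (fun a : ℝ × ℝ => p a.2) a' := by
    intro a b a' ha'
    have := ContMDiffAt.comp (I' := 𝓘(ℝ, ℝ)) a' (hl _ ha'.2).point
      (contDiff_snd (E := ℝ) (F := ℝ)).contMDiff.contMDiffAt
    exact contMDiffAt_iff_contDiffAt.1 this
  refine ⟨?_, ?_, ?_, ?_, ?_, ?_, ?_, ?_, ?_⟩
  · refine hsm (fun a => a.1 • 𝒮.pr (p a.2)) 0 1 le_rfl (by norm_num) (fun a' ha' => ?_)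
      fun a' ha' => 𝒮.path_of_le ha'.1.2 _
    exact (contMDiffAt_iff_contDiffAt.2 (contDiffAt_fst.smul
      (𝒮.pr.contDiff.contDiffAt.comp a' (hpa _ _ a' ha')))).contMDiffWithinAt
  · refine hsm (fun a => 𝒮.pr (p a.2) + (a.1 - 1) • (p a.2 - 𝒮.pr (p a.2))) 1 2 (by norm_num) le_rfl
      (fun a' ha' => ?_) fun a' ha' => 𝒮.path_of_ge ha'.1.1 _
    have h1 := hpa _ _ a' ha'
    have h2 : ContDiffAt ℝ ∞ (fun a : ℝ × ℝ => 𝒮.pr (p a.2)) a' :=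
      𝒮.pr.contDiff.contDiffAt.comp a' h1
    exact (contMDiffAt_iff_contDiffAt.2 (h2.add
      ((contDiffAt_fst.sub contDiffAt_const).smul (h1.sub h2)))).contMDiffWithinAt
  · intro θ hθ
    have h1 : 𝒮.path 2 (p θ) = p θ := by
      rw [𝒮.path_of_ge (by norm_num)]
      norm_num
    simp only [h1]
    exact (hl θ hθ).eq.self_of_nhds.2
  · intro s hs
    have h0 := (hl 0 ⟨le_rfl, hpi⟩).eq.self_of_nhds
    have h1 := (hl _ ⟨hpi, le_rfl⟩).eq.self_of_nhds
    -- The lift closes up to the stabilizer element `(k 2π)⁻¹ * k 0`. The paths are equivariant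
    -- under it, so the capping itself closes.
    obtain ⟨hγ, hact⟩ := 𝒮.slice_eq h0.1 h1.1 (h1.2.trans (hxp.trans h0.2.symm))
    simp only
    rw [← hact, 𝒮.path_act s hγ, 𝒮.σ_act _ hγ _ (hr₁ _ (hp 0 ⟨le_rfl, hpi⟩) s hs).1, smul_smul,
      mul_inv_cancel_left]
  · intro a ha
    -- In the slice the moment map is linear and annihilates `pr v`, hence also the segment from 0
    -- to `pr v`, which is the inner half of the path.
    refine mu_smul_eq_zero D ?_ _
    rw [𝒮.mu_σ _ (hr₁ _ (hp _ ha.2) a.1 ⟨ha.1.1, ha.1.2.trans (by norm_num)⟩).1,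
      𝒮.path_of_le ha.1.2, map_smul, 𝒮.mom_pr, smul_zero]
  · intro θ hθ
    exact ((hl θ hθ).gauge.mul contMDiffAt_const).contMDiffWithinAt
  · exact mul_inv_cancel _
  · intro θ hθ
    simp only
    rw [𝒮.path_of_le zero_le_one, zero_smul, 𝒮.σ_zero, smul_smul, inv_mul_cancel_right]
  · intro a ha
    -- The gauge replaces `k θ` by `k 0`, so the distance to be bounded is that from `k 0 • σ
    -- (path)` to `k 0 • z`.
    rw [smul_smul, mul_inv_rev, inv_inv, inv_mul_cancel_right]
    exact (hr₁ _ (hp _ ha.2) a.1 ha.1).2 (k 0)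

/-- Loops near an orbit of the zero level have small cappings. -/
theorem exists_capping (hz : D.μ z = 0) {ρ : ℝ} (hρ : 0 < ρ) :
    ∃ r₁ : ℝ, 0 < r₁ ∧ r₁ ≤ 𝒮.r ∧ ∃ ε : ℝ, 0 < ε ∧ ∀ (x : ℝ → X) (η : ℝ → F),
      ContMDiff 𝓘(ℝ, ℝ) 𝓘(ℝ, E) ∞ x → x (2 * Real.pi) = x 0 → x 0 ∈ 𝒮.tube r₁ →
      (∀ θ ∈ Icc (0 : ℝ) (2 * Real.pi), D.normTan (x θ) (curveD (E := E) G x η θ) ≤ ε) →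
      ∃ (c : ℝ × ℝ → X) (z₀ : X) (g : ℝ → G), IsCapping D ρ x c z₀ g := by
  have hpi : (0 : ℝ) < 2 * Real.pi := by positivity
  obtain ⟨r₂, hr₂, hr₂r, hpath⟩ := 𝒮.exists_path_radius hρ
  have hr' : r₂ / 2 < 𝒮.r := by linarith
  obtain ⟨C, hC0, hC⟩ := 𝒮.exists_bound hz hr'
  -- The radius starts below `r₂ / 4` and grows at rate at most `K`, thus by at most `r₂ / 4` over
  -- the loop; it stays below `r₂`, where the paths are controlled. The choice `ε = K / (C + 1)`
  -- ensures `C ε < K`.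
  set K : ℝ := r₂ / 4 / (2 * Real.pi)
  have hK : 0 < K := by positivity
  have hKpi : K * (2 * Real.pi) = r₂ / 4 := div_mul_cancel₀ _ hpi.ne'
  refine ⟨r₂ / 4, by positivity, by linarith, K / (C + 1), by positivity,
    fun x η hx hxp hx0 hε => ?_⟩
  have hCK : C * (K / (C + 1)) < K := by
    rw [← mul_div_assoc, div_lt_iff₀ (by positivity)]
    nlinarith
  have hmem := 𝒮.curve_mem_tube hr' (fun k v hv w => (hC k v hv w).2) hC0 hCK hK.le
    (T := 2 * Real.pi) (r₁ := r₂ / 4) (by rw [hKpi]; linarith) hx hx0 hpi.le hε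
  obtain ⟨k, p, hl⟩ := 𝒮.exists_lift hx hpi.le fun θ hθ => by
    obtain ⟨k, v, hv, hkv⟩ := hmem θ hθ
    exact ⟨k, v, hv.trans_lt hr', hkv⟩
  refine ⟨_, _, _, 𝒮.isCapping_of_lift hpath hxp hl fun θ hθ => ?_⟩
  obtain ⟨k', v, hv, hkv⟩ := hmem θ hθ
  have h := (hl θ hθ).eq.self_of_nhds
  rw [← 𝒮.radius_apply (k := k θ) h.1, h.2, ← hkv, 𝒮.radius_apply (hv.trans_lt hr')]
  linarith

end Slice

theorem continuous_normLie_mu (D : HamiltonianSpace F E G X) :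
    Continuous fun x => D.normLie (D.μ x) := by
  have h := D.μ_smooth.continuous
  unfold HamiltonianSpace.normLie
  exact Real.continuous_sqrt.comp ((D.ip.continuous.comp h).clm_apply h)

theorem normLie_pos (D : HamiltonianSpace F E G X) {ξ : F} (h : ξ ≠ 0) : 0 < D.normLie ξ :=
  Real.sqrt_pos.2 (D.ip_pos ξ h)

/-- Loops with a small covariant derivative near the zero level have small cappings. -/
theorem exists_capping [FiniteDimensional ℝ F] [CompactSpace X] (D : HamiltonianSpace F E G X)
    {ρ : ℝ} (hρ : 0 < ρ) :
    ∃ ε : ℝ, 0 < ε ∧ ∀ (x : ℝ → X) (η : ℝ → F),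
      ContMDiff 𝓘(ℝ, ℝ) 𝓘(ℝ, E) ∞ x → x (2 * Real.pi) = x 0 → D.normLie (D.μ (x 0)) ≤ ε →
      (∀ θ ∈ Icc (0 : ℝ) (2 * Real.pi), D.normTan (x θ) (curveD (E := E) G x η θ) ≤ ε) →
      ∃ (c : ℝ × ℝ → X) (z₀ : X) (g : ℝ → G), IsCapping D ρ x c z₀ g := by
  set Z : Set X := {x | D.μ x = 0}
  have hZ : IsCompact Z := (isClosed_singleton.preimage D.μ_smooth.continuous).isCompact
  have h𝒮 : ∀ z : Z, Nonempty (Slice D (z : X)) := fun z => nonempty_slice D z.2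
  let 𝒮 : ∀ z : Z, Slice D (z : X) := fun z => (h𝒮 z).some
  choose r₁ hr₁ hr₁r ε hε hcap using fun z : Z => (𝒮 z).exists_capping z.2 hρ
  obtain ⟨t, ht⟩ := hZ.elim_finite_subcover (fun z : Z => (𝒮 z).tube (r₁ z))
    (fun z => (𝒮 z).isOpen_tube (hr₁r z))
    (fun z hz => mem_iUnion.2 ⟨⟨z, hz⟩, (𝒮 ⟨z, hz⟩).mem_tube_self (hr₁ _)⟩)
  -- Off the finitely many tubes that cover the zero level the norm of the moment map has a positive
  -- lower bound, so a small value of it at `x 0` puts the base point of the loop into a tube.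
  set K : Set X := (⋃ z ∈ t, (𝒮 z).tube (r₁ z))ᶜ
  have hK : IsCompact K :=
    (isOpen_biUnion fun z _ => (𝒮 z).isOpen_tube (hr₁r z)).isClosed_compl.isCompact
  have hmin : ∃ δ : ℝ, 0 < δ ∧ ∀ x ∈ K, δ < D.normLie (D.μ x) := by
    rcases K.eq_empty_or_nonempty with he | hne
    · exact ⟨1, one_pos, by simp [he]⟩
    obtain ⟨a, ha, hmin⟩ := hK.exists_isMinOn hne (continuous_normLie_mu D).continuousOn
    have hpos : 0 < D.normLie (D.μ a) := normLie_pos D fun h => ha (ht h)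
    exact ⟨D.normLie (D.μ a) / 2, by positivity, fun x hx => by
      have : D.normLie (D.μ a) ≤ D.normLie (D.μ x) := hmin hx
      linarith⟩
  obtain ⟨δ, hδ, hδK⟩ := hmin
  have hε' : ∃ ε' : ℝ, 0 < ε' ∧ ∀ z ∈ t, ε' ≤ ε z := by
    rcases t.eq_empty_or_nonempty with he | hne
    · exact ⟨1, one_pos, by simp [he]⟩
    obtain ⟨a, ha, hmin⟩ := t.exists_min_image ε hne
    exact ⟨ε a, hε a, hmin⟩
  obtain ⟨ε', hε'0, hε'⟩ := hε'
  refine ⟨min δ ε', lt_min hδ hε'0, fun x η hx hxp hμ hD => ?_⟩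
  have hx0 : x 0 ∉ K := fun h => absurd (hδK _ h) (not_lt.2 (hμ.trans (min_le_left _ _)))
  obtain ⟨z, hzt, hz⟩ := mem_iUnion₂.1 (not_notMem.1 hx0)
  exact hcap z x η hx hxp hz fun θ hθ => (hD θ hθ).trans ((min_le_right _ _).trans (hε' z hzt))

end Capping
end SympVortex

namespace SympVortex

/-! ### The action as an integral of a primitive over the loop. -/

section Action

variable {F : Type*} [NormedAddCommGroup F] [NormedSpace ℝ F]
  {E : Type*} [NormedAddCommGroup E] [NormedSpace ℝ E] [FiniteDimensional ℝ E]
  {G : Type*} [TopologicalSpace G] [ChartedSpace F G] [Group G] [LieGroup 𝓘(ℝ, F) ∞ G]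
  {X : Type*} [MetricSpace X] [ChartedSpace E X] [IsManifold 𝓘(ℝ, E) ∞ X]
  [MulAction G X] [ContMDiffSMul 𝓘(ℝ, F) 𝓘(ℝ, E) ∞ G X]
  {H : Type*} [NormedAddCommGroup H] [NormedSpace ℝ H]
  {D : HamiltonianSpace F E G X}

variable (H) in
/-- On the invariant open set `U` the bounded one-form `α` is a primitive of `ω` whose values on
the orbits are given by the moment map. -/
structure IsMomentPrimitive (D : HamiltonianSpace F E G X) (U : Set X) (α : X → E →L[ℝ] ℝ)
    (C : ℝ) : Prop where
  isOpen : IsOpen U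
  smul_mem : ∀ (g : G), ∀ x ∈ U, g • x ∈ U
  primitive : ∀ x ∈ U, HasPrimitiveAt H D α x
  inf_eq : ∀ x ∈ U, ∀ ξ : F, α x (inf G x ξ) = -D.ip (D.μ x) ξ
  bound : ∀ x ∈ U, ∀ w : E, |α x w| ≤ C * D.normTan x w

theorem Slice.exists_isMomentPrimitive [CompactSpace G] {z : X} (𝒮 : Slice D z) (hz : D.μ z = 0) :
    ∃ C : ℝ, 0 ≤ C ∧ IsMomentPrimitive (F × 𝒮.S) D (𝒮.tube (𝒮.r / 2)) 𝒮.alpha C := by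
  have hr := 𝒮.r_pos
  obtain ⟨C, hC, hb⟩ := 𝒮.exists_bound hz (r' := 𝒮.r / 2) (by linarith)
  have hsub := 𝒮.tube_mono (r₁ := 𝒮.r / 2) (r₂ := 𝒮.r) (by linarith)
  refine ⟨C, hC, 𝒮.isOpen_tube (by linarith), fun g x hx => 𝒮.smul_mem_tube hx g,
    fun x hx => 𝒮.hasPrimitiveAt_alpha hz (hsub hx), fun x hx => 𝒮.alpha_inf hz (hsub hx), ?_⟩
  rintro x ⟨k, v, hv, rfl⟩ w
  exact (hb k v hv.le w).1

/-- The contributions of the sides `θ = 0` and `θ = 2π` to Stokes' theorem cancel because `c` closes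
up. -/
theorem area_eq_loops {α : X → E →L[ℝ] ℝ} {c : ℝ × ℝ → X} {a b : ℝ} (hab : a < b)
    (hc : ContMDiffOn 𝓘(ℝ, ℝ × ℝ) 𝓘(ℝ, E) ∞ c (cylRect a b))
    (hα : ∀ p ∈ cylRect a b, HasPrimitiveAt H D α (c p))
    (hcl : ∀ s ∈ Icc a b, c (s, 2 * Real.pi) = c (s, 0)) :
    area D c a b =
      (∫ θ in (0 : ℝ)..(2 * Real.pi),
        α (c (b, θ)) (dW (fun θ => c (b, θ)) (Icc 0 (2 * Real.pi)) θ 1))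
      - (∫ θ in (0 : ℝ)..(2 * Real.pi),
        α (c (a, θ)) (dW (fun θ => c (a, θ)) (Icc 0 (2 * Real.pi)) θ 1)) := by
  rw [area_eq_boundary D hab hc hα]
  have h : (∫ s in a..b, α (c (s, 2 * Real.pi)) (dW (fun s => c (s, 2 * Real.pi)) (Icc a b) s 1))
      = ∫ s in a..b, α (c (s, 0)) (dW (fun s => c (s, 0)) (Icc a b) s 1) := by
    refine intervalIntegral.integral_congr fun s hs => ?_
    rw [uIcc_of_le hab.le] at hs
    rw [dW_congr (c := fun s => c (s, 2 * Real.pi)) (c' := fun s => c (s, 0)) hcl hs, hcl s hs]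
  rw [h, sub_self, sub_zero]

/-- The integral of `α` over the covariant derivative of a loop. -/
def loopIntegral (G : Type*) [TopologicalSpace G] [ChartedSpace F G] [Group G] [MulAction G X]
    (α : X → E →L[ℝ] ℝ) (x : ℝ → X) (η : ℝ → F) : ℝ :=
  ∫ θ in (0 : ℝ)..(2 * Real.pi), α (x θ) (curveD G x η θ)

theorem dW_Icc_eq {x : ℝ → X} (hx : ContMDiff 𝓘(ℝ, ℝ) 𝓘(ℝ, E) ∞ x) {θ : ℝ}
    (hθ : θ ∈ Icc (0 : ℝ) (2 * Real.pi)) :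
    dW (E := E) x (Icc 0 (2 * Real.pi)) θ = dW x univ θ :=
  dW_mono ((hx θ).mdifferentiableAt (by simp)).mdifferentiableWithinAt
    (uniqueDiffOn_Icc (by positivity) θ hθ) (subset_univ _)

variable {U : Set X} {α : X → E →L[ℝ] ℝ} {C : ℝ}

/-- The value of `α` on the infinitesimal action supplies exactly the term `⟨μ, η⟩` of the action;
this is what the normalization `α(X_ξ) = -⟨μ, ξ⟩` is for. -/
theorem IsMomentPrimitive.loopIntegral_eq (h : IsMomentPrimitive H D U α C) {x : ℝ → X} {η : ℝ → F}
    (hx : ContMDiff 𝓘(ℝ, ℝ) 𝓘(ℝ, E) ∞ x) (hη : Continuous η)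
    (hU : ∀ θ ∈ Icc (0 : ℝ) (2 * Real.pi), x θ ∈ U) :
    loopIntegral G α x η =
      (∫ θ in (0 : ℝ)..(2 * Real.pi), α (x θ) (dW x (Icc 0 (2 * Real.pi)) θ 1))
        - ∫ θ in (0 : ℝ)..(2 * Real.pi), D.ip (D.μ (x θ)) (η θ) := by
  have hpi : (0 : ℝ) ≤ 2 * Real.pi := by positivity
  have h1 : ContinuousOn (fun θ => α (x θ) (dW x (Icc 0 (2 * Real.pi)) θ 1))
      (Icc 0 (2 * Real.pi)) :=
    continuousOn_pullback_primitive D (uniqueDiffOn_Icc (by positivity)) hx.contMDiffOn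
      (fun θ hθ => h.primitive _ (hU θ hθ)) 1
  have h2 : Continuous fun θ => D.ip (D.μ (x θ)) (η θ) :=
    (D.ip.continuous.comp (D.μ_smooth.continuous.comp hx.continuous)).clm_apply hη
  rw [← intervalIntegral.integral_sub
    (ContinuousOn.intervalIntegrable (by rwa [uIcc_of_le hpi])) (h2.intervalIntegrable _ _)]
  refine intervalIntegral.integral_congr fun θ hθ => ?_
  rw [uIcc_of_le hpi] at hθ
  rw [curveD, map_add, h.inf_eq _ (hU θ hθ), dW_Icc_eq hx hθ, sub_eq_add_neg]

/-- At `θ = 0` the gauge is the unit, so the base point of the loop itself is close to the centre.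
Cappings of one loop, or of neighbouring loops, are compared through this single point. -/
theorem IsCapping.dist_lt {ρ : ℝ} {x : ℝ → X} {c : ℝ × ℝ → X} {z₀ : X} {g : ℝ → G}
    (hc : IsCapping D ρ x c z₀ g) : dist (x 0) z₀ < ρ := by
  have hpi : (0 : ℝ) ≤ 2 * Real.pi := by positivity
  have h := hc.small (2, 0) ⟨⟨by norm_num, le_rfl⟩, le_rfl, hpi⟩
  simp only [hc.gauge_zero, inv_one, one_smul] at h
  rwa [hc.boundary 0 ⟨le_rfl, hpi⟩] at h

theorem IsCapping.mu_centre {ρ : ℝ} {x : ℝ → X} {c : ℝ × ℝ → X} {z₀ : X} {g : ℝ → G}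
    (hc : IsCapping D ρ x c z₀ g) : D.μ z₀ = 0 := by
  have hpi : (0 : ℝ) ≤ 2 * Real.pi := by positivity
  have h := hc.inner_mem (0, 0) ⟨⟨le_rfl, zero_le_one⟩, le_rfl, hpi⟩
  rwa [hc.centre 0 ⟨le_rfl, hpi⟩, hc.gauge_zero, one_smul] at h

/-- A capping is near its centre only after a gauge transformation; invariance of `U` undoes the
gauge. -/
theorem IsMomentPrimitive.capping_mem (h : IsMomentPrimitive H D U α C) {ρ : ℝ} {x : ℝ → X}
    {c : ℝ × ℝ → X} {z₀ : X} {g : ℝ → G} (hc : IsCapping D ρ x c z₀ g)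
    (hU : Metric.ball z₀ ρ ⊆ U) {p : ℝ × ℝ} (hp : p ∈ cylRect 0 2) : c p ∈ U := by
  have h1 := h.smul_mem (g p.2) _ (hU (hc.small p hp))
  rwa [smul_inv_smul] at h1

theorem IsMomentPrimitive.loop_mem (h : IsMomentPrimitive H D U α C) {ρ : ℝ} {x : ℝ → X}
    {c : ℝ × ℝ → X} {z₀ : X} {g : ℝ → G} (hc : IsCapping D ρ x c z₀ g)
    (hU : Metric.ball z₀ ρ ⊆ U) {θ : ℝ} (hθ : θ ∈ Icc (0 : ℝ) (2 * Real.pi)) : x θ ∈ U := by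
  rw [← hc.boundary θ hθ]
  exact h.capping_mem hc hU ⟨⟨by norm_num, le_rfl⟩, hθ⟩

/-- The action on a capping inside the domain of `α` is an integral over the loop. -/
theorem IsMomentPrimitive.cappedAction_eq (h : IsMomentPrimitive H D U α C) {ρ : ℝ} {x : ℝ → X}
    {η : ℝ → F} (hx : ContMDiff 𝓘(ℝ, ℝ) 𝓘(ℝ, E) ∞ x) (hη : Continuous η)
    {c : ℝ × ℝ → X} {z₀ : X} {g : ℝ → G} (hc : IsCapping D ρ x c z₀ g)
    (hU : Metric.ball z₀ ρ ⊆ U) : cappedAction D c x η = -loopIntegral G α x η := by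
  have hpi : (0 : ℝ) ≤ 2 * Real.pi := by positivity
  have hcyl : ∀ a b : ℝ, 0 ≤ a → b ≤ 2 → cylRect a b ⊆ cylRect 0 2 := fun a b ha hb =>
    prod_mono (Icc_subset_Icc ha hb) Subset.rfl
  rw [cappedAction, h.loopIntegral_eq hx hη fun θ hθ => h.loop_mem hc hU hθ,
    area_eq_loops (by norm_num) hc.smooth_inner
      (fun p hp => h.primitive _ (h.capping_mem hc hU (hcyl 0 1 le_rfl (by norm_num) hp)))
      (fun s hs => hc.closed s ⟨hs.1, hs.2.trans (by norm_num)⟩),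
    area_eq_loops (by norm_num) hc.smooth_outer
      (fun p hp => h.primitive _ (h.capping_mem hc hU (hcyl 1 2 (by norm_num) le_rfl hp)))
      (fun s hs => hc.closed s ⟨zero_le_one.trans hs.1, hs.2⟩)]
  have h2 : (∫ θ in (0 : ℝ)..(2 * Real.pi),
      α (c (2, θ)) (dW (fun θ => c (2, θ)) (Icc 0 (2 * Real.pi)) θ 1))
      = ∫ θ in (0 : ℝ)..(2 * Real.pi), α (x θ) (dW x (Icc 0 (2 * Real.pi)) θ 1) := by
    refine intervalIntegral.integral_congr fun θ hθ => ?_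
    rw [uIcc_of_le hpi] at hθ
    rw [dW_congr (c := fun θ => c (2, θ)) (c' := x) hc.boundary hθ, hc.boundary θ hθ]
  -- The blown-up centre runs along an orbit in the zero level, where `α(X_ξ) = -⟨μ, ξ⟩ = 0`.
  have h0 : (∫ θ in (0 : ℝ)..(2 * Real.pi),
      α (c (0, θ)) (dW (fun θ => c (0, θ)) (Icc 0 (2 * Real.pi)) θ 1)) = 0 := by
    refine (intervalIntegral.integral_congr (g := fun _ => (0 : ℝ)) fun θ hθ => ?_).trans
      intervalIntegral.integral_zero
    rw [uIcc_of_le hpi] at hθ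
    have hp : ((0 : ℝ), θ) ∈ cylRect 0 1 := ⟨⟨le_rfl, zero_le_one⟩, hθ⟩
    obtain ⟨ξ, hξ⟩ := exists_inf_eq_of_curve (E := E)
      ((hc.gauge_smooth θ hθ).mdifferentiableWithinAt (by simp))
      (uniqueDiffOn_Icc (by positivity) θ hθ) z₀ 1
    have hm := h.capping_mem hc hU (hcyl 0 1 le_rfl (by norm_num) hp)
    have hμ := hc.inner_mem _ hp
    rw [dW_congr (c := fun θ => c (0, θ)) (c' := fun θ => g θ • z₀) hc.centre hθ, hξ,
      ← hc.centre θ hθ, h.inf_eq _ hm, hμ, map_zero]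
    simp
  rw [h2, h0]
  ring

theorem IsMomentPrimitive.abs_loopIntegral_le (h : IsMomentPrimitive H D U α C) {x : ℝ → X}
    {η : ℝ → F} (hU : ∀ θ ∈ Icc (0 : ℝ) (2 * Real.pi), x θ ∈ U)
    (hcont : Continuous fun θ => D.normTan (x θ) (curveD (E := E) G x η θ)) :
    |loopIntegral G α x η|
      ≤ C * ∫ θ in (0 : ℝ)..(2 * Real.pi), D.normTan (x θ) (curveD (E := E) G x η θ) := by
  have hpi : (0 : ℝ) ≤ 2 * Real.pi := by positivity
  rw [← intervalIntegral.integral_const_mul, loopIntegral, ← Real.norm_eq_abs]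
  have hi : IntervalIntegrable (fun θ => C * D.normTan (x θ) (curveD (E := E) G x η θ)) volume 0
      (2 * Real.pi) := (continuous_const.mul hcont).intervalIntegrable _ _
  refine intervalIntegral.norm_integral_le_of_norm_le hpi ?_ hi
  refine Eventually.of_forall fun θ hθ => ?_
  exact h.bound _ (hU θ ⟨hθ.1.le, hθ.2⟩) _

/-- The zero level is covered by domains of primitives, uniformly. -/
theorem exists_moment_primitives [FiniteDimensional ℝ F] [CompactSpace G] [CompactSpace X]
    (D : HamiltonianSpace F E G X) :
    ∃ ρ₀ : ℝ, 0 < ρ₀ ∧ ∃ C : ℝ, 0 < C ∧ ∀ z : X, D.μ z = 0 → ∃ (S : Submodule ℝ E) (U : Set X)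
      (α : X → E →L[ℝ] ℝ), IsMomentPrimitive (F × S) D U α C ∧ Metric.ball z (3 * ρ₀) ⊆ U := by
  set Z : Set X := {x | D.μ x = 0}
  have hZ : IsCompact Z := (isClosed_singleton.preimage D.μ_smooth.continuous).isCompact
  have h𝒮 : ∀ z : Z, Nonempty (Slice D (z : X)) := fun z => nonempty_slice D z.2
  let 𝒮 : ∀ z : Z, Slice D (z : X) := fun z => (h𝒮 z).some
  choose C hC hprim using fun z : Z => (𝒮 z).exists_isMomentPrimitive z.2
  obtain ⟨t, ht⟩ := hZ.elim_finite_subcover (fun z : Z => (𝒮 z).tube ((𝒮 z).r / 2))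
    (fun z => (hprim z).isOpen)
    (fun z hz => mem_iUnion.2 ⟨⟨z, hz⟩, (𝒮 ⟨z, hz⟩).mem_tube_self (half_pos (𝒮 ⟨z, hz⟩).r_pos)⟩)
  -- A third of the Lebesgue number is taken since balls of radius `3 ρ₀` must fit into one tube.
  -- The summand 1 makes the common constant positive, as it will be a divisor.
  obtain ⟨δ, hδ, hleb⟩ := lebesgue_number_lemma_of_metric hZ
    (c := fun z : t => (𝒮 z).tube ((𝒮 z).r / 2)) (fun z => (hprim z).isOpen)
    (by rwa [iUnion_subtype])
  refine ⟨δ / 3, by positivity, 1 + ∑ z ∈ t, C z, ?_, fun z hz => ?_⟩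
  · have : 0 ≤ ∑ z ∈ t, C z := Finset.sum_nonneg fun z _ => hC z
    linarith
  · obtain ⟨i, hi⟩ := hleb z hz
    have h := hprim i
    refine ⟨(𝒮 i).S, _, (𝒮 i).alpha, ⟨h.isOpen, h.smul_mem, h.primitive, h.inf_eq,
      fun x hx w => (h.bound x hx w).trans ?_⟩, by rwa [mul_div_cancel₀ _ (by norm_num)]⟩
    refine mul_le_mul_of_nonneg_right ?_ (normTan_nonneg D x w)
    have := Finset.single_le_sum (f := C) (fun z _ => hC z) i.2
    linarith

end Action
end SympVortex

namespace SympVortex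

/-! ### Integration on the half-cylinder. -/

section HalfCylinder

theorem uniqueDiffOn_halfCyl (t₀ : ℝ) : UniqueDiffOn ℝ (halfCyl t₀) :=
  (uniqueDiffOn_Ici t₀).prod uniqueDiffOn_univ

theorem cylRect_subset_halfCyl {t₀ t₁ : ℝ} (h : t₀ ≤ t₁) (t₂ : ℝ) : cylRect t₁ t₂ ⊆ halfCyl t₀ :=
  fun _ hp => ⟨h.trans hp.1.1, mem_univ _⟩

theorem integral_fderivWithin_halfCyl {h : ℝ × ℝ → ℝ} {t₀ t₁ t₂ : ℝ}
    (hh : ContDiffOn ℝ ∞ h (halfCyl t₀)) (h₁ : t₀ ≤ t₁) (h₂ : t₁ ≤ t₂) :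
    ∫ p in cylRect t₁ t₂, fderivWithin ℝ h (halfCyl t₀) p (1, 0)
      = (∫ θ in (0 : ℝ)..(2 * Real.pi), h (t₂, θ)) - ∫ θ in (0 : ℝ)..(2 * Real.pi), h (t₁, θ) := by
  have hpi : (0 : ℝ) ≤ 2 * Real.pi := by positivity
  have hQI : cylRect t₁ t₂ = Icc (t₁, (0 : ℝ)) (t₂, 2 * Real.pi) := by
    rw [cylRect, Icc_prod_eq]
  have hsub := cylRect_subset_halfCyl h₁ t₂
  have hcont : ContinuousOn (fun p => fderivWithin ℝ h (halfCyl t₀) p (1, 0)) (cylRect t₁ t₂) :=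
    ((hh.continuousOn_fderivWithin (uniqueDiffOn_halfCyl t₀) (by simp)).mono hsub).clm_apply
      continuousOn_const
  have key := integral_divergence_prod_Icc_of_hasFDerivAt_of_le h (fun _ => 0)
    (fderivWithin ℝ h (halfCyl t₀)) (fun _ => 0) (t₁, 0) (t₂, 2 * Real.pi) ⟨h₂, hpi⟩
    (by rw [← hQI]; exact hh.continuousOn.mono hsub) continuousOn_const
    (fun p hp => by
      have hp' : halfCyl t₀ ∈ 𝓝 p :=
        prod_mem_nhds (Ici_mem_nhds (h₁.trans_lt hp.1.1)) univ_mem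
      exact (((hh p (mem_of_mem_nhds hp')).differentiableWithinAt
        (by simp)).hasFDerivWithinAt).hasFDerivAt hp')
    (fun p _ => hasFDerivAt_const _ _)
    (by
      simp only [zero_apply, add_zero, ← hQI]
      exact hcont.integrableOn_compact (isCompact_cylRect t₁ t₂))
  simp only [zero_apply, add_zero, zero_add, ← hQI, intervalIntegral.integral_zero, sub_zero] at key
  exact key

end HalfCylinder

/-! ### The energy density of a temporal vortex. -/

section Vortex

variable {F : Type*} [NormedAddCommGroup F] [NormedSpace ℝ F] [FiniteDimensional ℝ F]
  {E : Type*} [NormedAddCommGroup E] [NormedSpace ℝ E] [FiniteDimensional ℝ E]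
  {G : Type*} [TopologicalSpace G] [ChartedSpace F G] [Group G] [LieGroup 𝓘(ℝ, F) ∞ G]
  {X : Type*} [TopologicalSpace X] [ChartedSpace E X] [IsManifold 𝓘(ℝ, E) ∞ X]
  [MulAction G X] [ContMDiffSMul 𝓘(ℝ, F) 𝓘(ℝ, E) ∞ G X]
  {D : HamiltonianSpace F E G X}

theorem normTan_sq (D : HamiltonianSpace F E G X) (x : X) (v : E) :
    D.normTan x v ^ 2 = D.om x v (D.cx x v) := by
  refine Real.sq_sqrt ?_
  rcases eq_or_ne v 0 with rfl | hv
  · exact (D.omega_alt x 0 ▸ le_of_eq (by simp) : (0 : ℝ) ≤ D.om x 0 (D.cx x 0))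
  · exact (om_cx_pos D x hv).le

theorem normLie_sq (D : HamiltonianSpace F E G X) (ξ : F) : D.normLie ξ ^ 2 = D.ip ξ ξ := by
  refine Real.sq_sqrt ?_
  rcases eq_or_ne ξ 0 with rfl | hv
  · simp
  · exact (D.ip_pos ξ hv).le

theorem lieBr_zero_left (ζ : F) : lieBr G (0 : F) ζ = 0 := by
  have : CompleteSpace F := FiniteDimensional.complete ℝ F
  have : LieGroup 𝓘(ℝ, F) (minSmoothness ℝ 3) G := LieGroup.of_le (n := ∞) (by simp; norm_cast)
  exact zero_lie (L := GroupLieAlgebra 𝓘(ℝ, F) G) (M := GroupLieAlgebra 𝓘(ℝ, F) G) ζ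

variable {t₀ : ℝ} {lam : ℝ × ℝ → ℝ} {u : ℝ × ℝ → X} {η : ℝ × ℝ → F}

variable (G) in
/-- The covariant derivative `∂_θ u + X_η(u)` as a vector of the model space. -/
def covTheta (t₀ : ℝ) (u : ℝ × ℝ → X) (η : ℝ × ℝ → F) (p : ℝ × ℝ) : E :=
  dW u (halfCyl t₀) p (0, 1) + inf G (u p) (η p)

theorem contMDiff_slice (hu : ContMDiffOn 𝓘(ℝ, ℝ × ℝ) 𝓘(ℝ, E) ∞ u (halfCyl t₀)) {t : ℝ}
    (ht : t₀ ≤ t) : ContMDiff 𝓘(ℝ, ℝ) 𝓘(ℝ, E) ∞ (fun θ => u (t, θ)) := by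
  rw [← contMDiffOn_univ]
  exact hu.comp (f := fun θ : ℝ => (t, θ)) (contDiff_prodMk_right t).contMDiff.contMDiffOn
    fun θ _ => ⟨ht, mem_univ _⟩

theorem curveD_slice (hu : ContMDiffOn 𝓘(ℝ, ℝ × ℝ) 𝓘(ℝ, E) ∞ u (halfCyl t₀)) {t : ℝ}
    (ht : t₀ ≤ t) (θ : ℝ) : curveD (E := E) G (fun θ => u (t, θ)) (fun θ => η (t, θ)) θ
      = covTheta G t₀ u η (t, θ) := by
  have hj : HasFDerivAt (fun θ : ℝ => (t, θ)) (ContinuousLinearMap.inr ℝ ℝ ℝ) θ :=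
    hasFDerivAt_prodMk_right t θ
  have h := dW_comp (E := E) (j := fun θ : ℝ => (t, θ)) (Q := halfCyl t₀) (Q' := univ) (n := θ)
    ((hu (t, θ) ⟨ht, mem_univ _⟩).mdifferentiableWithinAt (by simp))
    hj.hasFDerivWithinAt.differentiableWithinAt (fun τ _ => ⟨ht, mem_univ _⟩)
    uniqueDiffWithinAt_univ 1
  rw [fderivWithin_univ, hj.fderiv] at h
  have h' : dW (E := E) (fun θ => u (t, θ)) univ θ 1 = dW u (halfCyl t₀) (t, θ) (0, 1) := by
    rw [h]; simp
  rw [curveD, h', covTheta]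

namespace IsTemporalVortex

variable {p : ℝ × ℝ}

theorem fderivWithin_eta (hv : IsTemporalVortex D t₀ lam u η) (hp : p ∈ halfCyl t₀) :
    fderivWithin ℝ η (halfCyl t₀) p (1, 0) = -(lam p • D.μ (u p)) := by
  have h := hv.curvature p hp
  rw [curv, lieBr_zero_left] at h
  simp only [fderivWithin_fun_const, Pi.zero_apply, zero_apply, sub_zero, add_zero] at h
  exact eq_neg_of_add_eq_zero_left h

theorem dW_t_eq (hv : IsTemporalVortex D t₀ lam u η) (hp : p ∈ halfCyl t₀) :
    dW (E := E) u (halfCyl t₀) p (1, 0)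
      = -D.cx (u p) (covTheta (E := E) G t₀ u η p) := by
  have h : (dW (E := E) u (halfCyl t₀) p (1, 0) + inf (F := F) (E := E) G (u p) 0)
      + D.cx (u p) (covTheta (E := E) G t₀ u η p) = 0 := hv.holomorphic p hp
  rw [map_zero, add_zero] at h
  exact eq_neg_of_add_eq_zero_left h

theorem fderivWithin_mu (hv : IsTemporalVortex D t₀ lam u η) (hp : p ∈ halfCyl t₀) (v : ℝ × ℝ) :
    fderivWithin ℝ (fun p => D.μ (u p)) (halfCyl t₀) p v
      = dX (E := E) D.μ (u p) (dW u (halfCyl t₀) p v) :=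
  fderivWithin_comp_eq (D.μ_smooth.mdifferentiableAt (by simp))
    ((hv.u_smooth p hp).mdifferentiableWithinAt (by simp)) (uniqueDiffOn_halfCyl t₀ p hp) v

theorem contDiffOn_mu (hv : IsTemporalVortex D t₀ lam u η) :
    ContDiffOn ℝ ∞ (fun p => D.μ (u p)) (halfCyl t₀) :=
  contMDiffOn_iff_contDiffOn.1 (D.μ_smooth.comp_contMDiffOn hv.u_smooth)

theorem contDiffOn_pairing (hv : IsTemporalVortex D t₀ lam u η) :
    ContDiffOn ℝ ∞ (fun p => D.ip (D.μ (u p)) (η p)) (halfCyl t₀) :=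
  (D.ip.contDiff.comp_contDiffOn hv.contDiffOn_mu).clm_apply hv.a₂_smooth

/-- Put `v = ∂_θ u + X_η`. The first vortex equation `∂_t u = -J v` gives `ω(∂_t u, v) = |v|²`, and
the moment map equation gives `ω(∂_t u, X_η) = -⟨∂_t μ(u), η⟩`. -/
theorem normTan_sq_eq (hv : IsTemporalVortex D t₀ lam u η) (hp : p ∈ halfCyl t₀) :
    D.normTan (u p) (covTheta (E := E) G t₀ u η p) ^ 2
      = D.om (u p) (dW u (halfCyl t₀) p (1, 0)) (dW u (halfCyl t₀) p (0, 1))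
        - D.ip (fderivWithin ℝ (fun p => D.μ (u p)) (halfCyl t₀) p (1, 0)) (η p) := by
  rw [normTan_sq, hv.fderivWithin_mu hp, ← ham D, om_skew D _ (inf G (u p) (η p)), sub_neg_eq_add,
    ← map_add, ← covTheta, hv.dW_t_eq hp, map_neg, neg_apply, om_skew D]

/-- Read off from the formula for the square, whose terms are a continuous pull-back of `ω` and a
derivative of a map between vector spaces. -/
theorem continuousOn_normTan (hv : IsTemporalVortex D t₀ lam u η) :
    ContinuousOn (fun p => D.normTan (u p) (covTheta (E := E) G t₀ u η p)) (halfCyl t₀) := by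
  have h1 : ContinuousOn (fun p =>
      D.om (u p) (dW u (halfCyl t₀) p (1, 0)) (dW u (halfCyl t₀) p (0, 1))
        - D.ip (fderivWithin ℝ (fun p => D.μ (u p)) (halfCyl t₀) p (1, 0)) (η p)) (halfCyl t₀) := by
    refine (continuousOn_pullback_om D (uniqueDiffOn_halfCyl t₀) hv.u_smooth _ _).sub ?_
    have h2 := hv.contDiffOn_mu.continuousOn_fderivWithin (uniqueDiffOn_halfCyl t₀) (by simp)
    exact (D.ip.continuous.comp_continuousOn (h2.clm_apply continuousOn_const)).clm_apply
      hv.a₂_smooth.continuousOn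
  refine (Real.continuous_sqrt.comp_continuousOn h1).congr fun p hp => ?_
  simp only [Function.comp_apply]
  rw [← hv.normTan_sq_eq hp]
  exact (Real.sqrt_sq (normTan_nonneg D _ _)).symm

/-- As `J` is an isometry, the two components of `d_A u` have equal norm, and by the curvature
equation `|F_A|_h = |μ(u)|`, so both factors 1/2 disappear. The term with `d_A u` is conformally
invariant, so `lam` survives only in front of `|μ|²`. -/
theorem energyDensity_mul_eq (hv : IsTemporalVortex D t₀ lam u η) (hl : IsConformalFactor t₀ lam)
    (hp : p ∈ halfCyl t₀) :
    energyDensity D t₀ lam u (fun _ => 0) η p * lam p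
      = D.normTan (u p) (covTheta (E := E) G t₀ u η p) ^ 2 + lam p * D.ip (D.μ (u p)) (D.μ (u p)) := by
  have hpos := hl.pos p hp
  have h1 : curv G t₀ (fun _ => 0) η p = -(lam p • D.μ (u p)) :=
    eq_neg_of_add_eq_zero_left (hv.curvature p hp)
  have h2 : D.normTan (u p) (covDeriv G t₀ u (fun _ => (0 : F)) (1, 0) p) ^ 2
      = D.normTan (u p) (covTheta (E := E) G t₀ u η p) ^ 2 := by
    have h3 : (covDeriv G t₀ u (fun _ => (0 : F)) (1, 0) p : E)
        = -D.cx (u p) (covTheta (E := E) G t₀ u η p) :=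
      eq_neg_of_add_eq_zero_left (hv.holomorphic p hp)
    refine (congrArg (fun w : E => D.normTan (u p) w ^ 2) h3).trans ?_
    rw [normTan_sq, normTan_sq, map_neg (D.cx (u p)), cx_cx, neg_neg, map_neg, neg_apply, ← om_skew D]
  have h4 : energyDensity D t₀ lam u (fun _ => 0) η p = (1 / 2) *
      ((lam p)⁻¹ * (D.normTan (u p) (covDeriv G t₀ u (fun _ => (0 : F)) (1, 0) p) ^ 2
        + D.normTan (u p) (covTheta (E := E) G t₀ u η p) ^ 2)
      + (lam p)⁻¹ ^ 2 * D.normLie (curv G t₀ (fun _ => 0) η p) ^ 2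
      + D.normLie (D.μ (u p)) ^ 2) := rfl
  rw [h4, h1, h2, normLie_sq, normLie_sq]
  simp only [map_neg, map_smul, neg_apply, smul_apply, smul_eq_mul]
  field_simp
  ring

/-- By the second vortex equation `lam |μ|² = -⟨μ, ∂_t η⟩`, which completes `-⟨∂_t μ, η⟩` to a total
derivative; the conformal factor disappears. -/
theorem energyDensity_mul_eq_sub (hv : IsTemporalVortex D t₀ lam u η)
    (hl : IsConformalFactor t₀ lam) (hp : p ∈ halfCyl t₀) :
    energyDensity D t₀ lam u (fun _ => 0) η p * lam p
      = D.om (u p) (dW u (halfCyl t₀) p (1, 0)) (dW u (halfCyl t₀) p (0, 1))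
        - fderivWithin ℝ (fun p => D.ip (D.μ (u p)) (η p)) (halfCyl t₀) p (1, 0) := by
  have hu := uniqueDiffOn_halfCyl t₀ p hp
  have hμ : DifferentiableWithinAt ℝ (fun p => D.μ (u p)) (halfCyl t₀) p :=
    (hv.contDiffOn_mu p hp).differentiableWithinAt (by simp)
  have hη : DifferentiableWithinAt ℝ η (halfCyl t₀) p :=
    (hv.a₂_smooth p hp).differentiableWithinAt (by simp)
  have h1 : HasFDerivWithinAt (fun p => D.ip (D.μ (u p)))
      (D.ip.comp (fderivWithin ℝ (fun p => D.μ (u p)) (halfCyl t₀) p)) (halfCyl t₀) p :=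
    D.ip.hasFDerivAt.comp_hasFDerivWithinAt p hμ.hasFDerivWithinAt
  have h2 := (h1.clm_apply hη.hasFDerivWithinAt).fderivWithin hu
  rw [h2, hv.energyDensity_mul_eq hl hp, hv.normTan_sq_eq hp]
  simp only [add_apply, ContinuousLinearMap.comp_apply, ContinuousLinearMap.flip_apply]
  rw [hv.fderivWithin_eta hp, map_neg, map_smul, smul_eq_mul]
  ring

theorem continuousOn_energyDensity_mul (hv : IsTemporalVortex D t₀ lam u η)
    (hl : IsConformalFactor t₀ lam) :
    ContinuousOn (fun p => energyDensity D t₀ lam u (fun _ => 0) η p * lam p) (halfCyl t₀) := by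
  have h : ContinuousOn (fun p =>
      D.normTan (u p) (covTheta (E := E) G t₀ u η p) ^ 2 + lam p * D.ip (D.μ (u p)) (D.μ (u p)))
      (halfCyl t₀) :=
    (hv.continuousOn_normTan.pow 2).add (hl.smooth.continuousOn.mul
      ((D.ip.continuous.comp_continuousOn hv.contDiffOn_mu.continuousOn).clm_apply
        hv.contDiffOn_mu.continuousOn))
  exact h.congr fun p hp => hv.energyDensity_mul_eq hl hp

theorem integrableOn_energyDensity (hv : IsTemporalVortex D t₀ lam u η)
    (hl : IsConformalFactor t₀ lam) {t₁ : ℝ} (h₁ : t₀ ≤ t₁) (t₂ : ℝ) :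
    IntegrableOn (fun p => energyDensity D t₀ lam u (fun _ => 0) η p * lam p) (cylRect t₁ t₂) :=
  ((hv.continuousOn_energyDensity_mul hl).mono
    (cylRect_subset_halfCyl h₁ t₂)).integrableOn_compact (isCompact_cylRect t₁ t₂)

theorem energy_eq_area (hv : IsTemporalVortex D t₀ lam u η) (hl : IsConformalFactor t₀ lam)
    {t₁ t₂ : ℝ} (h₁ : t₀ ≤ t₁) (h₂ : t₁ < t₂) :
    energy D t₀ lam u η t₁ t₂ = area D u t₁ t₂
      - ((∫ θ in (0 : ℝ)..(2 * Real.pi), D.ip (D.μ (u (t₂, θ))) (η (t₂, θ)))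
        - ∫ θ in (0 : ℝ)..(2 * Real.pi), D.ip (D.μ (u (t₁, θ))) (η (t₁, θ))) := by
  have hsub := cylRect_subset_halfCyl h₁ t₂
  have hmeas : MeasurableSet (cylRect t₁ t₂) := (isCompact_cylRect t₁ t₂).measurableSet
  have hW : ContinuousOn (fun p =>
      D.om (u p) (dW u (halfCyl t₀) p (1, 0)) (dW u (halfCyl t₀) p (0, 1))) (cylRect t₁ t₂) :=
    (continuousOn_pullback_om D (uniqueDiffOn_halfCyl t₀) hv.u_smooth _ _).mono hsub
  have hd : ContinuousOn (fun p =>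
      fderivWithin ℝ (fun p => D.ip (D.μ (u p)) (η p)) (halfCyl t₀) p (1, 0)) (cylRect t₁ t₂) :=
    ((hv.contDiffOn_pairing.continuousOn_fderivWithin (uniqueDiffOn_halfCyl t₀) (by simp)).mono
      hsub).clm_apply continuousOn_const
  rw [← integral_fderivWithin_halfCyl hv.contDiffOn_pairing h₁ h₂.le, energy,
    setIntegral_congr_fun hmeas fun p hp => hv.energyDensity_mul_eq_sub hl (hsub hp),
    integral_sub (hW.integrableOn_compact (isCompact_cylRect t₁ t₂))
      (hd.integrableOn_compact (isCompact_cylRect t₁ t₂))]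
  congr 1
  refine setIntegral_congr_fun hmeas fun p hp => ?_
  -- `area` differentiates within the rectangle and the density within the half-cylinder. The
  -- derivatives agree because `t₁ < t₂` makes the rectangle a set of unique differentiability.
  have h := dW_mono (E := E) ((hv.u_smooth p (hsub hp)).mdifferentiableWithinAt (by simp))
    (uniqueDiffOn_cylRect h₂ p hp) hsub
  rw [← h]
  rfl

end IsTemporalVortex
end Vortex
end SympVortex

namespace SympVortex

/-! ### The local action: uniqueness, energy identity and limit. -/

section LocalActionTheory

variable {F : Type*} [NormedAddCommGroup F] [NormedSpace ℝ F] [FiniteDimensional ℝ F]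
  {E : Type*} [NormedAddCommGroup E] [NormedSpace ℝ E] [FiniteDimensional ℝ E]
  {G : Type*} [TopologicalSpace G] [ChartedSpace F G] [Group G] [LieGroup 𝓘(ℝ, F) ∞ G]
  {X : Type*} [MetricSpace X] [ChartedSpace E X] [IsManifold 𝓘(ℝ, E) ∞ X]
  [MulAction G X] [ContMDiffSMul 𝓘(ℝ, F) 𝓘(ℝ, E) ∞ G X]
  {H : Type*} [NormedAddCommGroup H] [NormedSpace ℝ H]
  {D : HamiltonianSpace F E G X} {ρ₀ ρ C : ℝ}

/-- Every ball of radius `3 ρ₀` about a point of the zero level is in the domain of a primitive. -/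
def HasPrimitives (D : HamiltonianSpace F E G X) (ρ₀ C : ℝ) : Prop :=
  ∀ z : X, D.μ z = 0 → ∃ (S : Submodule ℝ E) (U : Set X) (α : X → E →L[ℝ] ℝ),
    IsMomentPrimitive (F × S) D U α C ∧ Metric.ball z (3 * ρ₀) ⊆ U

/-- Three steps of length less than `ρ`, from `w` to `z'`, to `y` and to `z`, account for the factor
3. -/
theorem ball_subset_of_dist_lt {y z z' : X} (hρ : ρ ≤ ρ₀) (h : dist y z < ρ) (h' : dist y z' < ρ) :
    Metric.ball z' ρ ⊆ Metric.ball z (3 * ρ₀) := by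
  intro w hw
  rw [Metric.mem_ball] at hw ⊢
  have h1 := dist_triangle w z' z
  have h2 := dist_triangle_left z' z y
  linarith

/-- The action does not depend on the choice of a small capping. -/
theorem cappedAction_unique (hcov : HasPrimitives D ρ₀ C) (hρ : ρ ≤ ρ₀) {x : ℝ → X} {η : ℝ → F}
    (hx : ContMDiff 𝓘(ℝ, ℝ) 𝓘(ℝ, E) ∞ x) (hη : Continuous η)
    {c c' : ℝ × ℝ → X} {z z' : X} {g g' : ℝ → G} (hc : IsCapping D ρ x c z g)
    (hc' : IsCapping D ρ x c' z' g') : cappedAction D c x η = cappedAction D c' x η := by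
  obtain ⟨S, U, α, hα, hU⟩ := hcov z hc.mu_centre
  rw [hα.cappedAction_eq hx hη hc
      ((ball_subset_of_dist_lt hρ hc.dist_lt hc.dist_lt).trans hU),
    hα.cappedAction_eq hx hη hc' ((ball_subset_of_dist_lt hρ hc.dist_lt hc'.dist_lt).trans hU)]

theorem existsUnique_action (hcov : HasPrimitives D ρ₀ C) (hρ : ρ ≤ ρ₀) {x : ℝ → X} {η : ℝ → F}
    (hx : ContMDiff 𝓘(ℝ, ℝ) 𝓘(ℝ, E) ∞ x) (hη : Continuous η)
    (hcap : ∃ (c : ℝ × ℝ → X) (z₀ : X) (g : ℝ → G), IsCapping D ρ x c z₀ g) :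
    ∃! a : ℝ, a ∈ actionValues D ρ x η := by
  obtain ⟨c, z, g, hc⟩ := hcap
  refine ⟨_, ⟨c, z, g, hc, rfl⟩, ?_⟩
  rintro a ⟨c', z', g', hc', rfl⟩
  exact cappedAction_unique hcov hρ hx hη hc' hc

variable {t₀ : ℝ} {lam : ℝ × ℝ → ℝ} {u : ℝ × ℝ → X} {η : ℝ × ℝ → F}

theorem localAction_eq_cappedAction (hcov : HasPrimitives D ρ₀ C) (hρ : ρ ≤ ρ₀) {t : ℝ}
    (hx : ContMDiff 𝓘(ℝ, ℝ) 𝓘(ℝ, E) ∞ fun θ => u (t, θ)) (hη : Continuous fun θ => η (t, θ))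
    {c : ℝ × ℝ → X} {z : X} {g : ℝ → G} (hc : IsCapping D ρ (fun θ => u (t, θ)) c z g) :
    localAction D ρ u η t = cappedAction D c (fun θ => u (t, θ)) (fun θ => η (t, θ)) := by
  obtain ⟨c', z', g', hc', h⟩ := Classical.epsilon_spec
    (p := fun a => a ∈ actionValues D ρ (fun θ => u (t, θ)) (fun θ => η (t, θ)))
    ⟨_, c, z, g, hc, rfl⟩
  exact h.trans (cappedAction_unique hcov hρ hx hη hc' hc)

theorem continuous_slice (hη : ContDiffOn ℝ ∞ η (halfCyl t₀)) {t : ℝ} (ht : t₀ ≤ t) :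
    Continuous fun θ => η (t, θ) := by
  rw [← continuousOn_univ]
  exact hη.continuousOn.comp (f := fun θ : ℝ => (t, θ)) (by fun_prop) fun θ _ => ⟨ht, mem_univ _⟩

/-- Near every parameter the local action is the integral of one primitive. -/
theorem exists_local_primitive (hcov : HasPrimitives D ρ₀ C) (hρ : ρ ≤ ρ₀)
    (hv : IsTemporalVortex D t₀ lam u η)
    (hcap : ∀ t : ℝ, t₀ ≤ t → ∃ (c : ℝ × ℝ → X) (z₀ : X) (g : ℝ → G),
      IsCapping D ρ (fun θ => u (t, θ)) c z₀ g) {s : ℝ} (hs : t₀ ≤ s) :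
    ∃ (S : Submodule ℝ E) (U : Set X) (α : X → E →L[ℝ] ℝ), IsMomentPrimitive (F × S) D U α C ∧
      ∀ᶠ t in 𝓝 s, t₀ ≤ t → (∀ θ ∈ Icc (0 : ℝ) (2 * Real.pi), u (t, θ) ∈ U) ∧
        localAction D ρ u η t = -loopIntegral G α (fun θ => u (t, θ)) (fun θ => η (t, θ)) := by
  obtain ⟨c, z, g, hc⟩ := hcap s hs
  obtain ⟨S, U, α, hα, hU⟩ := hcov z hc.mu_centre
  refine ⟨S, U, α, hα, ?_⟩
  have hcont : ContinuousWithinAt (fun t => dist (u (t, 0)) z) (Ici t₀) s := by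
    have h1 : ContinuousOn (fun t : ℝ => u (t, 0)) (Ici t₀) :=
      hv.u_smooth.continuousOn.comp (f := fun t : ℝ => (t, (0 : ℝ))) (by fun_prop)
        fun t ht => ⟨ht, mem_univ _⟩
    exact (h1 s hs).dist continuousWithinAt_const
  -- The base points `u (t, 0)` stay within `ρ` of the centre `z` for `t` near `s`. Any capping at
  -- such a `t` therefore lies in the same domain `U`, without any continuity of the cappings in
  -- `t`.
  have hev := eventually_nhdsWithin_iff.1 (hcont.eventually (gt_mem_nhds hc.dist_lt))
  filter_upwards [hev] with t ht htt
  obtain ⟨c', z', g', hc'⟩ := hcap t htt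
  have hx := contMDiff_slice hv.u_smooth htt
  have hη := continuous_slice hv.a₂_smooth htt
  have hball := (ball_subset_of_dist_lt hρ (ht htt) hc'.dist_lt).trans hU
  refine ⟨fun θ hθ => hα.loop_mem hc' hball hθ, ?_⟩
  rw [localAction_eq_cappedAction hcov hρ hx hη hc', hα.cappedAction_eq hx hη hc' hball]

theorem continuous_normTan_slice (hv : IsTemporalVortex D t₀ lam u η) {t : ℝ} (ht : t₀ ≤ t) :
    Continuous fun θ => D.normTan (u (t, θ)) (covTheta (E := E) G t₀ u η (t, θ)) := by
  rw [← continuousOn_univ]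
  exact hv.continuousOn_normTan.comp (f := fun θ : ℝ => (t, θ)) (by fun_prop)
    fun θ _ => ⟨ht, mem_univ _⟩

theorem abs_localAction_le (hcov : HasPrimitives D ρ₀ C) (hρ : ρ ≤ ρ₀)
    (hv : IsTemporalVortex D t₀ lam u η)
    (hcap : ∀ t : ℝ, t₀ ≤ t → ∃ (c : ℝ × ℝ → X) (z₀ : X) (g : ℝ → G),
      IsCapping D ρ (fun θ => u (t, θ)) c z₀ g) {t : ℝ} (ht : t₀ ≤ t) :
    |localAction D ρ u η t| ≤ C * ∫ θ in (0 : ℝ)..(2 * Real.pi),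
      D.normTan (u (t, θ)) (covTheta (E := E) G t₀ u η (t, θ)) := by
  obtain ⟨S, U, α, hα, hev⟩ := exists_local_primitive hcov hρ hv hcap ht
  obtain ⟨hU, hL⟩ := hev.self_of_nhds ht
  have h1 := fun θ => curveD_slice (G := G) (η := η) hv.u_smooth ht θ
  have h := hα.abs_loopIntegral_le (x := fun θ => u (t, θ)) (η := fun θ => η (t, θ)) hU (by
    simp only [h1]
    exact continuous_normTan_slice hv ht)
  simp only [h1] at h
  rwa [hL, abs_neg]

/-- Stokes' theorem is applied to `u` itself, and its boundary terms combine with the difference of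
the integrals of `⟨μ, η⟩` to loop integrals. -/
theorem energy_eq_of_primitive {U : Set X} {α : X → E →L[ℝ] ℝ} (hα : IsMomentPrimitive H D U α C)
    (hv : IsTemporalVortex D t₀ lam u η) (hl : IsConformalFactor t₀ lam) {a b : ℝ} (ha : t₀ ≤ a)
    (hab : a < b) (hU : ∀ t ∈ Icc a b, ∀ θ ∈ Icc (0 : ℝ) (2 * Real.pi), u (t, θ) ∈ U) :
    energy D t₀ lam u η a b = loopIntegral G α (fun θ => u (b, θ)) (fun θ => η (b, θ))
      - loopIntegral G α (fun θ => u (a, θ)) (fun θ => η (a, θ)) := by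
  have hb := ha.trans hab.le
  rw [hv.energy_eq_area hl ha hab,
    hα.loopIntegral_eq (contMDiff_slice hv.u_smooth hb) (continuous_slice hv.a₂_smooth hb)
      (hU b (right_mem_Icc.2 hab.le)),
    hα.loopIntegral_eq (contMDiff_slice hv.u_smooth ha) (continuous_slice hv.a₂_smooth ha)
      (hU a (left_mem_Icc.2 hab.le)),
    area_eq_loops hab (hv.u_smooth.mono (cylRect_subset_halfCyl ha b))
      (fun p hp => hα.primitive _ (hU p.1 hp.1 p.2 hp.2))
      (fun s hs => by simpa using hv.u_periodic s 0 (ha.trans hs.1))]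
  ring

theorem energy_self (a : ℝ) : energy D t₀ lam u η a a = 0 := by
  refine setIntegral_measure_zero _ ?_
  rw [cylRect, Icc_self, Measure.volume_eq_prod, Measure.prod_prod, Real.volume_singleton, zero_mul]

theorem energy_add (hv : IsTemporalVortex D t₀ lam u η) (hl : IsConformalFactor t₀ lam) {a b c : ℝ}
    (ha : t₀ ≤ a) (hab : a ≤ b) (hbc : b ≤ c) :
    energy D t₀ lam u η a c = energy D t₀ lam u η a b + energy D t₀ lam u η b c := by
  have hunion : cylRect a c = cylRect a b ∪ cylRect b c := by
    rw [cylRect, cylRect, cylRect, ← union_prod, Icc_union_Icc_eq_Icc hab hbc]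
  have hdisj : AEDisjoint volume (cylRect a b) (cylRect b c) := by
    have h1 : cylRect a b ∩ cylRect b c ⊆ ({b} : Set ℝ) ×ˢ Icc 0 (2 * Real.pi) := by
      rintro p ⟨h1, h2⟩
      exact ⟨le_antisymm h1.1.2 h2.1.1, h1.2⟩
    refine measure_mono_null h1 ?_
    rw [Measure.volume_eq_prod, Measure.prod_prod, Real.volume_singleton, zero_mul]
  rw [energy, hunion, setIntegral_union₀ hdisj
    (isCompact_cylRect b c).measurableSet.nullMeasurableSet
    (hv.integrableOn_energyDensity hl ha b) (hv.integrableOn_energyDensity hl (ha.trans hab) c)]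
  rfl

/-- The energy is the decrease of the local action. -/
theorem energy_eq_sub (hcov : HasPrimitives D ρ₀ C) (hρ : ρ ≤ ρ₀)
    (hv : IsTemporalVortex D t₀ lam u η) (hl : IsConformalFactor t₀ lam)
    (hcap : ∀ t : ℝ, t₀ ≤ t → ∃ (c : ℝ × ℝ → X) (z₀ : X) (g : ℝ → G),
      IsCapping D ρ (fun θ => u (t, θ)) c z₀ g) {a b : ℝ} (ha : t₀ ≤ a) (hab : a ≤ b) :
    energy D t₀ lam u η a b = localAction D ρ u η a - localAction D ρ u η b := by
  choose S U α hα hev using fun s : Icc a b =>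
    exists_local_primitive hcov hρ hv hcap (s := s) (ha.trans s.2.1)
  choose V hV hVo hVmem using fun s => mem_nhds_iff.1 (hev s)
  -- The primitive may have to change with `t`. The interval is cut into pieces with one primitive
  -- each; the local action does not depend on the primitive, so the identities telescope.
  obtain ⟨τ, hτ0, hτm, ⟨m, hm⟩, hτs⟩ := exists_monotone_Icc_subset_open_cover_Icc hab
    (c := fun s : Icc a b => Subtype.val ⁻¹' V s)
    (fun s => (hVo s).preimage continuous_subtype_val)
    (fun s _ => mem_iUnion.2 ⟨s, hVmem s⟩)
  have key : ∀ n : ℕ, energy D t₀ lam u η a (τ n)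
      = localAction D ρ u η a - localAction D ρ u η (τ n) := by
    intro n
    induction n with
    | zero => rw [hτ0, energy_self, sub_self]
    | succ n ih =>
      obtain ⟨i, hi⟩ := hτs n
      have hle : (τ n : ℝ) ≤ τ (n + 1) := hτm n.le_succ
      have hn : t₀ ≤ τ n := ha.trans (τ n).2.1
      have hdat : ∀ t ∈ Icc (τ n : ℝ) (τ (n + 1)), _ := fun t ht =>
        hV i (hi (a := ⟨t, (τ n).2.1.trans ht.1, ht.2.trans (τ (n + 1)).2.2⟩) ⟨ht.1, ht.2⟩)
          (hn.trans ht.1)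
      have hstep : energy D t₀ lam u η (τ n) (τ (n + 1))
          = localAction D ρ u η (τ n) - localAction D ρ u η (τ (n + 1)) := by
        rcases hle.eq_or_lt with heq | hlt
        · rw [← heq, energy_self, sub_self]
        · rw [energy_eq_of_primitive (hα i) hv hl hn hlt fun t ht => (hdat t ht).1,
            (hdat _ (left_mem_Icc.2 hle)).2, (hdat _ (right_mem_Icc.2 hle)).2]
          ring
      rw [energy_add hv hl ha (τ n).2.1 hle, ih, hstep]
      ring
  have h := key m
  rwa [hm m le_rfl] at h

theorem energy_nonneg (hv : IsTemporalVortex D t₀ lam u η) (hl : IsConformalFactor t₀ lam)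
    {a : ℝ} (ha : t₀ ≤ a) (b : ℝ) : 0 ≤ energy D t₀ lam u η a b := by
  refine setIntegral_nonneg (isCompact_cylRect a b).measurableSet fun p hp => ?_
  have hp' := cylRect_subset_halfCyl ha b hp
  rw [hv.energyDensity_mul_eq hl hp', ← normLie_sq]
  have := (hl.pos p hp').le
  positivity

/-- The energy grows at least linearly while the loops are far from being constant. -/
theorem le_energy (hv : IsTemporalVortex D t₀ lam u η) (hl : IsConformalFactor t₀ lam)
    {a b m : ℝ} (ha : t₀ ≤ a) (hab : a ≤ b) (hm : 0 ≤ m)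
    (h : ∀ t ∈ Icc a b, m ≤ ∫ θ in (0 : ℝ)..(2 * Real.pi),
      D.normTan (u (t, θ)) (covTheta (E := E) G t₀ u η (t, θ))) :
    (b - a) * (m ^ 2 / (2 * Real.pi)) ≤ energy D t₀ lam u η a b := by
  have hpi : (0 : ℝ) < 2 * Real.pi := by positivity
  set k : ℝ := m / (2 * Real.pi)
  have hk : 0 ≤ k := by positivity
  have hsub := cylRect_subset_halfCyl ha b
  have hmeas : MeasurableSet (cylRect a b) := (isCompact_cylRect a b).measurableSet
  -- The Cauchy–Schwarz inequality in the form `y² ≥ 2 k y - k²`, with the optimal `k = m / 2π`,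
  -- where `m` bounds the integrals over the circles from below.
  let f : ℝ × ℝ → ℝ := fun p =>
    2 * k * D.normTan (u p) (covTheta (E := E) G t₀ u η p) - k ^ 2
  have hf : ContinuousOn f (halfCyl t₀) :=
    (continuousOn_const.mul hv.continuousOn_normTan).sub continuousOn_const
  have hfi : IntegrableOn f (cylRect a b) :=
    (hf.mono hsub).integrableOn_compact (isCompact_cylRect a b)
  have h1 : ∫ p in cylRect a b, f p ≤ energy D t₀ lam u η a b := by
    refine setIntegral_mono_on hfi (hv.integrableOn_energyDensity hl ha b) hmeas fun p hp => ?_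
    rw [hv.energyDensity_mul_eq hl (hsub hp), ← normLie_sq]
    have h2 := (hl.pos p (hsub hp)).le
    have h3 : 0 ≤ lam p * D.normLie (D.μ (u p)) ^ 2 := by positivity
    have h4 := sq_nonneg (D.normTan (u p) (covTheta (E := E) G t₀ u η p) - k)
    simp only [f]
    nlinarith
  refine le_trans ?_ h1
  rw [cylRect, Measure.volume_eq_prod] at hfi ⊢
  rw [setIntegral_prod f hfi]
  have hinner : IntegrableOn (fun t => ∫ θ in Icc 0 (2 * Real.pi), f (t, θ)) (Icc a b) := by
    rw [IntegrableOn, ← Measure.prod_restrict] at hfi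
    exact hfi.integral_prod_left
  have hconst : ∫ _t in Icc a b, m ^ 2 / (2 * Real.pi) = (b - a) * (m ^ 2 / (2 * Real.pi)) := by
    simp [measureReal_def, Real.volume_Icc, ENNReal.toReal_ofReal (sub_nonneg.2 hab)]
  rw [← hconst]
  refine setIntegral_mono_on (integrableOn_const (by simp)) hinner measurableSet_Icc fun t ht => ?_
  have ht0 := ha.trans ht.1
  rw [integral_Icc_eq_integral_Ioc, ← intervalIntegral.integral_of_le hpi.le]
  simp only [f]
  have hc := continuous_normTan_slice hv ht0
  have hi1 : IntervalIntegrable (fun θ => 2 * k *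
      D.normTan (u (t, θ)) (covTheta (E := E) G t₀ u η (t, θ))) volume 0 (2 * Real.pi) :=
    (continuous_const.mul hc).intervalIntegrable _ _
  rw [intervalIntegral.integral_sub hi1 (intervalIntegrable_const),
    intervalIntegral.integral_const_mul, intervalIntegral.integral_const, sub_zero, smul_eq_mul]
  have h5 := mul_le_mul_of_nonneg_left (h t ht) (by positivity : (0 : ℝ) ≤ 2 * k)
  have h6 : 2 * k * m - 2 * Real.pi * k ^ 2 = m ^ 2 / (2 * Real.pi) := by
    simp only [k]
    field_simp
    ring
  linarith

/-- The local action tends to zero at the end of the cylinder. -/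
theorem tendsto_localAction (hcov : HasPrimitives D ρ₀ C) (hC : 0 < C) (hρ : ρ ≤ ρ₀)
    (hv : IsTemporalVortex D t₀ lam u η) (hl : IsConformalFactor t₀ lam)
    (hcap : ∀ t : ℝ, t₀ ≤ t → ∃ (c : ℝ × ℝ → X) (z₀ : X) (g : ℝ → G),
      IsCapping D ρ (fun θ => u (t, θ)) c z₀ g) {ε : ℝ}
    (hε : ∀ p ∈ halfCyl t₀, D.normTan (u p) (covTheta (E := E) G t₀ u η p) ≤ ε) :
    Tendsto (localAction D ρ u η) atTop (𝓝 0) := by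
  have hpi : (0 : ℝ) < 2 * Real.pi := by positivity
  have hen : ∀ {a b : ℝ}, t₀ ≤ a → a ≤ b → energy D t₀ lam u η a b
      = localAction D ρ u η a - localAction D ρ u η b := fun ha hab =>
    energy_eq_sub hcov hρ hv hl hcap ha hab
  have hanti : ∀ {a b : ℝ}, t₀ ≤ a → a ≤ b → localAction D ρ u η b ≤ localAction D ρ u η a :=
    fun {a b} ha hab => by
      have h1 := energy_nonneg hv hl ha b
      rw [hen ha hab] at h1
      linarith
  have hbd : ∀ t, t₀ ≤ t → |localAction D ρ u η t| ≤ C * (2 * Real.pi * ε) := by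
    intro t ht
    refine (abs_localAction_le hcov hρ hv hcap ht).trans (mul_le_mul_of_nonneg_left ?_ hC.le)
    have h1 : ∫ θ in (0 : ℝ)..(2 * Real.pi),
        D.normTan (u (t, θ)) (covTheta (E := E) G t₀ u η (t, θ))
        ≤ ∫ _θ in (0 : ℝ)..(2 * Real.pi), ε :=
      intervalIntegral.integral_mono_on hpi.le
        ((continuous_normTan_slice hv ht).intervalIntegrable _ _) intervalIntegrable_const
        fun θ _ => hε (t, θ) ⟨ht, mem_univ _⟩
    rwa [intervalIntegral.integral_const, sub_zero, smul_eq_mul] at h1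
  have hsmall : ∀ δ : ℝ, 0 < δ → ∀ a, t₀ ≤ a → ∃ t, a ≤ t ∧ |localAction D ρ u η t| < δ := by
    intro δ hδ a ha
    by_contra! hcon
    set κ : ℝ := (δ / C) ^ 2 / (2 * Real.pi)
    have hκ : 0 < κ := by positivity
    set M : ℝ := C * (2 * Real.pi * ε)
    have hM : 0 ≤ M := (abs_nonneg _).trans (hbd a ha)
    -- While `|𝓛| ≥ δ`, the integral over each circle is at least `δ / C` and the energy grows at
    -- rate at least `κ`. Up to time `b` it would reach `2 M + 1`, but it is a difference of two
    -- values of modulus at most `M`.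
    set b : ℝ := a + (2 * M + 1) / κ
    have hab : a ≤ b := le_add_of_nonneg_right (by positivity)
    have h1 := le_energy hv hl ha hab (m := δ / C) (by positivity) fun t ht => by
      rw [div_le_iff₀' hC]
      exact (hcon t ht.1).trans (abs_localAction_le hcov hρ hv hcap (ha.trans ht.1))
    rw [hen ha hab] at h1
    have h2 : (b - a) * κ = 2 * M + 1 := by
      simp only [b, add_sub_cancel_left]
      field_simp
    have h3 := (abs_le.1 (hbd a ha)).2
    have h4 := (abs_le.1 (hbd b (ha.trans hab))).1
    linarith
  rw [Metric.tendsto_atTop]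
  intro δ hδ
  -- A later time `t` lies between two times of small action, and monotonicity squeezes the value at
  -- `t`.
  obtain ⟨a, ha, haδ⟩ := hsmall δ hδ t₀ le_rfl
  refine ⟨a, fun t ht => ?_⟩
  obtain ⟨b, hb, hbδ⟩ := hsmall δ hδ t (ha.trans ht)
  rw [Real.dist_eq, sub_zero, abs_lt]
  have h1 := hanti ha ht
  have h2 := hanti (ha.trans ht) hb
  exact ⟨by linarith [(abs_lt.1 hbδ).1], by linarith [(abs_lt.1 haδ).2]⟩

end LocalActionTheory
end SympVortex

end

/-! ### The proposition. -/

open SympVortex in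
theorem mainTheorem3
    {F : Type*} [NormedAddCommGroup F] [NormedSpace ℝ F] [FiniteDimensional ℝ F]
    {E : Type*} [NormedAddCommGroup E] [NormedSpace ℝ E] [FiniteDimensional ℝ E]
    {G : Type*} [TopologicalSpace G] [ChartedSpace F G] [Group G] [LieGroup 𝓘(ℝ, F) ∞ G]
    [CompactSpace G] [ConnectedSpace G]
    {X : Type*} [MetricSpace X] [CompactSpace X] [ChartedSpace E X] [IsManifold 𝓘(ℝ, E) ∞ X]
    [MulAction G X] [ContMDiffSMul 𝓘(ℝ, F) 𝓘(ℝ, E) ∞ G X]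
    (D : HamiltonianSpace F E G X) :
    ∃ ρ₀ : ℝ, 0 < ρ₀ ∧ ∀ ρ : ℝ, 0 < ρ → ρ ≤ ρ₀ → ∃ ε : ℝ, 0 < ε ∧
      ∀ (t₀ : ℝ) (lam : ℝ × ℝ → ℝ) (u : ℝ × ℝ → X) (η : ℝ × ℝ → F),
        IsConformalFactor t₀ lam →
        IsTemporalVortex D t₀ lam u η →
        (∀ p ∈ halfCyl t₀, D.normTan (u p) (covDeriv G t₀ u η (0, 1) p) ≤ ε) →
        (∀ p ∈ halfCyl t₀, D.normLie (D.μ (u p)) ≤ ε) →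
        (∀ t : ℝ, t₀ ≤ t →
          ∃! a : ℝ, a ∈ actionValues D ρ (fun θ => u (t, θ)) (fun θ => η (t, θ))) ∧
        (∀ t₁ t₂ : ℝ, t₀ ≤ t₁ → t₁ ≤ t₂ →
          IntegrableOn (fun p => energyDensity D t₀ lam u (fun _ => 0) η p * lam p)
            (cylRect t₁ t₂) ∧
          energy D t₀ lam u η t₁ t₂ = localAction D ρ u η t₁ - localAction D ρ u η t₂) ∧
        Tendsto (localAction D ρ u η) atTop (𝓝 0) := by
  -- The constant `ρ₀` secures independence of the capping, while `ε`, chosen after `ρ`, secures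
  -- existence.
  obtain ⟨ρ₀, hρ₀, C, hC, hcov⟩ := exists_moment_primitives D
  refine ⟨ρ₀, hρ₀, fun ρ hρ hρρ₀ => ?_⟩
  obtain ⟨ε, hε, hcapε⟩ := exists_capping D hρ
  refine ⟨ε, hε, fun t₀ lam u η hl hv hξ hμ => ?_⟩
  have hcap : ∀ t : ℝ, t₀ ≤ t → ∃ (c : ℝ × ℝ → X) (z₀ : X) (g : ℝ → G),
      IsCapping D ρ (fun θ => u (t, θ)) c z₀ g := by
    intro t ht
    refine hcapε _ (fun θ => η (t, θ)) (contMDiff_slice hv.u_smooth ht)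
      (by simpa using hv.u_periodic t 0 ht) (hμ (t, 0) ⟨ht, mem_univ _⟩) fun θ _ => ?_
    rw [curveD_slice hv.u_smooth ht]
    exact hξ (t, θ) ⟨ht, mem_univ _⟩
  exact ⟨fun t ht => existsUnique_action hcov hρρ₀ (contMDiff_slice hv.u_smooth ht)
      (continuous_slice hv.a₂_smooth ht) (hcap t ht),
    fun t₁ t₂ h₁ h₂ => ⟨hv.integrableOn_energyDensity hl h₁ t₂,
      energy_eq_sub hcov hρρ₀ hv hl hcap h₁ h₂⟩,
    tendsto_localAction hcov hC hρρ₀ hv hl hcap hξ⟩
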